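/- Let $K$ be a complete discretely valued field with ring of integers $\mathcal O_K$ and uniformizer $\pi$, let $n\ge 0$ and $m\in\mathbb Z$. Let $\chi$ be the map sending a matrix in $M_n(K)$ to its characteristic polynomial, and for $M\in M_n(K)$ let $d\chi_M : M_n(K)\to K_{<n}[X]$ be its differential at $M$, where $K_{<n}[X]$ is the space of polynomials of degree less than $n$. The precision lattice of $\chi_M$, when $M$ is known at flat precision $O(\pi^m)$, is $d\chi_M(\pi^m M_n(\mathcal O_K))$; the lattice $O(\pi^m)$ in $K_{<n}[X]$ is $\pi^m\mathcal O_K[X]\cap K_{<n}[X]$. A matrix $A\in M_n(k)$ over a field $k$ has a cyclic vector if there is $v\in k^n$ such that $v, Av, A^2v,\dots$ span $k^n$. (1) Let $M\in \mathrm{GL}_n(\mathcal O_K)$. Then $\chi$ is differentiable at $M$, and $$d\chi_M(\pi^m M_n(\mathcal O_K))\subsetneq \pi^m\mathcal O_K[X]\cap K_{<n}[X]$$ if and only if the reduction of $M$ modulo $\pi$ does not have a cyclic vector. (2) This criterion is checkable in $O\tilde{~}(n^\omega)$ operations in the residue field. Precisely, let $\omega\in\mathbb R$ be such that two $n\times n$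 matrices over a commutative ring can be multiplied in $O(n^\omega)$ ring operations, that is, by straight-line programs (one for each $n$, with integer constants, valid over every commutative ring) of that length. Then there are $\kappa\in\mathbb N$ and algebraic computation trees $T_n$, $n\ge 0$ (with integer constants, the operations $+,-,\times,/$ and tests for zero, each at unit cost), independent of $K$, whose worst-case cost is $O(n^\omega\log(n)^\kappa)$ as $n\to\infty$, such that for every complete discretely valued field $K$ with residue field $k$, every $n\ge 0$ and every $A\in M_n(k)$, the tree $T_n$ on input the entries of $A$ never divides by zero and correctly decides whether $A$ has no cyclic vector. -/

import Mathlib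

/-! ### Matrices over a complete discretely valued field and precision lattices -/

section Precision

/-- The ring of integers `{x | ‖x‖ ≤ 1}` of a nonarchimedean valued field. -/
noncomputable abbrev IntegerRing (K : Type*) [NormedField K] [IsUltrametricDist K] : ValuationSubring K :=
  (NormedField.valuation (K := K)).valuationSubring

variable {K : Type*} [NontriviallyNormedField K] [IsUltrametricDist K]

/-- `O(π ^ m)` in `K`: the fractional ideal of the ring of integers generated by `π ^ m`. -/
noncomputable def bigO (π : IntegerRing K) (m : ℤ) : Submodule (IntegerRing K) K :=
  Submodule.span (IntegerRing K) {(π : K) ^ m}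

/-- The flat lattice `O(π ^ m)` in the tangent space `M_n(K)` of the space of matrices. -/
noncomputable def flatMatrixLattice (π : IntegerRing K) (m : ℤ) (n : ℕ) :
    Submodule (IntegerRing K) (Matrix (Fin n) (Fin n) K) where
  carrier := {A | ∀ i j, A i j ∈ bigO π m}
  add_mem' ha hb i j := (bigO π m).add_mem (ha i j) (hb i j)
  zero_mem' _ _ := (bigO π m).zero_mem
  smul_mem' c _ ha i j := (bigO π m).smul_mem c (ha i j)

/-- The flat lattice `O(π ^ m)` in the space `K_{<n}[X]` of polynomials of degree less than `n`,
which is the tangent space of the space of monic polynomials of degree `n`. -/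
noncomputable def flatPolyLattice (π : IntegerRing K) (m : ℤ) (n : ℕ) :
    Submodule (IntegerRing K) (Polynomial.degreeLT K n) where
  carrier := {P | ∀ i, (P : Polynomial K).coeff i ∈ bigO π m}
  add_mem' {a b} ha hb i := by
    simpa using (bigO π m).add_mem (ha i) (hb i)
  zero_mem' i := by simp
  smul_mem' c a ha i := by
    have h := (bigO π m).smul_mem c (ha i)
    rwa [← Polynomial.coeff_smul] at h

/-- The characteristic polynomial map, the monic polynomial `X ^ n + ∑ i < n, a_i X ^ i` being
given by its coordinates `(a_0, …, a_{n-1})`. -/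
noncomputable def charpolyMap (K : Type*) [Field K] (n : ℕ) (A : Matrix (Fin n) (Fin n) K) :
    Fin n → K :=
  fun i => A.charpoly.coeff i

/-- The differential at `A` of the characteristic polynomial map, as a linear map from `M_n(K)` to
the space of polynomials of degree less than `n`. -/
noncomputable def charpolyDifferential {n : ℕ} (A : Matrix (Fin n) (Fin n) K) :
    Matrix (Fin n) (Fin n) K →ₗ[K] Polynomial.degreeLT K n :=
  (Polynomial.degreeLTEquiv K n).symm.toLinearMap ∘ₗ
    (fderiv K (charpolyMap K n) A).toLinearMap

/-- The precision lattice of the characteristic polynomial of a matrix `A` known at flat precision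
`O(π ^ m)`: the image of the flat lattice `O(π ^ m)` under the differential at `A`. -/
noncomputable def charpolyPrecision {n : ℕ} (A : Matrix (Fin n) (Fin n) K) (π : IntegerRing K)
    (m : ℤ) : Submodule (IntegerRing K) (Polynomial.degreeLT K n) :=
  (flatMatrixLattice π m n).map ((charpolyDifferential A).restrictScalars (IntegerRing K))

end Precision

/-- A square matrix over a field has a cyclic vector `v` if `v, A v, A² v, …` span the space. -/
def HasCyclicVector {k : Type*} [Field k] {n : ℕ} (A : Matrix (Fin n) (Fin n) k) : Prop :=
  ∃ v : Fin n → k, Submodule.span k (Set.range fun i : ℕ => (A ^ i).mulVec v) = ⊤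

/-! ### Algebraic computations and their cost

The model is the standard one of algebraic complexity theory: straight-line programs over rings and
algebraic computation trees over fields.  The type `σ` indexes the ring elements available so far
(at the start, the inputs); each arithmetic instruction adds one more, which gets the index
`none : Option σ`.  Programs do not depend on the ring: their only constants are integers. -/

/-- A ring operation applied to available elements. -/
inductive RingOp (σ : Type) : Type
  | const (z : ℤ)
  | add (i j : σ)
  | sub (i j : σ)
  | mul (i j : σ)

/-- The value of a ring operation. -/
def RingOp.eval {R : Type*} [CommRing R] {σ : Type} (x : σ → R) : RingOp σ → R
  | .const z => (z : R)
  | .add i j => x i + x j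
  | .sub i j => x i - x j
  | .mul i j => x i * x j

/-- The available elements after one more element `a` has been computed. -/
def extend {R : Type*} {σ : Type} (x : σ → R) (a : R) : Option σ → R
  | none => a
  | some i => x i

/-- Straight-line programs over rings with outputs indexed by `ι`. -/
inductive StraightLine (ι : Type) : Type → Type 1
  | output {σ : Type} (out : ι → σ) : StraightLine ι σ
  | step {σ : Type} (op : RingOp σ) (rest : StraightLine ι (Option σ)) : StraightLine ι σ

/-- The number of operations of a straight-line program. -/
def StraightLine.cost {ι : Type} : {σ : Type} → StraightLine ι σ → ℕ
  | _, .output _ => 0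
  | _, .step _ rest => rest.cost + 1

/-- The outputs of a straight-line program. -/
def StraightLine.eval {R : Type*} [CommRing R] {ι : Type} :
    {σ : Type} → StraightLine ι σ → (σ → R) → ι → R
  | _, .output out, x => fun i => x (out i)
  | _, .step op rest, x => rest.eval (extend x (op.eval x))

/-- Algebraic computation trees over fields: arithmetic operations, divisions, branchings on
whether an element is zero, and yes/no answers at the leaves. -/
inductive ComputationTree : Type → Type 1
  | answer {σ : Type} (b : Bool) : ComputationTree σ
  | step {σ : Type} (op : RingOp σ) (rest : ComputationTree (Option σ)) : ComputationTree σ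
  | div {σ : Type} (i j : σ) (rest : ComputationTree (Option σ)) : ComputationTree σ
  | branch {σ : Type} (i : σ) (ifZero ifNonzero : ComputationTree σ) : ComputationTree σ

/-- The worst-case number of operations (arithmetic operations and zero tests) of a computation
tree. -/
def ComputationTree.cost : {σ : Type} → ComputationTree σ → ℕ
  | _, .answer _ => 0
  | _, .step _ rest => rest.cost + 1
  | _, .div _ _ rest => rest.cost + 1
  | _, .branch _ t e => max t.cost e.cost + 1

/-- On the input `x`, the computation never divides by zero, and it answers `true` if and only if
`P` holds. -/
def ComputationTree.Decides {k : Type*} [Field k] (P : Prop) :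
    {σ : Type} → ComputationTree σ → (σ → k) → Prop
  | _, .answer b, _ => (b = true ↔ P)
  | _, .step op rest, x => rest.Decides P (extend x (op.eval x))
  | _, .div i j rest, x => x j ≠ 0 ∧ rest.Decides P (extend x (x i / x j))
  | _, .branch i t e, x => (x i = 0 → t.Decides P x) ∧ (x i ≠ 0 → e.Decides P x)

universe u

/-- Two `n × n` matrices over a ring can be multiplied in `O(n ^ ω)` operations in the ring. -/
def IsMatMulExponent (ω : ℝ) : Prop :=
  ∃ S : (n : ℕ) → StraightLine (Fin n × Fin n) ((Fin n × Fin n) ⊕ (Fin n × Fin n)),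
    (fun n : ℕ => ((S n).cost : ℝ)) =O[Filter.atTop] (fun n : ℕ => (n : ℝ) ^ ω) ∧
    ∀ (n : ℕ) (R : Type u) [CommRing R] (A B : Matrix (Fin n) (Fin n) R) (i j : Fin n),
      (S n).eval (Sum.elim (fun p => A p.1 p.2) (fun p => B p.1 p.2)) (i, j) = (A * B) i j

/-! Criterion. By Jacobi's formula dχ_M(N) = -tr(adj(X - M) N). The coefficient of X^i in adj(X - M)
is the polynomial quotient of χ_M by X^(i+1), evaluated at M (`adjugateCoeff_eq`). For i < n these
quotients are monic of degree n-1-i, hence a basis of the polynomials of degree less than n. As the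
trace form is nondegenerate, over a field the differential is onto exactly when no nonzero
polynomial of degree less than n kills M (`surjective_charpolyTangent_iff`), which is equivalent to
having a cyclic vector (`hasCyclicVector_iff_nonderogatory`). Over the ring of integers the same
formula is integral, so the image always lies in the flat lattice. After division by π^m, equality
means surjectivity of a linear map of finite free modules, and Nakayama's lemma moves this to the
residue field.

Cost. A deterministic divide and conquer computes a column that is cyclic whenever some column is;
the answer is then read off from whether its Krylov matrix K satisfies K * pinv K = 1. Generalized
inverses come from a block recursion with four calls in half the size and no pivoting (`ginv`).
Since ω ≥ 2, proved by counting the outputs of matrix multiplication, this costs only a logarithmic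
factor over a product. For the cyclic column, start from generators of the space under A, at first
the unit vectors, and halve the set of generators. The first half generates an invariant subspace,
reached by repeated doubling (`krylovProj`). In an adapted basis A becomes block triangular, and
each diagonal block comes with half as many generators. Recursion gives cyclic columns of both
blocks, and `isCyclicColumn_mergeColumns` glues them by an explicit Fitting decomposition. Block
sizes add up to the original size and the budget is superadditive, so each of the log n levels costs
about as much as one level at full size.

Bookkeeping. A quantity is a function on the type `W` of all inputs, so that one tree serves all
fields. `Computes` is in continuation-passing style: it turns any tree that uses the new quantities
into one that does not, at an additional cost. The continuation may be duplicated at every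
branching, but the cost is that of the longest path, so costs still add. -/

/-! ### Calculus of costs for computation trees -/

section ComputationModel

variable {W : Type*} {K : W → Type u} [∀ w, Field (K w)]

/-- On every part of `D`, the quantities in `S` being available, some computation tree of cost at
most `c` decides `P`. -/
def Solvable (c : ℝ) (D : Set W) (S : Set (∀ w, K w)) (P : W → Prop) : Prop :=
  ∀ D' ⊆ D, ∀ (σ : Type) (v : σ → ∀ w, K w), (∀ f ∈ S, ∃ s, ∀ w ∈ D', v s w = f w) →
    ∃ t : ComputationTree σ, (t.cost : ℝ) ≤ c ∧ ∀ w ∈ D', t.Decides (P w) (fun s => v s w)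

/-- Quantities need to agree only on the smaller domain. This is how knowledge gained from a zero
test enters: an expression may be replaced by one that equals it on the current branch. -/
theorem Solvable.mono {c c' : ℝ} {D D' : Set W} {S S' : Set (∀ w, K w)} {P : W → Prop}
    (h : Solvable c D S P) (hc : c ≤ c') (hD : D' ⊆ D)
    (hS : ∀ f ∈ S, ∃ g ∈ S', ∀ w ∈ D', f w = g w) :
    Solvable c' D' S' P := by
  intro E hE σ v hv
  obtain ⟨t, ht, ht'⟩ := h E (hE.trans hD) σ v (fun f hf => by
    obtain ⟨g, hg, hfg⟩ := hS f hf
    obtain ⟨s, hs⟩ := hv g hg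
    exact ⟨s, fun w hw => (hs w hw).trans (hfg w (hE hw)).symm⟩)
  exact ⟨t, ht.trans hc, ht'⟩

theorem Solvable.answer (b : Bool) {c : ℝ} {D : Set W} {S : Set (∀ w, K w)} {P : W → Prop}
    (hc : 0 ≤ c) (h : ∀ w ∈ D, b = true ↔ P w) : Solvable c D S P := fun _ hE _ _ _ =>
  ⟨.answer b, by simpa [ComputationTree.cost] using hc, fun w hw => h w (hE hw)⟩

theorem Solvable.step {c : ℝ} {D : Set W} {S : Set (∀ w, K w)} {P : W → Prop} {h : ∀ w, K w}
    (hop : ∀ (σ : Type) (v : σ → ∀ w, K w) (D' : Set W), (∀ f ∈ S, ∃ s, ∀ w ∈ D', v s w = f w) →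
      ∃ op : RingOp σ, ∀ w ∈ D', op.eval (fun s => v s w) = h w)
    (hr : Solvable c D (insert h S) P) : Solvable (c + 1) D S P := by
  intro E hE σ v hv
  obtain ⟨op, hop⟩ := hop σ v E hv
  obtain ⟨t, ht, ht'⟩ := hr E hE (Option σ)
    (fun s w => extend (fun s => v s w) (op.eval (fun s => v s w)) s) (by
      rintro f (rfl | hf)
      · exact ⟨none, fun w hw => hop w hw⟩
      · obtain ⟨s, hs⟩ := hv f hf
        exact ⟨some s, hs⟩)
  refine ⟨.step op t, ?_, fun w hw => ht' w hw⟩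
  simp only [ComputationTree.cost]
  push_cast
  linarith

theorem Solvable.div {c : ℝ} {D : Set W} {S : Set (∀ w, K w)} {P : W → Prop} {f g : ∀ w, K w}
    (hf : f ∈ S) (hg : g ∈ S) (h0 : ∀ w ∈ D, g w ≠ 0)
    (hr : Solvable c D (insert (fun w => f w / g w) S) P) : Solvable (c + 1) D S P := by
  intro E hE σ v hv
  obtain ⟨i, hi⟩ := hv f hf
  obtain ⟨j, hj⟩ := hv g hg
  obtain ⟨t, ht, ht'⟩ := hr E hE (Option σ)
    (fun s w => extend (fun s => v s w) (v i w / v j w) s) (by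
      rintro _ (rfl | hf)
      · exact ⟨none, fun w hw => by simp [extend, hi w hw, hj w hw]⟩
      · obtain ⟨s, hs⟩ := hv _ hf
        exact ⟨some s, hs⟩)
  refine ⟨.div i j t, ?_, fun w hw => ⟨(hj w hw).trans_ne (h0 w (hE hw)), ht' w hw⟩⟩
  simp only [ComputationTree.cost]
  push_cast
  linarith

theorem Solvable.branch {c : ℝ} {D : Set W} {S : Set (∀ w, K w)} {P : W → Prop} {f : ∀ w, K w}
    (hf : f ∈ S) (h0 : Solvable c (D ∩ {w | f w = 0}) S P)
    (h1 : Solvable c (D ∩ {w | f w ≠ 0}) S P) : Solvable (c + 1) D S P := by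
  intro E hE σ v hv
  obtain ⟨i, hi⟩ := hv f hf
  have key : ∀ F ⊆ E, ∀ f ∈ S, ∃ s, ∀ w ∈ F, v s w = f w := fun F hF f hf =>
    (hv f hf).imp fun s hs w hw => hs w (hF hw)
  obtain ⟨t, ht, ht'⟩ := h0 (E ∩ {w | f w = 0}) (Set.inter_subset_inter_left _ hE) σ v
    (key _ Set.inter_subset_left)
  obtain ⟨e, he, he'⟩ := h1 (E ∩ {w | f w ≠ 0}) (Set.inter_subset_inter_left _ hE) σ v
    (key _ Set.inter_subset_left)
  refine ⟨.branch i t e, ?_, fun w hw => ⟨fun h => ht' w ⟨hw, ?_⟩, fun h => he' w ⟨hw, ?_⟩⟩⟩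
  · simp only [ComputationTree.cost]
    push_cast
    linarith [max_le ht he]
  · exact (hi w hw).symm.trans h
  · exact fun h' => h ((hi w hw).trans h')

/-- On every part of `D`, the quantities in `T` can be computed from those in `S` by computation
trees of cost at most `c`. -/
def Computes (c : ℝ) (D : Set W) (S T : Set (∀ w, K w)) : Prop :=
  ∀ D' ⊆ D, ∀ S', S ⊆ S' → ∀ (P : W → Prop) (c' : ℝ),
    Solvable c' D' (S' ∪ T) P → Solvable (c' + c) D' S' P

namespace Computes

variable {c c₁ c₂ : ℝ} {D : Set W} {S S' T U : Set (∀ w, K w)}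

theorem congr (h : Computes c D S T) (hS : ∀ f ∈ S, ∃ g ∈ S', ∀ w ∈ D, f w = g w)
    (hU : ∀ f ∈ U, ∃ g ∈ T, ∀ w ∈ D, f w = g w) : Computes c D S' U := by
  intro D' hD R hR P c' hs
  refine (h D' hD (R ∪ S) Set.subset_union_right P c' (hs.mono le_rfl subset_rfl ?_)).mono le_rfl
    subset_rfl ?_
  · rintro f (hf | hf)
    · exact ⟨f, .inl (.inl hf), fun _ _ => rfl⟩
    · obtain ⟨g, hg, hfg⟩ := hU f hf
      exact ⟨g, .inr hg, fun w hw => hfg w (hD hw)⟩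
  · rintro f (hf | hf)
    · exact ⟨f, hf, fun _ _ => rfl⟩
    · obtain ⟨g, hg, hfg⟩ := hS f hf
      exact ⟨g, hR hg, fun w hw => hfg w (hD hw)⟩

theorem mono (h : Computes c₁ D S T) (hc : c₁ ≤ c₂) (hS : S ⊆ S') (hU : U ⊆ T) :
    Computes c₂ D S' U := by
  have h' := h.congr (S' := S') (U := U) (fun f hf => ⟨f, hS hf, fun _ _ => rfl⟩)
    (fun f hf => ⟨f, hU hf, fun _ _ => rfl⟩)
  exact fun D' hD R hR P c' hs => (h' D' hD R hR P c' hs).mono (by linarith) subset_rfl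
    fun f hf => ⟨f, hf, fun _ _ => rfl⟩

theorem of_le (h : Computes c₁ D S T) (hc : c₁ ≤ c₂) : Computes c₂ D S T :=
  h.mono hc subset_rfl subset_rfl

theorem weaken (h : Computes c D S T) (hS : S ⊆ S') : Computes c D S' T :=
  h.mono le_rfl hS subset_rfl

theorem restrict {D' : Set W} (h : Computes c D S T) (hD : D' ⊆ D) : Computes c D' S T :=
  fun E hE => h E (hE.trans hD)

theorem of_subset (h : T ⊆ S) : Computes 0 D S T := fun D' _ R hR P c' hs => by
  rw [add_zero]
  refine hs.mono le_rfl subset_rfl ?_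
  rintro f (hf | hf)
  · exact ⟨f, hf, fun _ _ => rfl⟩
  · exact ⟨f, hR (h hf), fun _ _ => rfl⟩

/-- The continuation of the first computation is the second one followed by the original
continuation, so the two overheads add. -/
theorem trans (h₁ : Computes c₁ D S T) (h₂ : Computes c₂ D (S ∪ T) U) :
    Computes (c₁ + c₂) D S (T ∪ U) := by
  intro D' hD R hR P c' hs
  have := h₁ D' hD R hR P _ (h₂ D' hD (R ∪ T) (Set.union_subset_union_left _ hR) P c'
    (by rwa [Set.union_assoc]))
  exact this.mono (by linarith) subset_rfl fun f hf => ⟨f, hf, fun _ _ => rfl⟩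

theorem union (h₁ : Computes c₁ D S T) (h₂ : Computes c₂ D S U) :
    Computes (c₁ + c₂) D S (T ∪ U) :=
  h₁.trans (h₂.weaken Set.subset_union_left)

/-- Computed quantities can be shared. -/
theorem bind (h₁ : Computes c₁ D S T)
    (h₂ : ∀ S', S ⊆ S' → T ⊆ S' → Computes c₂ D S' U) : Computes (c₁ + c₂) D S U :=
  (h₁.trans (h₂ _ Set.subset_union_left Set.subset_union_right)).mono le_rfl subset_rfl
    Set.subset_union_right

theorem iUnion {ι : Type*} [Finite ι] {T : ι → Set (∀ w, K w)}
    (h : ∀ i, Computes c D S (T i)) :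
    Computes (Nat.card ι * c) D S (⋃ i, T i) := by
  classical
  have := Fintype.ofFinite ι
  have key : ∀ s : Finset ι, Computes (s.card * c) D S (⋃ i ∈ s, T i) := by
    intro s
    induction s using Finset.induction_on with
    | empty => simpa using of_subset (Set.empty_subset S)
    | insert a s ha ih =>
      rw [Finset.card_insert_of_notMem ha, Finset.set_biUnion_insert]
      exact ((h a).union ih).of_le (by push_cast; linarith)
  simpa using key Finset.univ

theorem ringOp {h : ∀ w, K w}
    (hop : ∀ (σ : Type) (v : σ → ∀ w, K w) (D' : Set W), (∀ f ∈ S, ∃ s, ∀ w ∈ D', v s w = f w) →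
      ∃ op : RingOp σ, ∀ w ∈ D', op.eval (fun s => v s w) = h w) :
    Computes 1 D S {h} := by
  intro D' _ R hR P c' hs
  refine Solvable.step (h := h) (fun σ v E hv => hop σ v E fun f hf => hv f (hR hf)) ?_
  rwa [Set.insert_eq, Set.union_comm]

theorem const (z : ℤ) : Computes 1 D S {fun w => (z : K w)} :=
  ringOp fun _ _ _ _ => ⟨.const z, fun _ _ => rfl⟩

theorem zero : Computes 1 D S {fun w => (0 : K w)} := by
  simpa using const (K := K) (D := D) (S := S) 0

theorem one : Computes 1 D S {fun w => (1 : K w)} := by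
  simpa using const (K := K) (D := D) (S := S) 1

theorem add {f g : ∀ w, K w} (hf : f ∈ S) (hg : g ∈ S) :
    Computes 1 D S {fun w => f w + g w} := ringOp fun σ v E hv => by
  obtain ⟨i, hi⟩ := hv f hf
  obtain ⟨j, hj⟩ := hv g hg
  exact ⟨.add i j, fun w hw => by simp [RingOp.eval, hi w hw, hj w hw]⟩

theorem sub {f g : ∀ w, K w} (hf : f ∈ S) (hg : g ∈ S) :
    Computes 1 D S {fun w => f w - g w} := ringOp fun σ v E hv => by
  obtain ⟨i, hi⟩ := hv f hf
  obtain ⟨j, hj⟩ := hv g hg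
  exact ⟨.sub i j, fun w hw => by simp [RingOp.eval, hi w hw, hj w hw]⟩

theorem mul {f g : ∀ w, K w} (hf : f ∈ S) (hg : g ∈ S) :
    Computes 1 D S {fun w => f w * g w} := ringOp fun σ v E hv => by
  obtain ⟨i, hi⟩ := hv f hf
  obtain ⟨j, hj⟩ := hv g hg
  exact ⟨.mul i j, fun w hw => by simp [RingOp.eval, hi w hw, hj w hw]⟩

/-- Both branches run the same continuation. The cost of a tree takes the maximum over the branches,
so only the test itself is charged. -/
theorem branch {f : ∀ w, K w} (hf : f ∈ S) (h0 : Computes c (D ∩ {w | f w = 0}) S T)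
    (h1 : Computes c (D ∩ {w | f w ≠ 0}) S T) : Computes (c + 1) D S T := by
  intro D' hD R hR P c' hs
  rw [← add_assoc]
  have key : ∀ E ⊆ D', Solvable c' E (R ∪ T) P := fun E hE =>
    hs.mono le_rfl hE fun f hf => ⟨f, hf, fun _ _ => rfl⟩
  exact Solvable.branch (hR hf)
    (h0 _ (Set.inter_subset_inter_left _ hD) R hR P c' (key _ Set.inter_subset_left))
    (h1 _ (Set.inter_subset_inter_left _ hD) R hR P c' (key _ Set.inter_subset_left))

/-- Inversion, with `0⁻¹ = 0`. -/
theorem inv {f : ∀ w, K w} (hf : f ∈ S) : Computes 3 D S {fun w => (f w)⁻¹} := by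
  -- One zero test, then either the constant 0 or the constant 1 followed by a division.
  have h3 : (3 : ℝ) = 2 + 1 := by norm_num
  rw [h3]
  refine branch hf ?_ ?_
  · refine (zero (K := K) (S := S)).congr (fun f hf => ⟨f, hf, fun _ _ => rfl⟩) ?_ |>.of_le
      (by norm_num)
    rintro _ rfl
    exact ⟨_, rfl, fun w hw => by simp [show f w = 0 from hw.2]⟩
  · have h2 : (2 : ℝ) = 1 + 1 := by norm_num
    rw [h2]
    refine (one (K := K)).bind fun S' hS h1 => ?_
    intro D' hD R hR P c' hs
    refine Solvable.div (f := fun w => (1 : K w)) (g := f) (hR (h1 rfl)) (hR (hS hf))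
      (fun w hw => (hD hw).2) ?_
    refine hs.mono le_rfl subset_rfl ?_
    rintro g (hg | rfl)
    · exact ⟨g, .inr hg, fun _ _ => rfl⟩
    · exact ⟨_, .inl rfl, fun w _ => by simp⟩

/-- Branching on the zero pattern of a finite family of quantities. -/
theorem cases {ι : Type*} [Finite ι] (f : ι → ∀ w, K w) (hf : ∀ i, f i ∈ S)
    (h : ∀ Z : Set ι, Computes c (D ∩ {w | ∀ i, f i w = 0 ↔ i ∈ Z}) S T) :
    Computes (c + Nat.card ι) D S T := by
  classical
  have := Fintype.ofFinite ι
  -- The domain varies in the induction because each test shrinks it. The number of leaves is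
  -- exponential, but a path meets each quantity once.
  have key : ∀ (s : Finset ι) (D : Set W),
      (∀ Z : Set ι, Computes c (D ∩ {w | ∀ i ∈ s, f i w = 0 ↔ i ∈ Z}) S T) →
      Computes (c + s.card) D S T := by
    intro s
    induction s using Finset.induction_on with
    | empty => intro D h; simpa using h ∅
    | insert a s ha ih =>
      intro D h
      rw [Finset.card_insert_of_notMem ha]
      push_cast
      rw [← add_assoc]
      refine branch (hf a) (ih _ fun Z => ?_) (ih _ fun Z => ?_)
      · refine (h (insert a Z)).restrict ?_
        rintro w ⟨⟨hw, hw0⟩, hwZ⟩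
        refine ⟨hw, fun i hi => ?_⟩
        rcases Finset.mem_insert.1 hi with rfl | hi'
        · simpa using hw0
        · rw [hwZ i hi', Set.mem_insert_iff, or_iff_right]
          rintro rfl
          exact ha hi'
      · refine (h (Z \ {a})).restrict ?_
        rintro w ⟨⟨hw, hw0⟩, hwZ⟩
        refine ⟨hw, fun i hi => ?_⟩
        rcases Finset.mem_insert.1 hi with rfl | hi'
        · simpa using hw0
        · rw [hwZ i hi', Set.mem_sdiff, and_iff_left]
          rintro rfl
          exact ha hi'
  simpa using key Finset.univ D (by simpa using h)

end Computes

/-- Testing whether all quantities of a finite family vanish. -/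
theorem Solvable.forall_eq_zero {ι : Type*} [Finite ι] {D : Set W} {S : Set (∀ w, K w)}
    (f : ι → ∀ w, K w) (hf : ∀ i, f i ∈ S) (P : W → Prop)
    (hP : ∀ w ∈ D, P w ↔ ¬ ∀ i, f i w = 0) : Solvable (Nat.card ι) D S P := by
  classical
  have := Fintype.ofFinite ι
  have key : ∀ (s : Finset ι) (D : Set W), (∀ w ∈ D, P w ↔ ¬ ∀ i ∈ s, f i w = 0) →
      Solvable s.card D S P := by
    intro s
    induction s using Finset.induction_on with
    | empty =>
      intro D h
      exact Solvable.answer false (by simp) fun w hw => by simp [h w hw]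
    | insert a s ha ih =>
      intro D h
      rw [Finset.card_insert_of_notMem ha]
      push_cast
      refine Solvable.branch (hf a) (ih _ ?_) (Solvable.answer true (by simp) ?_)
      · rintro w ⟨hw, hw0⟩
        rw [h w hw, Finset.forall_mem_insert, and_iff_right (show f a w = 0 from hw0)]
      · rintro w ⟨hw, hw0⟩
        rw [h w hw, Finset.forall_mem_insert]
        exact ⟨fun _ h => hw0 h.1, fun _ => rfl⟩
  simpa using key Finset.univ D (by simpa using hP)

end ComputationModel

/-! ### Matrix arithmetic, priced in multiples of a budget -/

section MatrixComputations

/-- Multiplication of `N × N` matrices over fields, their addition, and the creation of matrices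
of zeros and ones are possible within the budget `μ`. -/
structure Budget (N : ℕ) (μ : ℝ) : Prop where
  nonneg : 0 ≤ μ
  sq_le : (N : ℝ) ^ 2 ≤ μ
  mul_le : N ≠ 0 → ∃ p : StraightLine (Fin N × Fin N) ((Fin N × Fin N) ⊕ (Fin N × Fin N)),
    (p.cost : ℝ) + 1 ≤ μ ∧ ∀ (R : Type u) [Field R] (A B : Matrix (Fin N) (Fin N) R) (i j : Fin N),
      p.eval (Sum.elim (fun p => A p.1 p.2) (fun p => B p.1 p.2)) (i, j) = (A * B) i j

theorem Budget.mono {N : ℕ} {μ ν : ℝ} (h : Budget.{u} N μ) (hμ : μ ≤ ν) : Budget.{u} N ν :=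
  ⟨h.nonneg.trans hμ, h.sq_le.trans hμ, fun hN => by
    obtain ⟨p, hp, hp'⟩ := h.mul_le hN
    exact ⟨p, hp.trans hμ, hp'⟩⟩

/-- The type `m` has at most `N` elements. -/
class SizeLE (m : Type) [Fintype m] (N : ℕ) : Prop where
  card_le : Fintype.card m ≤ N

variable {W : Type*} {K : W → Type u} [∀ w, Field (K w)]
variable {m n l o : Type} {D : Set W} {S S' : Set (∀ w, K w)}

/-- The set of entries of a varying matrix. -/
def entries (X : ∀ w, Matrix m n (K w)) : Set (∀ w, K w) :=
  Set.range fun (p : m × n) w => X w p.1 p.2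

theorem mem_entries (X : ∀ w, Matrix m n (K w)) (i : m) (j : n) :
    (fun w => X w i j) ∈ entries X := ⟨(i, j), rfl⟩

theorem entries_subset_iff {X : ∀ w, Matrix m n (K w)} :
    entries X ⊆ S ↔ ∀ i j, (fun w => X w i j) ∈ S := by
  simp [entries, Set.range_subset_iff]

/-- Straight-line programs are the branch-free computations. The multiplication programs granted by
the exponent enter the tree model here. -/
theorem Computes.straightLine {ι σ : Type} (p : StraightLine ι σ) (v : σ → ∀ w, K w)
    (hv : ∀ s, v s ∈ S) :
    Computes p.cost D S (Set.range fun i w => p.eval (fun s => v s w) i) := by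
  induction p generalizing S with
  | output out =>
    simp only [StraightLine.cost, StraightLine.eval, Nat.cast_zero]
    exact Computes.of_subset (Set.range_subset_iff.2 fun i => hv _)
  | @step σ op rest ih =>
    simp only [StraightLine.cost, StraightLine.eval]
    push_cast
    rw [add_comm]
    have hop : Computes 1 D S {fun w => op.eval (fun s => v s w)} := by
      cases op with
      | const z => exact Computes.const z
      | add i j => exact Computes.add (hv i) (hv j)
      | sub i j => exact Computes.sub (hv i) (hv j)
      | mul i j => exact Computes.mul (hv i) (hv j)
    refine hop.bind fun S' hS hT => ?_
    refine (ih (fun s w => extend (fun s => v s w) (op.eval (fun s => v s w)) s) ?_)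
    rintro (_ | s)
    · exact hT rfl
    · exact hS (hv s)

/-- The matrix `X` can be computed from `S` at a cost of `j` times the budget `μ`. -/
def Steps (μ : ℝ) (j : ℕ) (D : Set W) (S : Set (∀ w, K w)) (X : ∀ w, Matrix m n (K w)) : Prop :=
  Computes (j * μ) D S (entries X)

variable {N : ℕ} {μ : ℝ} {i j k : ℕ}

theorem Steps.of_subset {X : ∀ w, Matrix m n (K w)} (h : entries X ⊆ S) : Steps μ 0 D S X := by
  simpa [Steps] using Computes.of_subset h

theorem Steps.weaken {X : ∀ w, Matrix m n (K w)} (h : Steps μ j D S X) (hS : S ⊆ S') :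
    Steps μ j D S' X := Computes.weaken h hS

theorem Steps.congr {X Y : ∀ w, Matrix m n (K w)} (h : Steps μ j D S X)
    (hXY : ∀ w ∈ D, Y w = X w) : Steps μ j D S Y := by
  refine Computes.congr h (fun f hf => ⟨f, hf, fun _ _ => rfl⟩) ?_
  rintro _ ⟨p, rfl⟩
  exact ⟨_, ⟨p, rfl⟩, fun w hw => by simp [hXY w hw]⟩

theorem Steps.sub_entries {m' n' : Type} {X : ∀ w, Matrix m n (K w)} {Y : ∀ w, Matrix m' n' (K w)}
    (h : Steps μ j D S X) (hXY : entries Y ⊆ entries X) : Steps μ j D S Y :=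
  Computes.mono h le_rfl subset_rfl hXY

theorem Steps.submatrix {m' n' : Type} {X : ∀ w, Matrix m n (K w)} (h : Steps μ j D S X)
    (f : m' → m) (g : n' → n) : Steps μ j D S (fun w => (X w).submatrix f g) :=
  h.sub_entries (entries_subset_iff.2 fun i j => mem_entries X (f i) (g j))

theorem Steps.transpose {X : ∀ w, Matrix m n (K w)} (h : Steps μ j D S X) :
    Steps μ j D S (fun w => (X w).transpose) :=
  h.sub_entries (entries_subset_iff.2 fun i j => mem_entries X j i)

theorem Steps.of_union {m₁ n₁ m₂ n₂ : Type} {X : ∀ w, Matrix m₁ n₁ (K w)}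
    {Y : ∀ w, Matrix m₂ n₂ (K w)} {Z : ∀ w, Matrix m n (K w)} (hX : Steps μ i D S X)
    (hY : Steps μ j D S Y) (h : entries Z ⊆ entries X ∪ entries Y) : Steps μ (i + j) D S Z := by
  refine (Computes.union hX hY).mono (le_of_eq ?_) subset_rfl h
  push_cast
  ring

theorem Steps.fromCols {X : ∀ w, Matrix m n (K w)} {Y : ∀ w, Matrix m l (K w)}
    (hX : Steps μ i D S X) (hY : Steps μ j D S Y) :
    Steps μ (i + j) D S (fun w => Matrix.fromCols (X w) (Y w)) :=
  hX.of_union hY <| entries_subset_iff.2 fun a b => b.casesOn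
    (fun b => .inl (mem_entries X a b)) (fun b => .inr (mem_entries Y a b))

theorem Steps.fromRows {X : ∀ w, Matrix m n (K w)} {Y : ∀ w, Matrix l n (K w)}
    (hX : Steps μ i D S X) (hY : Steps μ j D S Y) :
    Steps μ (i + j) D S (fun w => Matrix.fromRows (X w) (Y w)) :=
  hX.of_union hY <| entries_subset_iff.2 fun a b => a.casesOn
    (fun a => .inl (mem_entries X a b)) (fun a => .inr (mem_entries Y a b))

theorem Steps.fromBlocks {A : ∀ w, Matrix m n (K w)} {B : ∀ w, Matrix m l (K w)}
    {C : ∀ w, Matrix o n (K w)} {E : ∀ w, Matrix o l (K w)} {i₁ i₂ i₃ i₄ : ℕ}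
    (hA : Steps μ i₁ D S A) (hB : Steps μ i₂ D S B) (hC : Steps μ i₃ D S C)
    (hE : Steps μ i₄ D S E) :
    Steps μ (i₁ + i₂ + (i₃ + i₄)) D S (fun w => Matrix.fromBlocks (A w) (B w) (C w) (E w)) := by
  refine ((hA.fromCols hB).fromRows (hC.fromCols hE)).congr fun w _ => ?_
  ext (a | a) (b | b) <;> rfl

theorem Steps.bind {m' n' : Type} {X : ∀ w, Matrix m n (K w)} {Y : ∀ w, Matrix m' n' (K w)}
    (hX : Steps μ i D S X) (hY : ∀ S', S ⊆ S' → entries X ⊆ S' → Steps μ j D S' Y) :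
    Steps μ (i + j) D S Y := by
  have := Computes.bind hX hY
  rw [← add_mul] at this
  exact_mod_cast this

theorem Steps.chain {m' n' : Type} {X : ∀ w, Matrix m n (K w)} {Y : ∀ w, Matrix m' n' (K w)}
    (hX : Steps μ i D S X) (hij : i ≤ j)
    (hY : ∀ S', S ⊆ S' → entries X ⊆ S' → Steps μ (j - i) D S' Y) : Steps μ j D S Y := by
  have := hX.bind hY
  rwa [Nat.add_sub_cancel' hij] at this

theorem Steps.of_le {X : ∀ w, Matrix m n (K w)} (hX : Steps μ i D S X) (hμ : 0 ≤ μ) (hij : i ≤ j) :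
    Steps μ j D S X :=
  Computes.of_le hX (by gcongr)

theorem entries_eq_empty_left [IsEmpty m] (X : ∀ w, Matrix m n (K w)) : entries X = ∅ :=
  Set.range_eq_empty _

namespace Budget

variable [Fintype m] [Fintype n] [Fintype l]

theorem isEmpty {m : Type} [Fintype m] [h : SizeLE m 0] : IsEmpty m :=
  Fintype.card_eq_zero_iff.1 (Nat.le_zero.1 h.card_le)

/-- There are at most N² entries with one operation each, and `sq_le` puts N² within one budget. -/
theorem entrywise (hB : Budget.{u} N μ) [hm : SizeLE m N] [hn : SizeLE n N]
    {X : ∀ w, Matrix m n (K w)} (h : ∀ a b, Computes 1 D S {fun w => X w a b}) :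
    Steps μ 1 D S X := by
  have h1 : ∀ p : m × n, Computes 1 D S {fun w => X w p.1 p.2} := fun p => h _ _
  have := Computes.iUnion h1
  rw [Set.iUnion_singleton_eq_range] at this
  refine this.of_le ?_
  have hc : ((Nat.card (m × n) : ℕ) : ℝ) ≤ (N : ℝ) ^ 2 := by
    rw [Nat.card_eq_fintype_card, Fintype.card_prod, sq]
    exact_mod_cast Nat.mul_le_mul hm.card_le hn.card_le
  simpa using hc.trans hB.sq_le

theorem add (hB : Budget.{u} N μ) [SizeLE m N] [SizeLE n N] {X Y : ∀ w, Matrix m n (K w)}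
    (hX : Steps μ i D S X) (hY : Steps μ j D S Y) :
    Steps μ (i + (j + 1)) D S (fun w => X w + Y w) :=
  hX.bind fun _ h hX' => (hY.weaken h).bind fun _ h' hY' => hB.entrywise fun a b =>
    Computes.add (h' (hX' (mem_entries X a b))) (hY' (mem_entries Y a b))

theorem sub (hB : Budget.{u} N μ) [SizeLE m N] [SizeLE n N] {X Y : ∀ w, Matrix m n (K w)}
    (hX : Steps μ i D S X) (hY : Steps μ j D S Y) :
    Steps μ (i + (j + 1)) D S (fun w => X w - Y w) :=
  hX.bind fun _ h hX' => (hY.weaken h).bind fun _ h' hY' => hB.entrywise fun a b =>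
    Computes.sub (h' (hX' (mem_entries X a b))) (hY' (mem_entries Y a b))

theorem const (hB : Budget.{u} N μ) [SizeLE m N] [SizeLE n N] (p : m → n → ℤ) :
    Steps μ 1 D S (fun w => Matrix.of fun a b => (p a b : K w)) :=
  hB.entrywise fun _ _ => Computes.const _

theorem zero (hB : Budget.{u} N μ) [SizeLE m N] [SizeLE n N] :
    Steps μ 1 D S (fun w => (0 : Matrix m n (K w))) :=
  (hB.const fun _ _ => 0).congr fun w _ => by ext; simp

theorem diagonal [DecidableEq m] (hB : Budget.{u} N μ) [SizeLE m N] (p : m → ℤ) :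
    Steps μ 1 D S (fun w => (Matrix.diagonal fun a => (p a : K w))) :=
  (hB.const fun a b => if a = b then p a else 0).congr fun w _ => by
    ext a b
    by_cases h : a = b <;> simp [Matrix.diagonal, h]

theorem one [DecidableEq m] (hB : Budget.{u} N μ) [SizeLE m N] :
    Steps μ 1 D S (fun w => (1 : Matrix m m (K w))) :=
  (hB.diagonal fun _ => 1).congr fun w _ => by simp

theorem neg (hB : Budget.{u} N μ) [SizeLE m N] [SizeLE n N] {X : ∀ w, Matrix m n (K w)}
    (hX : Steps μ i D S X) : Steps μ (1 + (i + 1)) D S (fun w => -X w) :=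
  (hB.sub hB.zero hX).congr fun w _ => by simp

theorem exists_equiv (m : Type) [Fintype m] (N : ℕ) [h : SizeLE m N] :
    ∃ r : ℕ, Nonempty (m ⊕ Fin r ≃ Fin N) := by
  refine ⟨N - Fintype.card m, ⟨Fintype.equivOfCardEq ?_⟩⟩
  have := h.card_le
  simp only [Fintype.card_sum, Fintype.card_fin]
  omega

theorem mul (hB : Budget.{u} N μ) [SizeLE m N] [SizeLE n N] [SizeLE l N]
    {X : ∀ w, Matrix m l (K w)} {Y : ∀ w, Matrix l n (K w)}
    (hX : Steps μ i D S X) (hY : Steps μ j D S Y) :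
    Steps μ (i + (j + 1)) D S (fun w => X w * Y w) := by
  refine hX.bind fun S₁ h hX' => (hY.weaken h).bind fun S₂ h' hY' => ?_
  replace hX' := hX'.trans h'
  -- For N = 0 the budget may be 0 and not even a constant is affordable, but there are no entries
  -- to compute.
  rcases eq_or_ne N 0 with rfl | hN
  · have := isEmpty (m := m)
    refine Computes.mono (Computes.of_subset (Set.empty_subset _)) ?_ subset_rfl
      (entries_eq_empty_left _).le
    simpa using hB.nonneg
  obtain ⟨p, hp, hp'⟩ := hB.mul_le hN
  obtain ⟨r₁, ⟨e₁⟩⟩ := exists_equiv m N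
  obtain ⟨r₂, ⟨e₂⟩⟩ := exists_equiv l N
  obtain ⟨r₃, ⟨e₃⟩⟩ := exists_equiv n N
  -- The additional operation creates the zero with which rectangular factors are padded to N × N.
  refine Computes.of_le (c₁ := 1 + p.cost) ?_ (by simpa [add_comm] using hp)
  refine (Computes.zero (K := K)).bind fun S₃ h₃ h0 => ?_
  let X' : ∀ w, Matrix (Fin N) (Fin N) (K w) := fun w =>
    (Matrix.fromBlocks (X w) 0 0 0).submatrix e₁.symm e₂.symm
  let Y' : ∀ w, Matrix (Fin N) (Fin N) (K w) := fun w =>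
    (Matrix.fromBlocks (Y w) 0 0 0).submatrix e₂.symm e₃.symm
  have hX1 : ∀ a b, (fun w => X' w a b) ∈ S₃ := by
    intro a b
    simp only [X', Matrix.submatrix_apply]
    rcases e₁.symm a with a | a <;> rcases e₂.symm b with b | b <;>
      simp only [Matrix.fromBlocks_apply₁₁, Matrix.fromBlocks_apply₁₂, Matrix.fromBlocks_apply₂₁,
        Matrix.fromBlocks_apply₂₂, Matrix.zero_apply]
    · exact h₃ (hX' (mem_entries X a b))
    all_goals exact h0 rfl
  have hY1 : ∀ a b, (fun w => Y' w a b) ∈ S₃ := by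
    intro a b
    simp only [Y', Matrix.submatrix_apply]
    rcases e₂.symm a with a | a <;> rcases e₃.symm b with b | b <;>
      simp only [Matrix.fromBlocks_apply₁₁, Matrix.fromBlocks_apply₁₂, Matrix.fromBlocks_apply₂₁,
        Matrix.fromBlocks_apply₂₂, Matrix.zero_apply]
    · exact h₃ (hY' (mem_entries Y a b))
    all_goals exact h0 rfl
  have := Computes.straightLine (D := D) (S := S₃) p
    (Sum.elim (fun q w => X' w q.1 q.2) (fun q w => Y' w q.1 q.2))
    (by rintro (q | q); exacts [hX1 _ _, hY1 _ _])
  refine this.mono le_rfl subset_rfl (entries_subset_iff.2 fun a b => ?_)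
  refine ⟨(e₁ (.inl a), e₃ (.inl b)), ?_⟩
  funext w
  have h1 := hp' (K w) (X' w) (Y' w) (e₁ (.inl a)) (e₃ (.inl b))
  rw [show (X' w * Y' w) (e₁ (.inl a)) (e₃ (.inl b)) = (X w * Y w) a b by
    simp only [X', Y', Matrix.submatrix_mul_equiv, Matrix.fromBlocks_multiply]
    simp] at h1
  rw [← h1]
  dsimp only
  congr 1
  funext s
  rcases s with s | s <;> rfl

end Budget

end MatrixComputations

/-! ### Generalized inverses by block recursion -/

section GeneralizedInverse

open Matrix

variable {k : Type*} [Field k] {m n : Type}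

/-- `G` is a generalized inverse of `M` with nonzero rows among those selected by the diagonal
matrix `D`, which select a basis of the column space of `M`. -/
structure IsSelectiveInverse [Fintype m] [Fintype n] (M : Matrix m n k) (G : Matrix n m k)
    (D : Matrix n n k) : Prop where
  inner : M * G * M = M
  left : D * G = G
  right : G * M * D = D

theorem IsSelectiveInverse.outer [Fintype m] [Fintype n] {M : Matrix m n k} {G : Matrix n m k}
    {D : Matrix n n k} (h : IsSelectiveInverse M G D) : G * M * G = G := calc
  G * M * G = G * M * (D * G) := by rw [h.left]
  _ = G := by rw [← Matrix.mul_assoc, h.right, h.left]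

theorem IsSelectiveInverse.of_eq [Fintype m] [Fintype n] {M M' : Matrix m n k} {G : Matrix n m k}
    {D : Matrix n n k} (h : IsSelectiveInverse M G D) (e : M = M') : IsSelectiveInverse M' G D :=
  e ▸ h

/-- A generalized inverse of a block matrix, in terms of generalized inverses of `A` and of the
matrices which remain after elimination. -/
def blockInverse [Fintype n] [DecidableEq n] (A B C E X Y Z V : Matrix n n k) :
    Matrix (n ⊕ n) (n ⊕ n) k :=
  let β := Y * (1 - A * X)
  let γ := (1 - X * A) * Z
  let S := E - C * X * B
  let S₁ := S * (1 - Y * ((1 - A * X) * B))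
  let σ := (1 - Y * ((1 - A * X) * B)) * V * (1 - C * (1 - X * A) * Z)
  fromBlocks 1 (-(X * B) - γ * S₁) 0 1 * fromBlocks X γ β σ * fromBlocks 1 0 (-(C * X) - S * β) 1

variable [Fintype n] [DecidableEq n]

/-- Expanding the triangular factors leaves only products of half-size blocks, which is the form
used for counting operations. -/
theorem blockInverse_eq (A B C E X Y Z V : Matrix n n k) {B' γ S S₁ σ ρ lam : Matrix n n k}
    (hB : B' = (1 - A * X) * B) (hγ : γ = (1 - X * A) * Z) (hS : S = E - C * X * B)
    (hS₁ : S₁ = S * (1 - Y * B')) (hσ : σ = (1 - Y * B') * V * (1 - C * (1 - X * A) * Z))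
    (hρ : ρ = -(X * B) - γ * S₁) (hl : lam = -(C * X) - S * (Y * (1 - A * X))) :
    blockInverse A B C E X Y Z V =
      fromBlocks (X + ρ * (Y * (1 - A * X)) + (γ + ρ * σ) * lam) (γ + ρ * σ)
        (Y * (1 - A * X) + σ * lam) σ := by
  subst hB hγ hS hS₁ hσ hρ hl
  simp [blockInverse, fromBlocks_multiply]

/-- The annihilation relations say that the four blocks do not interact: after elimination, G times
the middle matrix is block diagonal. The left factor can be any matrix with a left inverse. The
right factor could spoil the selection of rows; its corner is therefore required to have the form X
p + (1 - X A) Z q, which the selected rows and the idempotent X A + (1 - X A) Z C both fix. -/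
theorem isSelectiveInverse_blocks {A B C S X Y Z V DA DB DC DS : Matrix n n k}
    (hX : IsSelectiveInverse A X DA) (hY : IsSelectiveInverse B Y DB)
    (hZ : IsSelectiveInverse C Z DC) (hV : IsSelectiveInverse S V DS)
    (hXB : X * B = 0) (hCX : C * X = 0) (hSY : S * Y = 0) (hZS : Z * S = 0)
    (hCDA : C * DA = 0) (hSDB : S * DB = 0) (hAC : DC * DA = 0) (hCA : DA * DC = 0)
    (hBS : DS * DB = 0) (hSB : DB * DS = 0) (p q : Matrix n n k) {M Lₗ Lᵢ : Matrix (n ⊕ n) (n ⊕ n) k}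
    (hLL' : Lₗ * Lᵢ = 1)
    (hM : M = Lᵢ * fromBlocks A B C S * fromBlocks 1 (-(X * p + (1 - X * A) * Z * q)) 0 1) :
    IsSelectiveInverse M (fromBlocks 1 (X * p + (1 - X * A) * Z * q) 0 1 *
      fromBlocks X ((1 - X * A) * Z) (Y * (1 - A * X)) ((1 - Y * B) * V * (1 - C * Z)) * Lₗ)
      (fromBlocks (DA + DC) 0 0 (DB + DS)) := by
  have hA' : A * (X * A) = A := by rw [← Matrix.mul_assoc, hX.inner]
  have hB' : B * (Y * B) = B := by rw [← Matrix.mul_assoc, hY.inner]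
  have hC' : C * (Z * C) = C := by rw [← Matrix.mul_assoc, hZ.inner]
  have hS' : S * (V * S) = S := by rw [← Matrix.mul_assoc, hV.inner]
  obtain ⟨γ, hγ⟩ : ∃ γ, γ = (1 - X * A) * Z := ⟨_, rfl⟩
  obtain ⟨β, hβ⟩ : ∃ β, β = Y * (1 - A * X) := ⟨_, rfl⟩
  obtain ⟨σ, hσ⟩ : ∃ σ, σ = (1 - Y * B) * V * (1 - C * Z) := ⟨_, rfl⟩
  rw [← hγ] at hM
  rw [← hγ, ← hβ, ← hσ]
  have e1 : A * γ = 0 := by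
    rw [hγ, ← Matrix.mul_assoc, Matrix.mul_sub, hA', Matrix.mul_one, sub_self, Matrix.zero_mul]
  have e2 : β * A = 0 := by
    rw [hβ, Matrix.mul_assoc, Matrix.sub_mul, hX.inner, Matrix.one_mul, sub_self, Matrix.mul_zero]
  have e3 : C * γ = C * Z := by
    rw [hγ, ← Matrix.mul_assoc, Matrix.mul_sub, ← Matrix.mul_assoc, hCX, Matrix.zero_mul,
      Matrix.mul_one, sub_zero]
  have e4 : β * B = Y * B := by
    rw [hβ, Matrix.mul_assoc, Matrix.sub_mul, Matrix.mul_assoc, hXB, Matrix.mul_zero,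
      Matrix.one_mul, sub_zero]
  have e5 : B * σ = 0 := by
    rw [hσ, Matrix.mul_assoc, ← Matrix.mul_assoc, Matrix.mul_sub, hB', Matrix.mul_one, sub_self,
      Matrix.zero_mul]
  have e6 : σ * C = 0 := by
    rw [hσ, Matrix.mul_assoc, Matrix.sub_mul 1 (C * Z), hZ.inner, Matrix.one_mul, sub_self,
      Matrix.mul_zero]
  have e7 : S * β = 0 := by rw [hβ, ← Matrix.mul_assoc, hSY, Matrix.zero_mul]
  have e8 : γ * S = 0 := by rw [hγ, Matrix.mul_assoc, hZS, Matrix.mul_zero]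
  have e9 : S * σ = S * V * (1 - C * Z) := by
    rw [hσ, ← Matrix.mul_assoc, ← Matrix.mul_assoc, Matrix.mul_sub S 1, ← Matrix.mul_assoc S, hSY,
      Matrix.zero_mul, Matrix.mul_one, sub_zero]
  have e10 : σ * S = (1 - Y * B) * V * S := by
    rw [hσ, Matrix.mul_assoc, Matrix.sub_mul 1 (C * Z), Matrix.mul_assoc C, hZS, Matrix.mul_zero,
      Matrix.one_mul, sub_zero]
  have d1 : (DA + DC) * X = X := by
    rw [Matrix.add_mul, hX.left, add_eq_left, ← hX.left, ← Matrix.mul_assoc, hAC, Matrix.zero_mul]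
  have d2 : (DA + DC) * Z = Z := by
    rw [Matrix.add_mul, hZ.left, add_eq_right, ← hZ.left, ← Matrix.mul_assoc, hCA, Matrix.zero_mul]
  have d3 : (DB + DS) * Y = Y := by
    rw [Matrix.add_mul, hY.left, add_eq_left, ← hY.left, ← Matrix.mul_assoc, hBS, Matrix.zero_mul]
  have d4 : (DB + DS) * V = V := by
    rw [Matrix.add_mul, hV.left, add_eq_right, ← hV.left, ← Matrix.mul_assoc, hSB, Matrix.zero_mul]
  have d5 : (DA + DC) * γ = γ := by
    rw [hγ, Matrix.sub_mul, Matrix.one_mul, Matrix.mul_sub, d2]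
    simp only [← Matrix.mul_assoc]
    rw [d1]
  have d6 : (DB + DS) * β = β := by rw [hβ, ← Matrix.mul_assoc, d3]
  have d7 : (DB + DS) * σ = σ := by
    rw [hσ, ← Matrix.mul_assoc, Matrix.sub_mul 1 (Y * B), Matrix.one_mul,
      Matrix.mul_sub (DB + DS) V, d4]
    simp only [← Matrix.mul_assoc]
    rw [d3]
  have x1 : (X * A + γ * C) * X = X := by
    rw [Matrix.add_mul, Matrix.mul_assoc γ, hCX, Matrix.mul_zero, add_zero, hX.outer]
  have x2 : (X * A + γ * C) * γ = γ := by
    rw [Matrix.add_mul, Matrix.mul_assoc X, e1, Matrix.mul_zero, zero_add, Matrix.mul_assoc, e3,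
      hγ, Matrix.mul_assoc, ← Matrix.mul_assoc Z, hZ.outer]
  have x3 : (X * A + γ * C) * (DA + DC) = DA + DC := by
    have : γ * C * DC = DC - X * A * DC := by
      rw [hγ, Matrix.mul_assoc, Matrix.mul_assoc, ← Matrix.mul_assoc Z, hZ.right, Matrix.sub_mul,
        Matrix.one_mul]
    rw [Matrix.add_mul, Matrix.mul_add, Matrix.mul_add, hX.right, Matrix.mul_assoc γ C DA, hCDA,
      Matrix.mul_zero, this]
    abel
  have x4 : (β * B + σ * S) * (DB + DS) = DB + DS := by
    have : σ * S * DS = DS - Y * B * DS := by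
      rw [e10, Matrix.mul_assoc, Matrix.mul_assoc, ← Matrix.mul_assoc V, hV.right, Matrix.sub_mul,
        Matrix.one_mul]
    rw [e4, Matrix.add_mul, Matrix.mul_add, Matrix.mul_add, hY.right, Matrix.mul_assoc σ S DB, hSDB,
      Matrix.mul_zero, this]
    abel
  obtain ⟨ρ, hρ⟩ : ∃ ρ, ρ = X * p + γ * q := ⟨_, rfl⟩
  rw [← hρ] at hM ⊢
  have r1 : (DA + DC) * ρ = ρ := by
    rw [hρ, Matrix.mul_add, ← Matrix.mul_assoc, ← Matrix.mul_assoc, d1, d5]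
  have r2 : (X * A + γ * C) * ρ = ρ := by
    rw [hρ, Matrix.mul_add, ← Matrix.mul_assoc, ← Matrix.mul_assoc, x1, x2]
  have hRR : fromBlocks 1 (-ρ) 0 1 * fromBlocks 1 ρ 0 1 = (1 : Matrix (n ⊕ n) (n ⊕ n) k) := by
    simp [fromBlocks_multiply]
  have hG : fromBlocks X γ β σ * fromBlocks A B C S =
      fromBlocks (X * A + γ * C) 0 0 (β * B + σ * S) := by
    simp [fromBlocks_multiply, hXB, e8, e2, e6]
  have hD : fromBlocks (DA + DC) 0 0 (DB + DS) * (fromBlocks 1 ρ 0 1 * fromBlocks X γ β σ) =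
      fromBlocks 1 ρ 0 1 * fromBlocks X γ β σ := by
    simp only [fromBlocks_multiply, Matrix.one_mul, Matrix.zero_mul, add_zero, zero_add,
      Matrix.mul_add, d1, d5, d6, d7, ← Matrix.mul_assoc, r1]
  have hMG : fromBlocks A B C S * fromBlocks (X * A + γ * C) 0 0 (β * B + σ * S) =
      fromBlocks A B C S := by
    have m1 : A * (X * A + γ * C) = A := by
      rw [Matrix.mul_add, hA', ← Matrix.mul_assoc, e1, Matrix.zero_mul, add_zero]
    have m2 : B * (β * B + σ * S) = B := by
      rw [Matrix.mul_add, e4, hB', ← Matrix.mul_assoc, e5, Matrix.zero_mul, add_zero]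
    have m3 : C * (X * A + γ * C) = C := by
      rw [Matrix.mul_add, ← Matrix.mul_assoc, hCX, ← Matrix.mul_assoc, e3, hZ.inner,
        Matrix.zero_mul, zero_add]
    have m4 : S * (β * B + σ * S) = S := by
      rw [Matrix.mul_add, ← Matrix.mul_assoc, e7, Matrix.zero_mul, zero_add, ← Matrix.mul_assoc, e9,
        Matrix.mul_assoc, Matrix.sub_mul, Matrix.mul_assoc C, hZS, Matrix.mul_zero, sub_zero,
        Matrix.one_mul, hV.inner]
    simp [fromBlocks_multiply, m1, m2, m3, m4]
  refine ⟨?_, ?_, ?_⟩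
  · calc M * (fromBlocks 1 ρ 0 1 * fromBlocks X γ β σ * Lₗ) * M
        = Lᵢ * fromBlocks A B C S * (fromBlocks 1 (-ρ) 0 1 * fromBlocks 1 ρ 0 1) *
          fromBlocks X γ β σ * (Lₗ * Lᵢ) * fromBlocks A B C S * fromBlocks 1 (-ρ) 0 1 := by
          rw [hM]; simp only [Matrix.mul_assoc]
      _ = Lᵢ * (fromBlocks A B C S * (fromBlocks X γ β σ * fromBlocks A B C S)) *
          fromBlocks 1 (-ρ) 0 1 := by
          rw [hRR, hLL']; simp only [Matrix.mul_assoc, Matrix.mul_one]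
      _ = M := by rw [hG, hMG, hM]
  · rw [← Matrix.mul_assoc, hD]
  · calc fromBlocks 1 ρ 0 1 * fromBlocks X γ β σ * Lₗ * M * fromBlocks (DA + DC) 0 0 (DB + DS)
        = fromBlocks 1 ρ 0 1 * fromBlocks X γ β σ * (Lₗ * Lᵢ) * fromBlocks A B C S *
          fromBlocks 1 (-ρ) 0 1 * fromBlocks (DA + DC) 0 0 (DB + DS) := by
          rw [hM]; simp only [Matrix.mul_assoc]
      _ = fromBlocks 1 ρ 0 1 * (fromBlocks X γ β σ * fromBlocks A B C S) *
          fromBlocks 1 (-ρ) 0 1 * fromBlocks (DA + DC) 0 0 (DB + DS) := by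
          rw [hLL']; simp only [Matrix.mul_assoc, Matrix.one_mul]
      _ = _ := by
          rw [hG]
          simp only [fromBlocks_multiply, Matrix.one_mul, Matrix.zero_mul, Matrix.mul_zero,
            Matrix.mul_one, add_zero, zero_add, Matrix.mul_neg, r2, x3, x4, Matrix.add_mul _ _ (DB + DS),
            Matrix.neg_mul]
          rw [Matrix.mul_assoc, x4]
          simp

/-- Generalized block elimination with A possibly singular: B and C are reduced to the parts that A
does not reach, and the Schur complement is compressed by what these parts already account for. The
original matrix is recovered from the reduced one by unipotent triangular factors, and the ranks of
the four reduced blocks add up. -/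
theorem isSelectiveInverse_blockInverse {A B C E X Y Z V DA DB DC DS : Matrix n n k}
    (hX : IsSelectiveInverse A X DA) (hY : IsSelectiveInverse ((1 - A * X) * B) Y DB)
    (hZ : IsSelectiveInverse (C * (1 - X * A)) Z DC)
    (hV : IsSelectiveInverse ((1 - C * (1 - X * A) * Z) *
      ((E - C * X * B) * (1 - Y * ((1 - A * X) * B)))) V DS)
    (hAC : DC * DA = DA * DC) (hBS : DS * DB = DB * DS) :
    IsSelectiveInverse (fromBlocks A B C E) (blockInverse A B C E X Y Z V)
      (fromBlocks (DA + DC) 0 0 (DB + DS)) ∧ DA * DC = 0 ∧ DB * DS = 0 := by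
  have hA' : A * (X * A) = A := by rw [← Matrix.mul_assoc, hX.inner]
  have hXB : X * ((1 - A * X) * B) = 0 := by
    rw [← Matrix.mul_assoc, Matrix.mul_sub, ← Matrix.mul_assoc, hX.outer, Matrix.mul_one, sub_self,
      Matrix.zero_mul]
  have hCX : C * (1 - X * A) * X = 0 := by
    rw [Matrix.mul_assoc, Matrix.sub_mul, hX.outer, Matrix.one_mul, sub_self, Matrix.mul_zero]
  have hβA : Y * (1 - A * X) * A = 0 := by
    rw [Matrix.mul_assoc, Matrix.sub_mul, hX.inner, Matrix.one_mul, sub_self, Matrix.mul_zero]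
  have hAγ : A * ((1 - X * A) * Z) = 0 := by
    rw [← Matrix.mul_assoc, Matrix.mul_sub, hA', Matrix.mul_one, sub_self, Matrix.zero_mul]
  have hβB : Y * (1 - A * X) * ((1 - A * X) * B) = Y * ((1 - A * X) * B) := by
    rw [Matrix.mul_assoc, Matrix.sub_mul 1 (A * X), Matrix.mul_assoc A, hXB, Matrix.mul_zero,
      sub_zero, Matrix.one_mul]
  have hCDA : C * (1 - X * A) * DA = 0 := by
    rw [Matrix.mul_assoc, Matrix.sub_mul, hX.right, Matrix.one_mul, sub_self, Matrix.mul_zero]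
  -- The reduced C vanishes on the columns selected for A and is injective on those selected for
  -- itself, so the two selections are disjoint.
  have hCA : DC * DA = 0 := by
    rw [← hZ.right, Matrix.mul_assoc, hAC, ← Matrix.mul_assoc, Matrix.mul_assoc Z, hCDA,
      Matrix.mul_zero, Matrix.zero_mul]
  obtain ⟨B', hB'⟩ : ∃ B', B' = (1 - A * X) * B := ⟨_, rfl⟩
  obtain ⟨C', hC'⟩ : ∃ C', C' = C * (1 - X * A) := ⟨_, rfl⟩
  obtain ⟨S, hS⟩ : ∃ S, S = E - C * X * B := ⟨_, rfl⟩
  have hβB' : Y * (1 - A * X) * B' = Y * B' := by rw [hB', hβB]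
  simp only [blockInverse]
  rw [← hB', ← hS] at hV ⊢
  rw [← hB'] at hY hXB
  rw [← hC'] at hZ hV hCX hCDA ⊢
  obtain ⟨S', hS'⟩ : ∃ S', S' = (1 - C' * Z) * (S * (1 - Y * B')) := ⟨_, rfl⟩
  rw [← hS'] at hV
  have hYY : (1 - Y * B') * Y = 0 := by
    rw [Matrix.sub_mul, hY.outer, Matrix.one_mul, sub_self]
  have hYD : (1 - Y * B') * DB = 0 := by
    rw [Matrix.sub_mul, hY.right, Matrix.one_mul, sub_self]
  have hZZ : Z * (1 - C' * Z) = 0 := by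
    rw [Matrix.mul_sub, ← Matrix.mul_assoc, hZ.outer, Matrix.mul_one, sub_self]
  have hSY : S' * Y = 0 := by
    rw [hS', Matrix.mul_assoc, Matrix.mul_assoc, hYY, Matrix.mul_zero, Matrix.mul_zero]
  have hSDB : S' * DB = 0 := by
    rw [hS', Matrix.mul_assoc, Matrix.mul_assoc, hYD, Matrix.mul_zero, Matrix.mul_zero]
  have hZS : Z * S' = 0 := by
    rw [hS', ← Matrix.mul_assoc, hZZ, Matrix.zero_mul]
  have hSB : DS * DB = 0 := by
    rw [← hV.right, Matrix.mul_assoc, hBS, ← Matrix.mul_assoc, Matrix.mul_assoc V, hSDB,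
      Matrix.mul_zero, Matrix.zero_mul]
  refine ⟨?_, hAC ▸ hCA, hBS ▸ hSB⟩
  obtain ⟨lam, hl⟩ : ∃ lam, lam = -(C * X) - S * (Y * (1 - A * X)) := ⟨_, rfl⟩
  have hρ : -(X * B) - (1 - X * A) * Z * (S * (1 - Y * B')) =
      X * (-B) + (1 - X * A) * Z * (-(S * (1 - Y * B'))) := by
    rw [Matrix.mul_neg, Matrix.mul_neg, sub_eq_add_neg]
  rw [← hl, hρ]
  refine isSelectiveInverse_blocks hX hY hZ hV hXB hCX hSY hZS hCDA hSDB hCA (hAC ▸ hCA) hSB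
    (hBS ▸ hSB) _ _ (Lᵢ := fromBlocks 1 0 (-lam) 1) (by simp [fromBlocks_multiply]) ?_
  have q1 : -lam * A + C' = C := by
    rw [hl, hC', Matrix.neg_mul, Matrix.sub_mul, Matrix.mul_assoc S, hβA, Matrix.mul_sub,
      Matrix.mul_zero, Matrix.neg_mul, Matrix.mul_one, ← Matrix.mul_assoc]
    abel
  have q2 : lam * B' = -(S * (Y * B')) := by
    rw [hl, Matrix.sub_mul, Matrix.neg_mul, Matrix.mul_assoc C, hXB, Matrix.mul_zero,
      Matrix.mul_assoc S, hβB', neg_zero, zero_sub]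
  have q3 : A * -(X * -B + (1 - X * A) * Z * -(S * (1 - Y * B'))) + B' = B := by
    rw [← hρ, Matrix.mul_neg, Matrix.mul_sub, ← Matrix.mul_assoc A ((1 - X * A) * Z), hAγ,
      Matrix.zero_mul, Matrix.mul_neg, hB', Matrix.sub_mul, Matrix.one_mul, ← Matrix.mul_assoc]
    abel
  have q4 : C * -(X * -B + (1 - X * A) * Z * -(S * (1 - Y * B'))) + (-lam * B' + S') = E := by
    rw [← hρ, Matrix.mul_neg, Matrix.mul_sub, ← Matrix.mul_assoc C ((1 - X * A) * Z),
      ← Matrix.mul_assoc C (1 - X * A), ← hC', Matrix.neg_mul, q2, hS', Matrix.sub_mul 1 (C' * Z),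
      Matrix.mul_sub S, Matrix.mul_neg, ← Matrix.mul_assoc C X, Matrix.one_mul, Matrix.mul_one, hS]
    abel
  simp only [fromBlocks_multiply, Matrix.one_mul, Matrix.zero_mul, Matrix.mul_zero, Matrix.mul_one,
    add_zero, q1, q3]
  rw [q4]

/-- An index type with `2 ^ t` elements. -/
def Idx : ℕ → Type
  | 0 => Unit
  | t + 1 => Idx t ⊕ Idx t

instance Idx.fintype : ∀ t, Fintype (Idx t)
  | 0 => inferInstanceAs (Fintype Unit)
  | t + 1 => letI := Idx.fintype t; inferInstanceAs (Fintype (Idx t ⊕ Idx t))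

instance Idx.decidableEq : ∀ t, DecidableEq (Idx t)
  | 0 => inferInstanceAs (DecidableEq Unit)
  | t + 1 => letI := Idx.decidableEq t; inferInstanceAs (DecidableEq (Idx t ⊕ Idx t))

theorem Idx.card : ∀ t, Fintype.card (Idx t) = 2 ^ t
  | 0 => rfl
  | t + 1 => by
    rw [pow_succ, mul_two, ← Idx.card t]
    exact Fintype.card_sum

/-- A generalized inverse of a square matrix, computed by recursion on blocks. -/
def ginv : (t : ℕ) → Matrix (Idx t) (Idx t) k → Matrix (Idx t) (Idx t) k
  | 0, M => M.map (·⁻¹)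
  | t + 1, M =>
    let A : Matrix (Idx t) (Idx t) k := toBlocks₁₁ M
    let B : Matrix (Idx t) (Idx t) k := toBlocks₁₂ M
    let C : Matrix (Idx t) (Idx t) k := toBlocks₂₁ M
    let E : Matrix (Idx t) (Idx t) k := toBlocks₂₂ M
    let X := ginv t A
    let Y := ginv t ((1 - A * X) * B)
    let Z := ginv t (C * (1 - X * A))
    blockInverse A B C E X Y Z (ginv t ((1 - C * (1 - X * A) * Z) *
      ((E - C * X * B) * (1 - Y * ((1 - A * X) * B)))))

/-- The diagonal matrix selecting the indices in `s`. -/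
noncomputable def selector (s : Set n) : Matrix n n k := diagonal (s.indicator 1)

theorem selector_comm (s t : Set n) : selector (k := k) s * selector t = selector t * selector s := by
  simp only [selector, diagonal_mul_diagonal, mul_comm]

theorem selector_add {s t : Set n} (h : selector (k := k) s * selector t = 0) :
    selector (k := k) s + selector t = selector (s ∪ t) := by
  have : Disjoint s t := by
    rw [Set.disjoint_left]
    intro i hs ht
    have := congrFun (congrFun h i) i
    simp [selector, hs, ht] at this
  simp only [selector, diagonal_add, Set.indicator_union_of_disjoint this]

theorem selector_sum {p : Type} [DecidableEq p] (s : Set n) (t : Set p) :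
    fromBlocks (selector (k := k) s) 0 0 (selector t) =
      selector (Sum.inl '' s ∪ Sum.inr '' t) := by
  classical
  ext (i | i) (j | j) <;> simp [selector, diagonal_apply, Set.indicator_apply]

/-- In size one the convention 0⁻¹ = 0 selects the index exactly when the entry is nonzero. In the
recursion the two selections in each half are disjoint, so the sum of their selectors is the
selector of the union. -/
theorem exists_isSelectiveInverse_ginv : ∀ (t : ℕ) (M : Matrix (Idx t) (Idx t) k),
    ∃ s, IsSelectiveInverse M (ginv t M) (selector s)
  | 0, M => by
    classical
    refine ⟨{i | M i i ≠ 0}, ?_⟩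
    have hM : M = diagonal fun i => M i i := by ext i j; obtain rfl : i = j := rfl; simp
    have hG : ginv 0 M = diagonal fun i => (M i i)⁻¹ := by
      ext i j; obtain rfl : i = j := rfl; simp [ginv]
    rw [hG]
    obtain ⟨x, hx⟩ : ∃ x, x = fun i => M i i := ⟨_, rfl⟩
    simp only [fun i => show M i i = x i from by rw [hx]] at hM ⊢
    rw [hM]
    constructor <;> simp only [selector, diagonal_mul_diagonal] <;> congr 1 <;> ext i <;>
      by_cases h : x i = 0 <;> simp [h]
  | t + 1, M => by
    obtain ⟨s₁, h₁⟩ := exists_isSelectiveInverse_ginv t (toBlocks₁₁ M)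
    obtain ⟨s₂, h₂⟩ := exists_isSelectiveInverse_ginv t
      ((1 - toBlocks₁₁ M * ginv t (toBlocks₁₁ M)) * toBlocks₁₂ M)
    obtain ⟨s₃, h₃⟩ := exists_isSelectiveInverse_ginv t
      (toBlocks₂₁ M * (1 - ginv t (toBlocks₁₁ M) * toBlocks₁₁ M))
    obtain ⟨s₄, h₄⟩ := exists_isSelectiveInverse_ginv t _
    obtain ⟨h, hAC, hBS⟩ := isSelectiveInverse_blockInverse (E := toBlocks₂₂ M) h₁ h₂ h₃ h₄
      (selector_comm _ _) (selector_comm _ _)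
    rw [selector_add hAC, selector_add hBS, selector_sum] at h
    exact ⟨_, h.of_eq (fromBlocks_toBlocks (m := Idx t) (n := Idx t) (l := Idx t) (o := Idx t) M)⟩

instance (t : ℕ) : SizeLE (Idx t) (2 ^ t) := ⟨(Idx.card t).le⟩

/-- The doubling hypothesis 4 β(t) ≤ β(t+1) pays exactly for the four half-size recursive calls.
Each level therefore adds a bounded multiple of the budget, and the total has only a factor linear
in t. -/
theorem ginv_steps {W : Type*} {K : W → Type u} [∀ w, Field (K w)] {D : Set W} {β : ℕ → ℝ}
    (hB : ∀ t, Budget.{u} (2 ^ t) (β t)) (hβ : ∀ t, 4 * β t ≤ β (t + 1)) (t : ℕ)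
    {S : Set (∀ w, K w)} {M : ∀ w, Matrix (Idx t) (Idx t) (K w)} (hM : entries M ⊆ S) :
    Steps (β t) (200 * t + 3) D S (fun w => ginv t (M w)) := by
  induction t generalizing S with
  | zero =>
    have h1 : (1 : ℝ) ≤ β 0 := by simpa using (hB 0).sq_le
    have := Computes.inv (D := D) (hM (mem_entries M () ()))
    refine this.mono (by simpa using h1) subset_rfl ?_
    rw [entries_subset_iff]
    exact fun _ _ => rfl
  | succ t ih =>
    obtain ⟨A, hA⟩ : ∃ A : ∀ w, Matrix (Idx t) (Idx t) (K w), A = fun w => toBlocks₁₁ (M w) :=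
      ⟨_, rfl⟩
    obtain ⟨B, hB'⟩ : ∃ B : ∀ w, Matrix (Idx t) (Idx t) (K w), B = fun w => toBlocks₁₂ (M w) :=
      ⟨_, rfl⟩
    obtain ⟨C, hC⟩ : ∃ C : ∀ w, Matrix (Idx t) (Idx t) (K w), C = fun w => toBlocks₂₁ (M w) :=
      ⟨_, rfl⟩
    obtain ⟨E, hE⟩ : ∃ E : ∀ w, Matrix (Idx t) (Idx t) (K w), E = fun w => toBlocks₂₂ (M w) :=
      ⟨_, rfl⟩
    have hAS : entries A ⊆ S := by
      rw [hA, entries_subset_iff]; exact fun i j => hM (mem_entries M (Sum.inl i) (Sum.inl j))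
    have hBS : entries B ⊆ S := by
      rw [hB', entries_subset_iff]; exact fun i j => hM (mem_entries M (Sum.inl i) (Sum.inr j))
    have hCS : entries C ⊆ S := by
      rw [hC, entries_subset_iff]; exact fun i j => hM (mem_entries M (Sum.inr i) (Sum.inl j))
    have hES : entries E ⊆ S := by
      rw [hE, entries_subset_iff]; exact fun i j => hM (mem_entries M (Sum.inr i) (Sum.inr j))
    obtain ⟨q, hq⟩ : ∃ q, q = 200 * t + 3 := ⟨_, rfl⟩
    rw [← hq] at ih
    have b := hB t
    -- Four recursive calls of cost q and at most 800 other units at half size. Division by 4 turns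
    -- this into q + 200 units at full size.
    suffices h : Steps (β t) (4 * q + 800) D S (fun w => blockInverse (A w) (B w) (C w) (E w)
        (ginv t (A w)) (ginv t ((1 - A w * ginv t (A w)) * B w))
        (ginv t (C w * (1 - ginv t (A w) * A w)))
        (ginv t ((1 - C w * (1 - ginv t (A w) * A w) * ginv t (C w * (1 - ginv t (A w) * A w))) *
          ((E w - C w * ginv t (A w) * B w) *
            (1 - ginv t ((1 - A w * ginv t (A w)) * B w) * ((1 - A w * ginv t (A w)) * B w)))))) by
      refine Computes.mono h ?_ subset_rfl (by subst hA hB' hC hE; exact subset_rfl)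
      have := hβ t
      have h0 := b.nonneg
      rw [show 200 * (t + 1) + 3 = q + 200 by omega]
      push_cast
      nlinarith
    have step {S' : Set (∀ w, K w)} {i : ℕ} {X : ∀ w, Matrix (Idx t) (Idx t) (K w)}
        (hX : Steps (β t) i D S' X) : Steps (β t) (i + q) D S' (fun w => ginv t (X w)) :=
      hX.bind fun _ _ h => ih h
    have v {S' : Set (∀ w, K w)} {X : ∀ w, Matrix (Idx t) (Idx t) (K w)} (h : entries X ⊆ S') :
        Steps (β t) 0 D S' X := Steps.of_subset h
    have one {S' : Set (∀ w, K w)} : Steps (β t) 1 D S' (fun w => (1 : Matrix (Idx t) (Idx t) (K w))) :=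
      b.one
    refine (ih hAS).chain (by omega) fun S₁ h₁ hX => ?_
    replace hAS := hAS.trans h₁
    replace hBS := hBS.trans h₁
    replace hCS := hCS.trans h₁
    replace hES := hES.trans h₁
    refine (b.mul (b.sub one (b.mul (v hAS) (v hX))) (v hBS)).chain (by omega) fun S₂ h₂ hB1 => ?_
    refine (ih hB1).chain (by omega) fun S₃ h₃ hY => ?_
    have h₃ := h₂.trans h₃
    replace hAS := hAS.trans h₃
    replace hBS := hBS.trans h₃
    replace hCS := hCS.trans h₃
    replace hES := hES.trans h₃
    replace hX := hX.trans h₃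
    refine (step (b.mul (v hCS) (b.sub one (b.mul (v hX) (v hAS))))).chain (by omega) fun S₄ h₄ hZ => ?_
    replace hAS := hAS.trans h₄
    replace hBS := hBS.trans h₄
    replace hCS := hCS.trans h₄
    replace hES := hES.trans h₄
    replace hX := hX.trans h₄
    replace hY := hY.trans h₄
    refine (step (b.mul (b.sub one (b.mul (b.mul (v hCS) (b.sub one (b.mul (v hX) (v hAS))))
      (v hZ))) (b.mul (b.sub (v hES) (b.mul (b.mul (v hCS) (v hX)) (v hBS)))
      (b.sub one (b.mul (v hY) (b.mul (b.sub one (b.mul (v hAS) (v hX))) (v hBS))))))).chain (by omega)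
      fun S₅ h₅ hV => ?_
    replace hAS := hAS.trans h₅
    replace hBS := hBS.trans h₅
    replace hCS := hCS.trans h₅
    replace hES := hES.trans h₅
    replace hX := hX.trans h₅
    replace hY := hY.trans h₅
    replace hZ := hZ.trans h₅
    simp only [blockInverse_eq _ _ _ _ _ _ _ _ rfl rfl rfl rfl rfl rfl rfl]
    have hβ' := b.mul (v hY) (b.sub one (b.mul (v hAS) (v hX)))
    have hγ := b.mul (b.sub one (b.mul (v hX) (v hAS))) (v hZ)
    have hS := b.sub (v hES) (b.mul (b.mul (v hCS) (v hX)) (v hBS))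
    have h1 := b.sub one (b.mul (v hY) (b.mul (b.sub one (b.mul (v hAS) (v hX))) (v hBS)))
    have hσ := b.mul (b.mul h1 (v hV)) (b.sub one
      (b.mul (b.mul (v hCS) (b.sub one (b.mul (v hX) (v hAS)))) (v hZ)))
    have hρ := b.sub (b.neg (b.mul (v hX) (v hBS))) (b.mul hγ (b.mul hS h1))
    have hl := b.sub (b.neg (b.mul (v hCS) (v hX))) (b.mul hS hβ')
    refine Steps.of_le (Steps.fromBlocks (b.add (b.add (v hX) (b.mul hρ hβ'))
      (b.mul (b.add hγ (b.mul hρ hσ)) hl)) (b.add hγ (b.mul hρ hσ)) (b.add hβ' (b.mul hσ hl)) hσ) b.nonneg ?_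
    omega

end GeneralizedInverse

/-! ### Rectangular generalized inverses and the toolkit -/

section PseudoInverse

open Matrix

variable {k : Type*} [Field k] {m n : Type} [Fintype m] [Fintype n]

/-- An embedding of a type with at most `2 ^ t` elements as a summand of `Idx t`. -/
noncomputable def idxEquiv (m : Type) [Fintype m] {t : ℕ} (h : Fintype.card m ≤ 2 ^ t) :
    m ⊕ Fin (2 ^ t - Fintype.card m) ≃ Idx t :=
  Fintype.equivOfCardEq (by
    simp only [Fintype.card_sum, Fintype.card_fin, Idx.card]
    omega)

/-- The exponent of a power of two bounding both dimensions of a matrix. -/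
def sizeLog (m n : Type) [Fintype m] [Fintype n] : ℕ :=
  Nat.clog 2 (max (Fintype.card m) (Fintype.card n))

theorem card_le_sizeLog_left : Fintype.card m ≤ 2 ^ sizeLog m n :=
  (le_max_left _ _).trans (Nat.le_pow_clog one_lt_two _)

theorem card_le_sizeLog_right : Fintype.card n ≤ 2 ^ sizeLog m n :=
  (le_max_right _ _).trans (Nat.le_pow_clog one_lt_two _)

/-- A generalized inverse of a rectangular matrix. -/
noncomputable def pinv (M : Matrix m n k) : Matrix n m k :=
  let e := idxEquiv m (card_le_sizeLog_left (m := m) (n := n))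
  let e' := idxEquiv n (card_le_sizeLog_right (m := m) (n := n))
  (ginv (sizeLog m n) ((fromBlocks M 0 0 0).submatrix e.symm e'.symm)).submatrix
    (fun i => e' (.inl i)) (fun j => e (.inl j))

/-- After padding by zero blocks, the top left blocks of the three defining identities involve only
the corresponding block of the inverse. -/
theorem exists_isSelectiveInverse_pinv [DecidableEq n] (M : Matrix m n k) :
    ∃ s, IsSelectiveInverse M (pinv M) (selector s) := by
  obtain ⟨e, he⟩ : ∃ e, e = idxEquiv m (card_le_sizeLog_left (m := m) (n := n)) := ⟨_, rfl⟩
  obtain ⟨e', he'⟩ : ∃ e', e' = idxEquiv n (card_le_sizeLog_right (m := m) (n := n)) := ⟨_, rfl⟩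
  simp only [pinv, ← he, ← he']
  obtain ⟨s, hs⟩ := exists_isSelectiveInverse_ginv (sizeLog m n)
    ((fromBlocks M 0 0 0).submatrix e.symm e'.symm)
  obtain ⟨G, hG⟩ : ∃ G, G = ginv (sizeLog m n) ((fromBlocks M 0 0 0).submatrix e.symm e'.symm) :=
    ⟨_, rfl⟩
  rw [← hG] at hs ⊢
  obtain ⟨G₁, G₂, G₃, G₄, h⟩ : ∃ G₁ G₂ G₃ G₄, G.submatrix e' e = fromBlocks G₁ G₂ G₃ G₄ :=
    ⟨_, _, _, _, (fromBlocks_toBlocks _).symm⟩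
  have hG' : G = (fromBlocks G₁ G₂ G₃ G₄).submatrix e'.symm e.symm := by
    rw [← h, submatrix_submatrix]; simp
  have h1 : G.submatrix (fun i => e' (.inl i)) (fun j => e (.inl j)) = G₁ := by
    rw [hG']; ext i j; simp
  have hsel : (selector s : Matrix _ _ k) =
      (fromBlocks (selector (e' ∘ Sum.inl ⁻¹' s)) 0 0 (selector (e' ∘ Sum.inr ⁻¹' s))).submatrix
        e'.symm e'.symm := by
    classical
    rw [selector_sum]
    ext i j
    obtain ⟨i, rfl⟩ := e'.surjective i
    obtain ⟨j, rfl⟩ := e'.surjective j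
    simp only [submatrix_apply, Equiv.symm_apply_apply, selector, diagonal_apply,
      EmbeddingLike.apply_eq_iff_eq, Set.indicator_apply]
    rcases i with i | i <;> simp
  refine ⟨(e' ∘ Sum.inl ⁻¹' s), ?_⟩
  rw [h1]
  obtain ⟨a, b, c⟩ := hs
  rw [hG'] at a b c
  rw [hsel] at b c
  simp only [submatrix_mul_equiv, fromBlocks_multiply, Matrix.zero_mul, Matrix.mul_zero, add_zero,
    zero_add] at a b c
  have inj {p q : Type} {p' q' : Type} (ε : p ≃ p') (η : q ≃ q') {X Y : Matrix p q k}
      (h : X.submatrix ε.symm η.symm = Y.submatrix ε.symm η.symm) : X = Y := by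
    have := congrArg (fun Z => Z.submatrix ε η) h
    simpa [submatrix_submatrix] using this
  exact ⟨(fromBlocks_inj.1 (inj _ _ a)).1, (fromBlocks_inj.1 (inj _ _ b)).1,
    (fromBlocks_inj.1 (inj _ _ c)).1⟩

theorem mul_pinv_mul (M : Matrix m n k) : M * pinv M * M = M := by
  classical
  obtain ⟨s, hs⟩ := exists_isSelectiveInverse_pinv M
  exact hs.inner

/-- Matrix arithmetic and generalized inverses of matrices of size at most `N` are possible within
the budget `μ`. -/
structure Toolkit {W : Type*} (K : W → Type u) [∀ w, Field (K w)] (N : ℕ) (μ : ℝ) : Prop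
    extends Budget.{u} N μ where
  pinv_avail : ∀ {m n : Type} [Fintype m] [Fintype n] [SizeLE m N] [SizeLE n N] {D : Set W}
    {S : Set (∀ w, K w)} {X : ∀ w, Matrix m n (K w)}, entries X ⊆ S →
    Steps μ 1 D S (fun w => pinv (X w))

theorem sizeLog_le {N : ℕ} (hN : N ≠ 0) [hm : SizeLE m N] [hn : SizeLE n N] :
    2 ^ sizeLog m n ≤ 2 * N := by
  rcases Nat.lt_or_ge 1 (max (Fintype.card m) (Fintype.card n)) with h | h
  · have h1 := Nat.pow_pred_clog_lt_self one_lt_two h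
    have h2 : 0 < sizeLog m n := Nat.clog_pos one_lt_two h
    have h3 : sizeLog m n = (sizeLog m n).pred + 1 := by rw [Nat.pred_eq_sub_one]; omega
    have h4 := max_le hm.card_le hn.card_le
    rw [h3, pow_succ]
    change 2 ^ (sizeLog m n).pred < _ at h1
    omega
  · rw [sizeLog, Nat.clog_of_right_le_one h]
    omega

/-- Padding at most doubles the size, which costs the factor q; the depth of the block recursion is
at most ℓ. Absorbing both into the budget makes a generalized inverse one unit. -/
theorem toolkit {W : Type*} (K : W → Type u) [∀ w, Field (K w)] {M : ℕ → ℝ}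
    (hB : ∀ N, Budget.{u} N (M N)) (h4 : ∀ N, 4 * M N ≤ M (2 * N)) (hmono : Monotone M)
    {N ℓ : ℕ} (hℓ : 2 * N ≤ 2 ^ ℓ) {q : ℝ} (hq : M (2 * N) ≤ q * M N) :
    Toolkit K N ((200 * ℓ + 4) * (q * M N)) := by
  have hM0 := (hB N).nonneg
  have hM1 := (hB (2 * N)).nonneg
  have hM2 : M N ≤ M (2 * N) := hmono (by omega)
  have hℓ0 : (0 : ℝ) ≤ ℓ := by positivity
  refine ⟨(hB N).mono ?_, ?_⟩
  · calc M N ≤ q * M N := hM2.trans hq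
      _ ≤ _ := by nlinarith [hM1.trans hq]
  · intro m n _ _ hm hn D S X hX
    rcases eq_or_ne N 0 with rfl | hN
    · have := Budget.isEmpty (m := n)
      refine Computes.mono (Computes.of_subset (Set.empty_subset _)) ?_ subset_rfl
        (entries_eq_empty_left _).le
      have := hM1.trans hq
      push_cast
      positivity
    have hs := sizeLog_le (m := m) (n := n) hN
    have hsl : sizeLog m n ≤ ℓ := (Nat.pow_le_pow_iff_right one_lt_two).1 (hs.trans hℓ)
    have h1 : (1 : ℝ) ≤ M (2 * N) := by
      refine le_trans ?_ (hB (2 * N)).sq_le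
      have : (1 : ℝ) ≤ (2 * N : ℕ) := by exact_mod_cast (by omega : 1 ≤ 2 * N)
      nlinarith
    have key : Computes (1 + ((200 * sizeLog m n + 3 : ℕ) * M (2 ^ sizeLog m n))) D S
        (entries fun w => pinv (X w)) := by
      refine (Computes.zero (K := K)).bind fun S' hS h0 => ?_
      refine (ginv_steps (K := K) (D := D) (S := S') (fun t => hB (2 ^ t))
        (fun t => by rw [pow_succ, mul_comm (2 ^ t)]; exact h4 _) (sizeLog m n) (M := fun w =>
        (fromBlocks (X w) 0 0 0).submatrix (idxEquiv m card_le_sizeLog_left).symm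
          (idxEquiv n card_le_sizeLog_right).symm) ?_).submatrix _ _
      refine entries_subset_iff.2 fun i j => ?_
      simp only [submatrix_apply]
      generalize (idxEquiv m card_le_sizeLog_left).symm i = i
      generalize (idxEquiv n card_le_sizeLog_right).symm j = j
      rcases i with i | i <;> rcases j with j | j
      · exact hS (hX (mem_entries X i j))
      all_goals exact h0 rfl
    refine key.of_le ?_
    have h2 : M (2 ^ sizeLog m n) ≤ M (2 * N) := hmono hs
    have h3 : (sizeLog m n : ℝ) ≤ ℓ := by exact_mod_cast hsl
    have h5 := (hB (2 ^ sizeLog m n)).nonneg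
    push_cast
    rw [one_mul]
    calc 1 + (200 * (sizeLog m n : ℝ) + 3) * M (2 ^ sizeLog m n)
        ≤ M (2 * N) + (200 * (ℓ : ℝ) + 3) * M (2 * N) := by gcongr
      _ = (200 * ℓ + 4) * M (2 * N) := by ring
      _ ≤ _ := by gcongr

namespace Toolkit

variable {W : Type*} {K : W → Type u} [∀ w, Field (K w)] {N : ℕ} {μ : ℝ} {D : Set W}
  {S : Set (∀ w, K w)} {i j : ℕ}

theorem pinv (hT : Toolkit K N μ) [SizeLE m N] [SizeLE n N] {X : ∀ w, Matrix m n (K w)}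
    (hX : Steps μ i D S X) : Steps μ (i + 1) D S (fun w => pinv (X w)) :=
  hX.bind fun _ _ h => hT.pinv_avail h

end Toolkit

end PseudoInverse

/-! ### Gluing cyclic columns along a block triangular matrix -/

section Merging

open Matrix Polynomial

variable {k : Type*} [Field k] {m n p : Type} [Fintype m] [Fintype n] [Fintype p]
  [DecidableEq m] [DecidableEq n] [DecidableEq p]

/-- The column `v` generates the whole space under `A`. -/
def IsCyclicColumn (A : Matrix m m k) (v : Matrix m Unit k) : Prop :=
  ∀ x : Matrix m Unit k, ∃ q : k[X], x = aeval A q * v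

/-- The annihilating polynomials of `A` have at least the degree of its characteristic
polynomial. -/
def Nonderogatory (A : Matrix m m k) : Prop :=
  ∀ q : k[X], q ≠ 0 → aeval A q = 0 → Fintype.card m ≤ q.natDegree

theorem ext_mul_column {l : Type} {X Y : Matrix l m k} (h : ∀ x : Matrix m Unit k, X * x = Y * x) :
    X = Y := by
  ext i j
  have := congrFun (congrFun (h (Matrix.of fun a _ => if a = j then 1 else 0)) i) ()
  simpa [Matrix.mul_apply] using this

/-- Polynomials in A commute, so one that kills a cyclic column kills everything this column
generates. -/
theorem aeval_eq_zero_of_isCyclicColumn {A : Matrix m m k} {v : Matrix m Unit k}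
    (h : IsCyclicColumn A v) {q : k[X]} (hq : aeval A q * v = 0) : aeval A q = 0 := by
  refine ext_mul_column fun x => ?_
  obtain ⟨r, rfl⟩ := h x
  rw [← Matrix.mul_assoc, ← map_mul, mul_comm, map_mul, Matrix.mul_assoc, hq, Matrix.mul_zero,
    Matrix.zero_mul]

/-- The matrix with columns `v, A v, …, A ^ (N - 1) v`. -/
def krylov (A : Matrix m m k) (v : Matrix m Unit k) (N : ℕ) : Matrix m (Fin N) k :=
  Matrix.of fun i j => (A ^ (j : ℕ) * v) i ()

theorem krylov_mul (A : Matrix m m k) (v : Matrix m Unit k) (N : ℕ) (c : Matrix (Fin N) Unit k) :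
    krylov A v N * c = aeval A (∑ i : Fin N, C (c i ()) * X ^ (i : ℕ)) * v := by
  ext i j
  simp only [map_sum, map_mul, aeval_C, map_pow, aeval_X, Matrix.sum_mul, Matrix.sum_apply,
    Matrix.mul_assoc]
  rw [Matrix.mul_apply]
  refine Finset.sum_congr rfl fun a _ => ?_
  rw [Algebra.algebraMap_eq_smul_one, Matrix.smul_mul, Matrix.one_mul, Matrix.smul_apply,
    smul_eq_mul, mul_comm]
  rfl

theorem mul_krylov {A P : Matrix m m k} (h : Commute P A) (v : Matrix m Unit k) (N : ℕ) :
    P * krylov A v N = krylov A (P * v) N := by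
  ext i j
  have h1 : P * (A ^ (j : ℕ) * v) = A ^ (j : ℕ) * (P * v) := by
    rw [← Matrix.mul_assoc, (h.pow_right j).eq, Matrix.mul_assoc]
  have := congrFun (congrFun h1 i) ()
  rw [Matrix.mul_apply] at this ⊢
  exact this

/-- By the Cayley–Hamilton theorem, division by the characteristic polynomial leaves polynomials of
degree less than the size. -/
theorem exists_krylov_mul {A : Matrix m m k} {v : Matrix m Unit k} (h : IsCyclicColumn A v) {N : ℕ}
    (hN : Fintype.card m ≤ N) (x : Matrix m Unit k) :
    ∃ c : Matrix (Fin N) Unit k, krylov A v N * c = x := by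
  obtain ⟨q, rfl⟩ := h x
  have hd : (q %ₘ A.charpoly).degree < N := by
    refine (degree_modByMonic_lt q A.charpoly_monic).trans_le ?_
    rw [Matrix.charpoly_degree_eq_dim]
    exact_mod_cast hN
  refine ⟨Matrix.of fun i _ => (q %ₘ A.charpoly).coeff i, ?_⟩
  rw [krylov_mul]
  simp only [of_apply]
  have hs : ∑ i ∈ Finset.range N, C ((q %ₘ A.charpoly).coeff i) * X ^ i = q %ₘ A.charpoly := by
    ext j
    simp only [finsetSum_coeff, coeff_C_mul, coeff_X_pow, mul_ite, mul_one, mul_zero,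
      Finset.sum_ite_eq, Finset.mem_range, ite_eq_left_iff, not_lt]
    exact fun hj => (coeff_eq_zero_of_degree_lt (hd.trans_le (by exact_mod_cast hj))).symm
  rw [Fin.sum_univ_eq_sum_range (fun i => C ((q %ₘ A.charpoly).coeff i) * X ^ i), hs,
    aeval_modByMonic_eq_self_of_root (aeval_self_charpoly A)]

/-- K * pinv K fixes the image of K, which is everything when the column is cyclic. -/
theorem krylov_mul_pinv {A : Matrix m m k} {v : Matrix m Unit k} (h : IsCyclicColumn A v) {N : ℕ}
    (hN : Fintype.card m ≤ N) : krylov A v N * pinv (krylov A v N) = 1 := by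
  refine ext_mul_column fun x => ?_
  obtain ⟨c, rfl⟩ := exists_krylov_mul h hN x
  rw [← Matrix.mul_assoc, mul_pinv_mul, Matrix.one_mul]

theorem isCyclicColumn_of_krylov_mul_pinv {A : Matrix m m k} {v : Matrix m Unit k} {N : ℕ}
    (h : krylov A v N * pinv (krylov A v N) = 1) : IsCyclicColumn A v := fun x =>
  ⟨_, by rw [← krylov_mul A v N (pinv (krylov A v N) * x), ← Matrix.mul_assoc, h, Matrix.one_mul]⟩

/-- Fitting's lemma for the iterated powers of a matrix. -/
theorem exists_pow_eq (H : Matrix m m k) {N : ℕ} (hN : Fintype.card m ≤ N) :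
    ∃ Y, H ^ N = H ^ N * H ^ N * Y := by
  have hp : H.charpoly ≠ 0 := H.charpoly_monic.ne_zero
  obtain ⟨q, hq, hq'⟩ := exists_eq_pow_rootMultiplicity_mul_and_not_dvd H.charpoly hp 0
  rw [C_0, sub_zero] at hq hq'
  have hj : H.charpoly.rootMultiplicity 0 ≤ N := by
    have := natDegree_le_of_dvd (Dvd.intro _ hq.symm) hp
    rw [natDegree_X_pow, charpoly_natDegree_eq_dim] at this
    exact this.trans hN
  -- Write χ_H = X^j q with X ∤ q and j ≤ N. Multiplying a X^N + b q = 1 by X^N gives X^N = X^(2N) a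
  -- up to a multiple of χ_H.
  obtain ⟨a, b, hab⟩ := ((irreducible_X.coprime_iff_not_dvd.2 hq').pow_left (m := N))
  refine ⟨aeval H a, ?_⟩
  have h1 : aeval H (X ^ N * q) = 0 := by
    obtain ⟨c, hc⟩ : H.charpoly ∣ X ^ N * q := by
      rw [hq]
      exact mul_dvd_mul (pow_dvd_pow _ hj) dvd_rfl
    rw [hc, map_mul, aeval_self_charpoly, zero_mul]
  have h2 : (X ^ N : k[X]) = X ^ N * X ^ N * a + b * (X ^ N * q) := by
    linear_combination -X ^ N * hab
  have h3 := congrArg (aeval H) h2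
  rw [map_add, map_mul _ b, h1, mul_zero, add_zero] at h3
  simpa using h3

/-- H^N and H^(2N) have the same image by Fitting's lemma. Hence Q * pinv (Q * Q) * Q acts as the
identity on the part where H is invertible, as seen after applying Q. -/
theorem sq_mul_pinv_mul (H : Matrix m m k) {N : ℕ} (hN : Fintype.card m ≤ N) :
    H ^ N * H ^ N * pinv (H ^ N * H ^ N) * H ^ N = H ^ N := by
  obtain ⟨Y, hY⟩ := exists_pow_eq H hN
  obtain ⟨Q, hQ⟩ : ∃ Q, Q = H ^ N := ⟨_, rfl⟩
  rw [← hQ] at hY ⊢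
  calc Q * Q * pinv (Q * Q) * Q = Q * Q * pinv (Q * Q) * (Q * Q * Y) := by rw [← hY]
    _ = Q * Q * pinv (Q * Q) * (Q * Q) * Y := by simp only [Matrix.mul_assoc]
    _ = _ := by rw [mul_pinv_mul, ← hY]

/-- The corner Z is left unspecified; only the diagonal blocks matter. -/
theorem aeval_fromBlocks (A : Matrix m m k) (Y : Matrix m p k) (B : Matrix p p k) (q : k[X]) :
    ∃ Z, aeval (fromBlocks A Y 0 B) q = fromBlocks (aeval A q) Z 0 (aeval B q) := by
  induction q using Polynomial.induction_on with
  | C a =>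
    refine ⟨0, ?_⟩
    simp only [aeval_C, Matrix.algebraMap_eq_diagonal]
    rw [fromBlocks_diagonal]
    congr 1
    ext (i | i) <;> rfl
  | add q r hq hr =>
    obtain ⟨Z, hZ⟩ := hq
    obtain ⟨Z', hZ'⟩ := hr
    exact ⟨Z + Z', by simp [hZ, hZ', fromBlocks_add]⟩
  | monomial n a h =>
    obtain ⟨Z, hZ⟩ := h
    rw [pow_succ, ← mul_assoc, map_mul, hZ]
    exact ⟨_, by rw [aeval_X, fromBlocks_multiply]; simp; rfl⟩

theorem aeval_fromBlocks_mul_inl (A : Matrix m m k) (Y : Matrix m p k) (B : Matrix p p k) (q : k[X])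
    (w : Matrix m Unit k) :
    aeval (fromBlocks A Y 0 B) q * fromRows w (0 : Matrix p Unit k) = fromRows (aeval A q * w) (0 : Matrix p Unit k) := by
  obtain ⟨Z, hZ⟩ := aeval_fromBlocks A Y B q
  rw [hZ, fromBlocks_mul_fromRows]
  simp

theorem toRows₂_aeval_fromBlocks_mul (A : Matrix m m k) (Y : Matrix m p k) (B : Matrix p p k)
    (q : k[X]) (w : Matrix m Unit k) (v : Matrix p Unit k) :
    (aeval (fromBlocks A Y 0 B) q * fromRows w v).toRows₂ = aeval B q * v := by
  obtain ⟨Z, hZ⟩ := aeval_fromBlocks A Y B q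
  rw [hZ, fromBlocks_mul_fromRows]
  simp

/-- If q kills A, then q χ_B kills the block matrix, and degrees can be compared. -/
theorem Nonderogatory.left {A : Matrix m m k} {Y : Matrix m p k} {B : Matrix p p k}
    (h : Nonderogatory (fromBlocks A Y 0 B)) : Nonderogatory A := by
  intro q hq h0
  obtain ⟨Z, hZ⟩ := aeval_fromBlocks A Y B q
  obtain ⟨Z', hZ'⟩ := aeval_fromBlocks A Y B B.charpoly
  have := h (q * B.charpoly) (mul_ne_zero hq B.charpoly_monic.ne_zero) (by
    rw [map_mul, hZ, hZ', aeval_self_charpoly, h0]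
    simp [fromBlocks_multiply])
  rw [natDegree_mul hq B.charpoly_monic.ne_zero, charpoly_natDegree_eq_dim, Fintype.card_sum] at this
  omega

theorem Nonderogatory.right {A : Matrix m m k} {Y : Matrix m p k} {B : Matrix p p k}
    (h : Nonderogatory (fromBlocks A Y 0 B)) : Nonderogatory B := by
  intro q hq h0
  obtain ⟨Z, hZ⟩ := aeval_fromBlocks A Y B q
  obtain ⟨Z', hZ'⟩ := aeval_fromBlocks A Y B A.charpoly
  have := h (A.charpoly * q) (mul_ne_zero A.charpoly_monic.ne_zero hq) (by
    rw [map_mul, hZ, hZ', aeval_self_charpoly, h0]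
    simp [fromBlocks_multiply])
  rw [natDegree_mul A.charpoly_monic.ne_zero hq, charpoly_natDegree_eq_dim, Fintype.card_sum] at this
  omega

/-- Given cyclic columns `w` for `A` and `v` for `B`, a cyclic column for the block triangular matrix
with diagonal blocks `A`, `B`, if there is one. -/
noncomputable def mergeColumns (A : Matrix m m k) (Y : Matrix m p k) (B : Matrix p p k)
    (w : Matrix m Unit k) (v : Matrix p Unit k) : Matrix (m ⊕ p) Unit k :=
  let d := Fintype.card p
  let R := krylov (fromBlocks A Y 0 B) (fromRows (0 : Matrix m Unit k) v) (d + 1)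
  let R' : Matrix (m ⊕ p) (Fin d) k := R.submatrix id Fin.castSucc
  let y : Matrix (m ⊕ p) Unit k := R.submatrix id fun _ => Fin.last d
  let u := y.toRows₁ - R'.toRows₁ * (pinv R'.toRows₂ * y.toRows₂)
  let H := krylov A u (Fintype.card m) * pinv (krylov A w (Fintype.card m))
  let Q := H ^ 2 ^ Nat.clog 2 (Fintype.card m)
  fromRows (w - Q * pinv (Q * Q) * Q * w) v

/-- Applying g to (z, v) removes the lower part and leaves ((h + g c)(A) w, 0). If h + g c is prime
to the minimal polynomial of A, this recovers (w, 0), then (0, v), and these generate everything.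
The conditions on c say that it is 0 modulo the primes of that minimal polynomial which do not
divide h, and 1 modulo those which do. In the first case h + g c ≡ h ≠ 0; in the second h + g c ≡ g,
which is nonzero because the block matrix is nonderogatory. -/
theorem isCyclicColumn_fromRows {A : Matrix m m k} {Y : Matrix m p k} {B : Matrix p p k}
    {w z u : Matrix m Unit k} {v : Matrix p Unit k} (hAB : Nonderogatory (fromBlocks A Y 0 B))
    (hw : IsCyclicColumn A w) (hv : IsCyclicColumn B v) {g h c : k[X]}
    (hg : g ≠ 0) (hgd : g.natDegree ≤ Fintype.card p)
    (hgv : aeval (fromBlocks A Y 0 B) g * fromRows (0 : Matrix m Unit k) v = fromRows u (0 : Matrix p Unit k)) (hu : aeval A h * w = u)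
    (hz : aeval A c * w = z) {N : ℕ} (h1 : aeval A (h ^ N * c) = 0) {r : k[X]}
    (h2 : aeval A (1 - c - h ^ N * r) = 0) (hN : N ≠ 0) :
    IsCyclicColumn (fromBlocks A Y 0 B) (fromRows z v) := by
  obtain ⟨M, hM⟩ : ∃ M, M = fromBlocks A Y 0 B := ⟨_, rfl⟩
  have hMw : ∀ q : k[X], aeval M q * fromRows w (0 : Matrix p Unit k) = fromRows (aeval A q * w) (0 : Matrix p Unit k) := fun q => by
    rw [hM, aeval_fromBlocks_mul_inl]
  have hspan : ∀ x : Matrix (m ⊕ p) Unit k, ∃ q s : k[X],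
      x = aeval M q * fromRows w (0 : Matrix p Unit k) + aeval M s * fromRows (0 : Matrix m Unit k) v := by
    intro x
    obtain ⟨s, hs⟩ := hv x.toRows₂
    obtain ⟨q, hq⟩ := hw (x - aeval M s * fromRows (0 : Matrix m Unit k) v).toRows₁
    refine ⟨q, s, ?_⟩
    rw [hMw, ← hq, eq_comm, ← eq_sub_iff_add_eq, ← fromRows_toRows (x - _)]
    congr 1
    ext i j
    have := congrFun (congrFun (toRows₂_aeval_fromBlocks_mul A Y B s 0 v) i) j
    rw [← hM, ← hs] at this
    simp only [toRows₂_apply, Matrix.zero_apply, Matrix.sub_apply] at this ⊢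
    exact (sub_eq_zero.2 this.symm).symm
  rw [← hM] at hAB hgv ⊢
  have hcop : IsCoprime (minpoly k A) (h + g * c) := by
    have hd1 := minpoly.dvd k A h1
    have hd2 := minpoly.dvd k A h2
    refine isCoprime_of_irreducible_dvd (fun H => minpoly.ne_zero (Matrix.isIntegral A) H.1) ?_
    intro q hq hqf hqs
    have hq' := hq.prime
    by_cases hqh : q ∣ h
    · have hqg : ¬ q ∣ g := by
        rintro ⟨g', rfl⟩
        obtain ⟨f', hf'⟩ := hqf
        obtain ⟨h', rfl⟩ := hqh
        have hf0 : f' ≠ 0 := by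
          rintro rfl
          exact minpoly.ne_zero (Matrix.isIntegral A) (by rw [hf', mul_zero])
        have hg0 := right_ne_zero_of_mul hg
        -- A common prime q of the minimal polynomial q f' of A, of g = q g' and of h = q h' would
        -- make q f' g' annihilate both generators. Its degree is too small by the degree of q.
        have hdeg := hAB (q * f' * g') (mul_ne_zero (mul_ne_zero hq.ne_zero hf0) hg0) (by
          refine ext_mul_column fun x => ?_
          obtain ⟨r, s, rfl⟩ := hspan x
          have e1 : aeval M (q * f' * g') * (aeval M r * fromRows w (0 : Matrix p Unit k)) = 0 := by
            rw [← Matrix.mul_assoc, ← map_mul, hMw, ← hf', mul_assoc, map_mul, minpoly.aeval,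
              Matrix.zero_mul, Matrix.zero_mul, fromRows_zero]
          have e2 : aeval M (q * f' * g') * (aeval M s * fromRows (0 : Matrix m Unit k) v) = 0 := by
            rw [← Matrix.mul_assoc, ← map_mul, show q * f' * g' * s = s * f' * (q * g') by ring,
              map_mul, Matrix.mul_assoc, hgv, hM, aeval_fromBlocks_mul_inl, ← hu, ← Matrix.mul_assoc,
              ← map_mul, show s * f' * (q * h') = s * h' * (q * f') by ring, ← hf', map_mul,
              minpoly.aeval, Matrix.mul_zero, Matrix.zero_mul, fromRows_zero]
          rw [Matrix.mul_add, e1, e2, Matrix.zero_mul, add_zero])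
        have hmin : (q * f').natDegree ≤ Fintype.card m := by
          rw [← hf', ← charpoly_natDegree_eq_dim A]
          exact natDegree_le_of_dvd (minpoly_dvd_charpoly A) A.charpoly_monic.ne_zero
        rw [natDegree_mul (mul_ne_zero hq.ne_zero hf0) hg0, Fintype.card_sum] at hdeg
        rw [natDegree_mul hq.ne_zero hg0] at hgd
        have := hq.natDegree_pos
        omega
      have hqc : q ∣ c := by
        rcases hq'.dvd_or_dvd ((dvd_add_right hqh).1 hqs) with H | H
        exacts [absurd H hqg, H]
      have : q ∣ 1 := by
        have h3 : q ∣ h ^ N * r := (dvd_pow hqh hN).mul_right r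
        have h4 := dvd_add (hqf.trans hd2) (dvd_add h3 hqc)
        rwa [show 1 - c - h ^ N * r + (h ^ N * r + c) = 1 by ring] at h4
      exact hq.not_isUnit (isUnit_of_dvd_one this)
    · have hqc : q ∣ c := by
        rcases hq'.dvd_or_dvd (hqf.trans hd1) with H | H
        exacts [absurd (hq'.dvd_of_dvd_pow H) hqh, H]
      exact hqh ((dvd_add_left (hqc.mul_left g)).1 hqs)
  obtain ⟨α, β, hαβ⟩ := hcop
  have hzv : fromRows z v = aeval M c * fromRows w (0 : Matrix p Unit k) + fromRows (0 : Matrix m Unit k) v := by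
    rw [hMw, hz]
    ext (i | i) j <;> simp
  have hW : aeval M (β * g) * fromRows z v = fromRows w (0 : Matrix p Unit k) := by
    have e1 : aeval M g * fromRows z v = fromRows (aeval A (h + g * c) * w) (0 : Matrix p Unit k) := by
      rw [hzv, Matrix.mul_add, hgv, ← Matrix.mul_assoc, ← map_mul, hMw, map_add, Matrix.add_mul, hu]
      ext (i | i) j <;> simp [add_comm]
    have e2 : aeval A (β * (h + g * c)) = 1 := by
      rw [← map_one (aeval (R := k) A), ← hαβ, map_add, map_mul _ α, minpoly.aeval, mul_zero,
        zero_add]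
    rw [map_mul, Matrix.mul_assoc, e1, hM, aeval_fromBlocks_mul_inl, ← Matrix.mul_assoc, ← map_mul,
      e2, Matrix.one_mul]
  have hV : aeval M (1 - c * (β * g)) * fromRows z v = fromRows (0 : Matrix m Unit k) v := by
    rw [map_sub, map_one, Matrix.sub_mul, Matrix.one_mul, map_mul, Matrix.mul_assoc, hW]
    rw [hzv]
    exact add_sub_cancel_left _ _
  intro x
  obtain ⟨q, s, rfl⟩ := hspan x
  refine ⟨q * (β * g) + s * (1 - c * (β * g)), ?_⟩
  rw [map_add, map_mul _ q, map_mul _ s, Matrix.add_mul, Matrix.mul_assoc, hW, Matrix.mul_assoc, hV]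

/-- The polynomials needed by `isCyclicColumn_fromRows` are realized by matrices. Expressing B^d v,
where d is the size of B, in the Krylov basis of v gives a monic g of degree d with g(B) v = 0, and
u is what g leaves in the upper part. Comparing the Krylov matrices of u and w yields h(A), and
`sq_mul_pinv_mul` provides c. -/
theorem isCyclicColumn_mergeColumns {A : Matrix m m k} {Y : Matrix m p k} {B : Matrix p p k}
    {w : Matrix m Unit k} {v : Matrix p Unit k} (hAB : Nonderogatory (fromBlocks A Y 0 B))
    (hw : IsCyclicColumn A w) (hv : IsCyclicColumn B v) :
    IsCyclicColumn (fromBlocks A Y 0 B) (mergeColumns A Y B w v) := by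
  obtain ⟨M, hM⟩ : ∃ M, M = fromBlocks A Y 0 B := ⟨_, rfl⟩
  obtain ⟨t, ht⟩ : ∃ t, t = fromRows (0 : Matrix m Unit k) v := ⟨_, rfl⟩
  obtain ⟨R', hR'⟩ : ∃ R', R' = krylov M t (Fintype.card p) := ⟨_, rfl⟩
  obtain ⟨y, hy⟩ : ∃ y, y = M ^ Fintype.card p * t := ⟨_, rfl⟩
  obtain ⟨u, hu⟩ : ∃ u, u = y.toRows₁ - R'.toRows₁ * (pinv R'.toRows₂ * y.toRows₂) := ⟨_, rfl⟩
  obtain ⟨H, hH⟩ : ∃ H, H = krylov A u (Fintype.card m) * pinv (krylov A w (Fintype.card m)) :=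
    ⟨_, rfl⟩
  obtain ⟨N, hN⟩ : ∃ N, N = 2 ^ Nat.clog 2 (Fintype.card m) := ⟨_, rfl⟩
  obtain ⟨Q, hQ⟩ : ∃ Q, Q = H ^ N := ⟨_, rfl⟩
  have hmerge : mergeColumns A Y B w v = fromRows (w - Q * pinv (Q * Q) * Q * w) v := by
    have e1 : (krylov M t (Fintype.card p + 1)).submatrix id Fin.castSucc = R' := hR' ▸ rfl
    have e2 : (krylov M t (Fintype.card p + 1)).submatrix id (fun _ => Fin.last _) = y := by
      subst hy
      ext i j
      rfl
    simp only [mergeColumns]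
    rw [← hM, ← ht, e1, e2, ← hu, ← hH, ← hN, ← hQ]
  have hR₂ : R'.toRows₂ = krylov B v (Fintype.card p) := by
    subst hR'
    ext i j
    have := toRows₂_aeval_fromBlocks_mul A Y B (X ^ (j : ℕ)) 0 v
    rw [← hM, ← ht, map_pow, map_pow, aeval_X, aeval_X] at this
    exact congrFun (congrFun this i) ()
  obtain ⟨a, ha⟩ : ∃ a, a = pinv R'.toRows₂ * y.toRows₂ := ⟨_, rfl⟩
  rw [← ha] at hu
  have hya : R'.toRows₂ * a = y.toRows₂ := by
    rw [ha, ← Matrix.mul_assoc, hR₂, krylov_mul_pinv hv le_rfl, Matrix.one_mul]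
  obtain ⟨s, hs⟩ : ∃ s : k[X], s = ∑ i : Fin (Fintype.card p), C (a i ()) * X ^ (i : ℕ) := ⟨_, rfl⟩
  have hsd : (-s).degree < Fintype.card p := by
    rw [degree_neg, hs]
    exact degree_sum_fin_lt _
  obtain ⟨h, hh⟩ := hw u
  have hHh : H = aeval A h := by
    have hcomm : Commute (aeval A h) A := by simpa using (Commute.all h X).map (aeval A)
    rw [hH, hh, ← mul_krylov hcomm,
      Matrix.mul_assoc, krylov_mul_pinv hw le_rfl, Matrix.mul_one]
  have hQh : Q = aeval A (h ^ N) := by rw [hQ, hHh, map_pow]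
  obtain ⟨c, hc⟩ := hw (w - Q * pinv (Q * Q) * Q * w)
  obtain ⟨r, hr⟩ := hw (pinv (Q * Q) * (Q * w))
  have hcN : Fintype.card m ≤ N := hN ▸ Nat.le_pow_clog one_lt_two _
  rw [hmerge]
  refine isCyclicColumn_fromRows hAB hw hv (g := X ^ Fintype.card p + -s) (h := h) (c := c) (u := u)
    (monic_X_pow_add hsd).ne_zero ?_ ?_ hh.symm hc.symm (N := N) ?_ (r := r) ?_
    (hN ▸ by positivity)
  · exact (natDegree_le_of_degree_le (degree_add_le_of_degree_le (degree_X_pow_le _) hsd.le))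
  · rw [← hM, ← ht, map_add, map_neg, map_pow, aeval_X, Matrix.add_mul, Matrix.neg_mul, hs,
      ← krylov_mul, ← hR', ← hy, ← sub_eq_add_neg, ← fromRows_toRows (y - R' * a)]
    congr 1
    · rw [hu]
      rfl
    · exact sub_eq_zero.2 hya.symm
  · refine aeval_eq_zero_of_isCyclicColumn hw ?_
    rw [map_mul, ← hQh, Matrix.mul_assoc, ← hc, Matrix.mul_sub, ← Matrix.mul_assoc,
      ← Matrix.mul_assoc, ← Matrix.mul_assoc, hQ, sq_mul_pinv_mul H hcN, sub_self]
  · refine aeval_eq_zero_of_isCyclicColumn hw ?_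
    rw [map_sub, map_sub, map_one, map_mul, ← hQh, Matrix.sub_mul, Matrix.sub_mul, ← hc,
      Matrix.mul_assoc Q (aeval A r), ← hr, Matrix.one_mul, sub_sub_cancel]
    simp only [Matrix.mul_assoc, sub_self]

end Merging

/-! ### Invariant subspaces by doubling, and selection of coordinates -/

section CyclicColumn

open Matrix Polynomial

variable {k : Type*} [Field k] {m n κ : Type} [Fintype m] [Fintype n] [Fintype κ]
  [DecidableEq m] [DecidableEq n]

/-- The columns of `B` generate the whole space under `A`. -/
def Generates (A : Matrix m m k) (B : Matrix m κ k) : Prop :=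
  ∀ U : Submodule k (Matrix m Unit k), (∀ x ∈ U, A * x ∈ U) → (∀ c : Matrix κ Unit k, B * c ∈ U) →
    U = ⊤

/-- A projection onto the space generated by the columns of `A ^ i * B`, for `i < 2 ^ t`. -/
noncomputable def krylovProj (A : Matrix m m k) (B : Matrix m κ k) : ℕ → Matrix m m k
  | 0 => B * pinv B
  | t + 1 =>
    let E := krylovProj A B t
    let Y := (1 - E) * (A ^ 2 ^ t * E)
    E + Y * pinv Y * (1 - E)

/-- The third clause bounds the image above by every invariant subspace containing B, the second
bounds it below. In the inductive step, Y collects what A^(2^t) adds to the image of E, and Y * pinv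
Y projects onto it inside the kernel of E. -/
theorem krylovProj_spec (A : Matrix m m k) (B : Matrix m κ k) (t : ℕ) :
    krylovProj A B t * krylovProj A B t = krylovProj A B t ∧
    (∀ i < 2 ^ t, krylovProj A B t * (A ^ i * B) = A ^ i * B) ∧
    ∀ U : Submodule k (Matrix m Unit k), (∀ x ∈ U, A * x ∈ U) →
      (∀ c : Matrix κ Unit k, B * c ∈ U) → ∀ x : Matrix m Unit k, krylovProj A B t * x ∈ U := by
  induction t with
  | zero =>
    refine ⟨?_, ?_, fun U _ hU x => ?_⟩
    · rw [krylovProj, ← Matrix.mul_assoc, mul_pinv_mul]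
    · intro i hi
      obtain rfl : i = 0 := by simpa using hi
      rw [pow_zero, Matrix.one_mul, krylovProj, mul_pinv_mul]
    · rw [krylovProj, Matrix.mul_assoc]
      exact hU _
  | succ t ih =>
    rw [krylovProj]
    obtain ⟨E, hE⟩ : ∃ E, E = krylovProj A B t := ⟨_, rfl⟩
    obtain ⟨P, hP⟩ : ∃ P, P = A ^ 2 ^ t := ⟨_, rfl⟩
    rw [← hE] at ih ⊢
    simp only [← hP]
    obtain ⟨Y, hY⟩ : ∃ Y, Y = (1 - E) * (P * E) := ⟨_, rfl⟩
    rw [← hY]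
    obtain ⟨h1, h2, h3⟩ := ih
    have hE0 : (1 - E) * E = 0 := by rw [Matrix.sub_mul, Matrix.one_mul, h1, sub_self]
    have hE1 : E * (1 - E) = 0 := by rw [Matrix.mul_sub, Matrix.mul_one, h1, sub_self]
    have hE2 : (1 - E) * (1 - E) = 1 - E := by
      rw [Matrix.mul_sub, hE0, Matrix.mul_one, sub_zero]
    have hEY : E * Y = 0 := by rw [hY, ← Matrix.mul_assoc, hE1, Matrix.zero_mul]
    have hYY : (1 - E) * Y = Y := by rw [hY, ← Matrix.mul_assoc, hE2]
    have hE' : (E + Y * pinv Y * (1 - E)) * E = E := by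
      rw [Matrix.add_mul, h1, Matrix.mul_assoc, hE0, Matrix.mul_zero, add_zero]
    have hPE : (E + Y * pinv Y * (1 - E)) * (P * E) = P * E := by
      rw [Matrix.add_mul, Matrix.mul_assoc (Y * pinv Y), ← hY, mul_pinv_mul, hY, Matrix.sub_mul,
        Matrix.one_mul]
      abel
    have hP' : ∀ i, A ^ (2 ^ t + i) * B = P * (A ^ i * B) := fun i => by
      rw [hP, ← Matrix.mul_assoc, pow_add]
    refine ⟨?_, ?_, fun U hA hU x => ?_⟩
    · rw [Matrix.mul_add, hE', ← Matrix.mul_assoc, ← Matrix.mul_assoc, Matrix.add_mul E, hEY,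
        zero_add, Matrix.mul_assoc (Y * pinv Y), hYY, mul_pinv_mul]
    · intro i hi
      rcases lt_or_ge i (2 ^ t) with h | h
      · rw [← h2 i h, ← Matrix.mul_assoc, hE', h2 i h]
      · obtain ⟨j, rfl⟩ := Nat.exists_eq_add_of_le h
        have hj : j < 2 ^ t := by rw [pow_succ] at hi; omega
        rw [hP', ← h2 j hj, ← Matrix.mul_assoc P, ← Matrix.mul_assoc, hPE]
    · have hAp : ∀ i, ∀ x ∈ U, A ^ i * x ∈ U := by
        intro i
        induction i with
        | zero => intro x hx; rwa [pow_zero, Matrix.one_mul]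
        | succ i ih => intro x hx; rw [pow_succ', Matrix.mul_assoc]; exact hA _ (ih x hx)
      have hYU : ∀ x : Matrix m Unit k, Y * x ∈ U := by
        intro x
        rw [hY, Matrix.sub_mul, Matrix.one_mul, Matrix.sub_mul]
        refine U.sub_mem ?_ ?_
        · rw [Matrix.mul_assoc, hP]; exact hAp _ _ (h3 U hA hU x)
        · rw [Matrix.mul_assoc]; exact h3 U hA hU _
      rw [Matrix.add_mul, Matrix.mul_assoc, Matrix.mul_assoc]
      exact U.add_mem (h3 U hA hU x) (hYU _)

/-- By the Cayley–Hamilton theorem the powers below the size give all polynomials in A. -/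
theorem krylovProj_invariant (A : Matrix m m k) (B : Matrix m κ k) {t : ℕ}
    (ht : Fintype.card m ≤ 2 ^ t) :
    krylovProj A B t * (A * krylovProj A B t) = A * krylovProj A B t ∧ krylovProj A B t * B = B := by
  obtain ⟨-, h2, h3⟩ := krylovProj_spec A B t
  obtain ⟨E, hE⟩ : ∃ E, E = krylovProj A B t := ⟨_, rfl⟩
  rw [← hE] at h2 h3 ⊢
  refine ⟨?_, by simpa using h2 0 (by positivity)⟩
  have hq : ∀ q : k[X], E * (aeval A q * B) = aeval A q * B := by
    intro q
    rw [← aeval_modByMonic_eq_self_of_root (aeval_self_charpoly A) (p := q), aeval_eq_sum_range,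
      Matrix.sum_mul, Matrix.mul_sum]
    refine Finset.sum_congr rfl fun i hi => ?_
    rw [Matrix.smul_mul, Matrix.mul_smul]
    by_cases h0 : q %ₘ A.charpoly = 0
    · simp [h0]
    rw [h2]
    have := natDegree_lt_natDegree h0 (degree_modByMonic_lt q A.charpoly_monic)
    rw [charpoly_natDegree_eq_dim] at this
    have := Finset.mem_range.1 hi
    omega
  -- The largest invariant subspace on which E is the identity. It contains the columns of B, hence
  -- the image of E.
  let U : Submodule k (Matrix m Unit k) :=
    { carrier := {x | ∀ q : k[X], E * (aeval A q * x) = aeval A q * x}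
      add_mem' := fun {x y} hx hy q => by
        rw [Matrix.mul_add, Matrix.mul_add, hx q, hy q]
      zero_mem' := fun q => by simp
      smul_mem' := fun c x hx q => by
        rw [Matrix.mul_smul, Matrix.mul_smul, hx q] }
  refine ext_mul_column fun x => ?_
  have := h3 U (fun x hx q => ?_) (fun c q => ?_) x X
  · rw [aeval_X] at this
    simpa only [Matrix.mul_assoc] using this
  · have := hx (q * X)
    rwa [map_mul, aeval_X, Matrix.mul_assoc] at this
  · rw [← Matrix.mul_assoc (aeval A q), ← Matrix.mul_assoc, hq]

/-- The indices of the nonzero columns of a matrix. -/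
def columnSupport (H : Matrix m n k) : Set n := {j | ∃ i, H i j ≠ 0}

/-- Transposition makes the selective inverse choose rows of E that form a basis of its row space.
The chosen set is exactly the set of nonzero columns of H, so it can be found by zero tests. The
columns of E * H in this set form a basis of the image of E and restrict to the identity on these
rows. -/
theorem exists_transpose_pinv (E : Matrix m m k) : ∃ H, H = (pinv Eᵀ)ᵀ ∧ E * H * E = E ∧
    H * selector (columnSupport H) = H ∧ selector (columnSupport H) * (E * H) =
      selector (columnSupport H) := by
  obtain ⟨s, h⟩ := exists_isSelectiveInverse_pinv Eᵀ
  obtain ⟨H, hH⟩ : ∃ H, H = (pinv Eᵀ)ᵀ := ⟨_, rfl⟩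
  have hH' : pinv Eᵀ = Hᵀ := by rw [hH, transpose_transpose]
  have hD : (selector s : Matrix m m k)ᵀ = selector s := by
    rw [selector, diagonal_transpose]
  rw [hH'] at h
  have h1 := congrArg transpose h.inner
  have h2 := congrArg transpose h.left
  have h3 := congrArg transpose h.right
  simp only [transpose_mul, transpose_transpose, hD] at h1 h2 h3
  have hs : columnSupport H = s := by
    ext j
    constructor
    · rintro ⟨i, hi⟩
      by_contra hj
      apply hi
      have := congrFun (congrFun h2 i) j
      rw [← this]
      simp [selector, hj]
    · intro hj
      by_contra hc
      simp only [columnSupport, Set.mem_ofPred_eq, not_exists, not_not] at hc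
      have := congrFun (congrFun h3 j) j
      rw [← Matrix.mul_assoc, Matrix.mul_apply] at this
      simp [selector, hj, hc] at this
  refine ⟨H, hH, ?_, ?_, ?_⟩
  · rw [← h1, Matrix.mul_assoc, h1, h1]
  · rw [hs, h2]
  · rw [hs, h3]

section Similarity

variable {A : Matrix m m k} {P : Matrix m n k} {P' : Matrix n m k}

theorem aeval_similar (h₁ : P * P' = 1) (h₂ : P' * P = 1) (q : k[X]) :
    aeval (P' * A * P) q = P' * aeval A q * P := by
  induction q using Polynomial.induction_on with
  | C a =>
    rw [aeval_C, aeval_C, Algebra.algebraMap_eq_smul_one, Algebra.algebraMap_eq_smul_one,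
      Matrix.mul_smul, Matrix.smul_mul, Matrix.mul_one, h₂]
  | add q r hq hr => rw [map_add, map_add, hq, hr, Matrix.mul_add, Matrix.add_mul]
  | monomial n a h =>
    rw [pow_succ, ← mul_assoc, map_mul, map_mul _ _ X, h, aeval_X, aeval_X]
    simp only [Matrix.mul_assoc]
    rw [← Matrix.mul_assoc P P', h₁, Matrix.one_mul]

theorem Nonderogatory.similar (hA : Nonderogatory A) (h₁ : P * P' = 1) (h₂ : P' * P = 1)
    (hc : Fintype.card n ≤ Fintype.card m) : Nonderogatory (P' * A * P) := by
  intro q hq h0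
  refine hc.trans (hA q hq ?_)
  rw [aeval_similar h₁ h₂] at h0
  calc aeval A q = P * P' * aeval A q * (P * P') := by rw [h₁, Matrix.one_mul, Matrix.mul_one]
    _ = P * (P' * aeval A q * P) * P' := by simp only [Matrix.mul_assoc]
    _ = 0 := by rw [h0, Matrix.mul_zero, Matrix.zero_mul]

theorem IsCyclicColumn.similar {y : Matrix n Unit k} (h : IsCyclicColumn (P' * A * P) y)
    (h₁ : P * P' = 1) (h₂ : P' * P = 1) : IsCyclicColumn A (P * y) := by
  intro x
  obtain ⟨q, hq⟩ := h (P' * x)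
  refine ⟨q, ?_⟩
  rw [aeval_similar h₁ h₂] at hq
  calc x = P * P' * x := by rw [h₁, Matrix.one_mul]
    _ = P * P' * (aeval A q * (P * y)) := by
      rw [Matrix.mul_assoc, hq]; simp only [Matrix.mul_assoc]
    _ = _ := by rw [h₁, Matrix.one_mul]

end Similarity

end CyclicColumn

/-! ### Adapted bases and the recursion for a cyclic column -/

section CyclicColumn

open Matrix Polynomial

variable {k : Type*} [Field k] {ι : Type} [Fintype ι] [DecidableEq ι]

open Classical in
/-- The matrix with columns in `S` those of a projection `E * H`, and the standard unit vectors as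
the other columns. -/
noncomputable def adaptedBasis (S : Set ι) (E H : Matrix ι ι k) : Matrix ι (S ⊕ (Sᶜ : Set ι)) k :=
  (1 + (1 - selector S) * (E * H)).submatrix id (Equiv.Set.sumCompl S)

open Classical in
/-- The inverse of `adaptedBasis`. -/
noncomputable def adaptedBasisInv (S : Set ι) (E H : Matrix ι ι k) :
    Matrix (S ⊕ (Sᶜ : Set ι)) ι k :=
  (1 - (1 - selector S) * (E * H)).submatrix (Equiv.Set.sumCompl S) id

section Basis

variable {S : Set ι} {E H : Matrix ι ι k}

/-- The change of basis is 1 plus a matrix of square zero, so its inverse is obtained by a change of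
sign. -/
theorem adaptedBasis_aux (hS : H * selector S = H) :
    (1 - selector S) * (E * H) * ((1 - selector S) * (E * H)) = 0 := by
  rw [Matrix.mul_assoc, ← Matrix.mul_assoc (E * H), Matrix.mul_sub, Matrix.mul_one,
    Matrix.mul_assoc E H, hS, sub_self, Matrix.zero_mul, Matrix.mul_zero]

theorem adaptedBasis_mul_inv [Fintype S] [Fintype (Sᶜ : Set ι)] (hS : H * selector S = H) :
    adaptedBasis S E H * adaptedBasisInv S E H = 1 := by
  classical
  rw [adaptedBasis, adaptedBasisInv, submatrix_mul_equiv, Matrix.mul_sub, Matrix.add_mul _ _ ((1 - selector S) * (E * H)),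
    adaptedBasis_aux hS]
  simp

theorem adaptedBasisInv_mul [DecidableEq S] [DecidableEq (Sᶜ : Set ι)] (hS : H * selector S = H) :
    adaptedBasisInv S E H * adaptedBasis S E H = 1 := by
  rw [adaptedBasis, adaptedBasisInv]
  rw [← submatrix_mul _ _ _ _ _ Function.bijective_id, Matrix.sub_mul, Matrix.mul_add ((1 - selector S) * (E * H)),
    adaptedBasis_aux hS]
  simp

/-- Vectors in the image of E have no coordinates outside S; `adaptedBasis_mul_fromRows` is the
converse. -/
theorem adaptedBasisInv_toRows₂ (h : E * H * E = E) {l : Type*} (X : Matrix ι l k) :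
    (adaptedBasisInv S E H * (E * X)).toRows₂ = 0 := by
  have h1 : (1 - selector S) * ((1 - (1 - selector S) * (E * H)) * E) = 0 := by
    have : (1 - selector S : Matrix ι ι k) * (1 - selector S) = 1 - selector S := by
      have : (selector S : Matrix ι ι k) * selector S = selector S := by
        simp only [selector, diagonal_mul_diagonal]
        congr 1
        ext i
        by_cases hi : i ∈ S <;> simp [hi]
      rw [Matrix.mul_sub, Matrix.sub_mul, Matrix.sub_mul, this]
      simp
    rw [Matrix.sub_mul 1 ((1 - selector S) * (E * H)), Matrix.one_mul,
      Matrix.mul_assoc (1 - selector S), h, Matrix.mul_sub,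
      ← Matrix.mul_assoc (1 - selector S) (1 - selector S), this, sub_self]
  have h2 : (1 - selector S : Matrix ι ι k) * ((1 - (1 - selector S) * (E * H) : Matrix ι ι k) *
      (E * X : Matrix ι l k)) = 0 := by
    rw [← Matrix.mul_assoc _ E, ← Matrix.mul_assoc, h1, Matrix.zero_mul]
  ext ⟨i, hi⟩ j
  replace h2 := congrFun (congrFun h2 i) j
  have h3 : ∀ Y : Matrix ι l k, ((1 - selector S : Matrix ι ι k) * Y) i j = Y i j := by
    intro Y
    rw [Matrix.sub_mul, Matrix.one_mul, Matrix.sub_apply, selector, diagonal_mul]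
    simp [show i ∉ S from hi]
  rw [h3] at h2
  refine Eq.trans ?_ h2
  change (adaptedBasisInv S E H * (E * X)) (Sum.inr ⟨i, hi⟩) j = _
  rw [Matrix.mul_apply, Matrix.mul_apply]
  rfl

theorem adaptedBasis_mul_fromRows [Fintype S] [Fintype (Sᶜ : Set ι)] (h2 : H * selector S = H)
    (h3 : selector S * (E * H) = selector S) {l : Type} (y : Matrix S l k) :
    ∃ x : Matrix ι l k, adaptedBasis S E H * fromRows y (0 : Matrix (Sᶜ : Set ι) l k) = E * x := by
  classical
  obtain ⟨Y, hY⟩ : ∃ Y : Matrix ι l k,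
      Y = (fromRows y (0 : Matrix (Sᶜ : Set ι) l k)).submatrix (Equiv.Set.sumCompl S).symm id :=
    ⟨_, rfl⟩
  refine ⟨H * Y, ?_⟩
  have hY' : fromRows y (0 : Matrix (Sᶜ : Set ι) l k) = Y.submatrix (Equiv.Set.sumCompl S) id := by
    rw [hY, submatrix_submatrix]; simp
  have hSY : (selector S : Matrix ι ι k) * Y = Y := by
    ext i j
    rw [selector, diagonal_mul, hY]
    by_cases hi : i ∈ S
    · simp [hi]
    · simp [hi, Equiv.Set.sumCompl_symm_apply_of_notMem]
  have hT : (1 + (1 - selector S) * (E * H)) * selector S = E * H := by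
    rw [Matrix.add_mul, Matrix.one_mul, Matrix.mul_assoc, Matrix.mul_assoc, h2, Matrix.sub_mul,
      Matrix.one_mul, h3]
    abel
  rw [hY', adaptedBasis, submatrix_mul_equiv, submatrix_id_id, ← hSY, ← Matrix.mul_assoc, hT,
    hSY, Matrix.mul_assoc]

end Basis

/-- One step in the construction of a cyclic column. -/
noncomputable def cyclicColumnStep {κ : Type} (rec : ∀ {ι : Type} [Fintype ι] [DecidableEq ι],
    Matrix ι ι k → Matrix ι κ k → Matrix ι Unit k) (S : Set ι) (E H A : Matrix ι ι k)
    (B : Matrix ι (κ ⊕ κ) k) : Matrix ι Unit k :=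
  letI := Fintype.ofFinite S
  letI := Fintype.ofFinite (Sᶜ : Set ι)
  let P' := adaptedBasisInv S E H
  let M := P' * A * adaptedBasis S E H
  let C := P' * B
  adaptedBasis S E H * mergeColumns M.toBlocks₁₁ M.toBlocks₁₂ M.toBlocks₂₂
    (rec M.toBlocks₁₁ C.toBlocks₁₁) (rec M.toBlocks₂₂ C.toBlocks₂₂)

/-- A cyclic column for a nonderogatory matrix `A`, when the columns of `B` generate the whole space
under `A`. -/
noncomputable def cyclicColumn : (s : ℕ) → {ι : Type} → [Fintype ι] → [DecidableEq ι] →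
    Matrix ι ι k → Matrix ι (Idx s) k → Matrix ι Unit k
  | 0, _, _, _, _, B => B
  | s + 1, ι, _, _, A, B =>
    let E := krylovProj A (B.submatrix id Sum.inl) (Nat.clog 2 (Fintype.card ι))
    let H := (pinv Eᵀ)ᵀ
    cyclicColumnStep (cyclicColumn s) (columnSupport H) E H A B

/-- Invariance of the image of E makes the conjugated matrix block triangular. The first half of the
columns generates the upper block by minimality of the image of E. Modulo this image these columns
vanish, so the second half generates the quotient. -/
theorem isCyclicColumn_step {κ : Type} [Fintype κ] {rec : ∀ {ι : Type} [Fintype ι] [DecidableEq ι],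
    Matrix ι ι k → Matrix ι κ k → Matrix ι Unit k}
    (hrec : ∀ {ι : Type} [Fintype ι] [DecidableEq ι] (A : Matrix ι ι k) (B : Matrix ι κ k),
      Nonderogatory A → Generates A B → IsCyclicColumn A (rec A B))
    {S : Set ι} {E H A : Matrix ι ι k} {B : Matrix ι (κ ⊕ κ) k} (hA : Nonderogatory A)
    (hB : Generates A B) (hEA : E * (A * E) = A * E)
    (hEB : E * B.submatrix id Sum.inl = B.submatrix id Sum.inl)
    (hEU : ∀ U : Submodule k (Matrix ι Unit k), (∀ x ∈ U, A * x ∈ U) →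
      (∀ c : Matrix κ Unit k, B.submatrix id Sum.inl * c ∈ U) → ∀ x : Matrix ι Unit k, E * x ∈ U)
    (h1 : E * H * E = E) (h2 : H * selector S = H) (h3 : selector S * (E * H) = selector S) :
    IsCyclicColumn A (cyclicColumnStep rec S E H A B) := by
  classical
  let := Fintype.ofFinite S
  let := Fintype.ofFinite (Sᶜ : Set ι)
  obtain ⟨P, hP⟩ : ∃ P, P = adaptedBasis S E H := ⟨_, rfl⟩
  obtain ⟨P', hP'⟩ : ∃ P', P' = adaptedBasisInv S E H := ⟨_, rfl⟩
  have hPP' : P * P' = 1 := by rw [hP, hP', adaptedBasis_mul_inv h2]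
  have hP'P : P' * P = 1 := by rw [hP, hP', adaptedBasisInv_mul h2]
  obtain ⟨M, hM⟩ : ∃ M, M = P' * A * P := ⟨_, rfl⟩
  have hM' : M = fromBlocks M.toBlocks₁₁ M.toBlocks₁₂ 0 M.toBlocks₂₂ := by
    conv_lhs => rw [← fromBlocks_toBlocks M]
    congr 1
    refine ext_mul_column fun y => ?_
    obtain ⟨x, hx⟩ := adaptedBasis_mul_fromRows h2 h3 y
    have h4 : (M * fromRows y (0 : Matrix (Sᶜ : Set ι) Unit k)).toRows₂ = 0 := by
      rw [hM, Matrix.mul_assoc, hP, hx, Matrix.mul_assoc, ← Matrix.mul_assoc A E, ← hEA, hP',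
        Matrix.mul_assoc E, adaptedBasisInv_toRows₂ h1]
    rw [Matrix.zero_mul, ← h4]
    conv_rhs => rw [← fromBlocks_toBlocks M, fromBlocks_mul_fromRows]
    simp
  have hMP : ∀ x : Matrix ι Unit k, P' * (A * x) = M * (P' * x) := fun x => by
    rw [hM, Matrix.mul_assoc (P' * A), ← Matrix.mul_assoc P, hPP', Matrix.one_mul, Matrix.mul_assoc]
  have hM1 : ∀ y : Matrix (S ⊕ (Sᶜ : Set ι)) Unit k, y.toRows₂ = 0 →
      (M * y).toRows₁ = M.toBlocks₁₁ * y.toRows₁ ∧ (M * y).toRows₂ = 0 := by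
    intro y hy
    rw [← fromRows_toRows y, hy, hM', fromBlocks_mul_fromRows]
    simp
  have hM2 : ∀ y : Matrix (S ⊕ (Sᶜ : Set ι)) Unit k,
      (M * y).toRows₂ = M.toBlocks₂₂ * y.toRows₂ := by
    intro y
    rw [← fromRows_toRows y, hM', fromBlocks_mul_fromRows]
    simp
  obtain ⟨C, hC⟩ : ∃ C, C = P' * B := ⟨_, rfl⟩
  have hC21 : C.toBlocks₂₁ = 0 := by
    have := adaptedBasisInv_toRows₂ (S := S) h1 (B.submatrix id Sum.inl)
    rw [hEB, ← hP'] at this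
    rw [hC]
    ext i j
    exact congrFun (congrFun this i) j
  have hN : Nonderogatory M := hM ▸ hA.similar hPP' hP'P
    (Fintype.card_congr (Equiv.Set.sumCompl S)).le
  rw [hM'] at hN
  have hG1 : Generates M.toBlocks₁₁ C.toBlocks₁₁ := by
    intro U hU hUC
    -- The subspace U, seen inside the image of E.
    let V : Submodule k (Matrix ι Unit k) :=
      { carrier := {x | (P' * x).toRows₂ = 0 ∧ (P' * x).toRows₁ ∈ U}
        add_mem' := fun {x y} hx hy => by
          rw [Set.mem_ofPred_eq, Matrix.mul_add]
          exact ⟨(congrArg₂ (· + ·) hx.1 hy.1).trans (add_zero _), U.add_mem hx.2 hy.2⟩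
        zero_mem' := by
          rw [Set.mem_ofPred_eq, Matrix.mul_zero]
          exact ⟨rfl, U.zero_mem⟩
        smul_mem' := fun c x hx => by
          rw [Set.mem_ofPred_eq, Matrix.mul_smul]
          exact ⟨(congrArg (c • ·) hx.1).trans (smul_zero _), U.smul_mem c hx.2⟩ }
    have hV := hEU V (fun x hx => ?_) (fun c => ?_)
    · rw [eq_top_iff]
      rintro y -
      obtain ⟨x, hx⟩ := adaptedBasis_mul_fromRows h2 h3 y
      have := (hV x).2
      rw [← hx, ← hP, ← Matrix.mul_assoc, hP'P, Matrix.one_mul] at this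
      simpa using this
    · change (P' * (A * x)).toRows₂ = 0 ∧ (P' * (A * x)).toRows₁ ∈ U
      rw [hMP, (hM1 _ hx.1).1, (hM1 _ hx.1).2]
      exact ⟨rfl, hU _ hx.2⟩
    · change (P' * (B.submatrix id Sum.inl * c)).toRows₂ = 0 ∧
        (P' * (B.submatrix id Sum.inl * c)).toRows₁ ∈ U
      have e : P' * (B.submatrix id Sum.inl * c) = C.submatrix id Sum.inl * c := by
        rw [← Matrix.mul_assoc, hC]
        rfl
      rw [e]
      refine ⟨?_, hUC c⟩
      change C.toBlocks₂₁ * c = 0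
      rw [hC21, Matrix.zero_mul]
  have hG2 : Generates M.toBlocks₂₂ C.toBlocks₂₂ := by
    intro U hU hUC
    -- The preimage of U under passage to the quotient.
    let V : Submodule k (Matrix ι Unit k) :=
      { carrier := {x | (P' * x).toRows₂ ∈ U}
        add_mem' := fun {x y} hx hy => by
          rw [Set.mem_ofPred_eq, Matrix.mul_add]
          exact U.add_mem hx hy
        zero_mem' := by
          rw [Set.mem_ofPred_eq, Matrix.mul_zero]
          exact U.zero_mem
        smul_mem' := fun c x hx => by
          rw [Set.mem_ofPred_eq, Matrix.mul_smul]
          exact U.smul_mem c hx }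
    have hV := hB V (fun x hx => ?_) (fun c => ?_)
    · rw [eq_top_iff]
      rintro y -
      have : P * fromRows (0 : Matrix S Unit k) y ∈ V := hV ▸ Submodule.mem_top
      change (P' * (P * fromRows (0 : Matrix S Unit k) y)).toRows₂ ∈ U at this
      rw [← Matrix.mul_assoc, hP'P, Matrix.one_mul] at this
      simpa using this
    · change (P' * (A * x)).toRows₂ ∈ U
      rw [hMP, hM2]
      exact hU _ hx
    · change (P' * (B * c)).toRows₂ ∈ U
      rw [← Matrix.mul_assoc, ← hC, ← fromBlocks_toBlocks C, hC21, ← fromRows_toRows c,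
        fromBlocks_mul_fromRows]
      simpa using hUC _
  have := isCyclicColumn_mergeColumns hN (hrec _ _ hN.left hG1) (hrec _ _ hN.right hG2)
  rw [← hM', hM] at this
  have := this.similar hPP' hP'P
  rw [hC, hP, hP'] at this
  exact this

theorem isCyclicColumn_cyclicColumn : ∀ (s : ℕ) {ι : Type} [Fintype ι] [DecidableEq ι]
    (A : Matrix ι ι k) (B : Matrix ι (Idx s) k), Nonderogatory A → Generates A B →
    IsCyclicColumn A (cyclicColumn s A B)
  | 0, ι, _, _, A, B, _, hB => by
    let U : Submodule k (Matrix ι Unit k) :=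
      { carrier := {x | ∃ q : k[X], x = aeval A q * (show Matrix ι Unit k from B)}
        add_mem' := by
          rintro _ _ ⟨q, rfl⟩ ⟨r, rfl⟩
          exact ⟨q + r, by rw [map_add, Matrix.add_mul]⟩
        zero_mem' := ⟨0, by rw [map_zero, Matrix.zero_mul]⟩
        smul_mem' := by
          rintro c _ ⟨q, rfl⟩
          exact ⟨c • q, by rw [map_smul, Matrix.smul_mul]⟩ }
    have hU := hB U ?_ fun c => ⟨C (c () ()), ?_⟩
    · intro x
      have : x ∈ U := hU ▸ Submodule.mem_top
      exact this
    · rintro _ ⟨q, rfl⟩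
      exact ⟨X * q, by rw [map_mul, aeval_X, Matrix.mul_assoc]⟩
    · rw [aeval_C, Algebra.algebraMap_eq_smul_one, Matrix.smul_mul, Matrix.one_mul]
      ext i j
      change ∑ a : Unit, (show Matrix ι Unit k from B) i a * c a j =
        c () () * (show Matrix ι Unit k from B) i j
      simp [mul_comm]
  | s + 1, ι, _, _, A, B, hA, hB => by
    obtain ⟨-, -, hEU⟩ := krylovProj_spec A (B.submatrix id Sum.inl)
      (Nat.clog 2 (Fintype.card ι))
    obtain ⟨hEA, hEB⟩ := krylovProj_invariant A (B.submatrix id Sum.inl)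
      (Nat.le_pow_clog one_lt_two (Fintype.card ι))
    obtain ⟨H, hH, h1, h2, h3⟩ := exists_transpose_pinv (krylovProj A (B.submatrix id Sum.inl)
      (Nat.clog 2 (Fintype.card ι)))
    subst hH
    exact isCyclicColumn_step (rec := cyclicColumn s) (isCyclicColumn_cyclicColumn s) hA hB hEA
      hEB hEU h1 h2 h3

end CyclicColumn

/-! ### Cost of Krylov matrices, projections and gluing -/

section CyclicColumnCost

open Matrix

variable {W : Type*} {K : W → Type u} [∀ w, Field (K w)] {N ℓ : ℕ} {μ : ℝ} {D : Set W}
  {S : Set (∀ w, K w)} {m p κ : Type} [Fintype m] [Fintype p] [Fintype κ] [DecidableEq m]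
  [DecidableEq p]

theorem Budget.pow_two_pow (hB : Budget.{u} N μ) [SizeLE m N] {A : ∀ w, Matrix m m (K w)}
    (hA : entries A ⊆ S) (t : ℕ) : Steps μ t D S (fun w => A w ^ 2 ^ t) := by
  induction t with
  | zero => simpa using Steps.of_subset hA
  | succ t ih =>
    refine ih.chain (Nat.le_succ t) fun S' hS hP => ?_
    refine ((hB.mul (Steps.of_subset hP) (Steps.of_subset hP)).of_le hB.nonneg (by omega)).congr
      fun w _ => ?_
    rw [pow_succ, mul_two, pow_add]

theorem entries_krylov_subset {A : ∀ w, Matrix m m (K w)} {v : ∀ w, Matrix m Unit (K w)} {a b : ℕ}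
    (h : a ≤ b) : entries (fun w => krylov (A w) (v w) a) ⊆ entries fun w => krylov (A w) (v w) b :=
  entries_subset_iff.2 fun i j => mem_entries (fun w => krylov (A w) (v w) b) i (Fin.castLE h j)

/-- Appending A^(2^t) K to K doubles the number of columns, so two products per doubling suffice:
one for the columns and one to square the power. -/
theorem Budget.krylov_two_pow (hB : Budget.{u} N μ) [SizeLE m N] {A : ∀ w, Matrix m m (K w)}
    {v : ∀ w, Matrix m Unit (K w)} (hA : entries A ⊆ S) (hv : entries v ⊆ S) (t : ℕ)
    (ht : 2 ^ t ≤ N) : Computes ((2 * t : ℕ) * μ) D S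
      (entries (fun w => A w ^ 2 ^ t) ∪ entries fun w => krylov (A w) (v w) (2 ^ t)) := by
  induction t with
  | zero =>
    refine Computes.mono (Computes.of_subset (Set.union_subset hA hv)) (by simp) subset_rfl ?_
    refine Set.union_subset_union (le_of_eq ?_) ?_
    · simp
    · refine entries_subset_iff.2 fun i j => ⟨(i, ()), ?_⟩
      funext w
      simp [krylov]
  | succ t ih =>
    have : SizeLE (Fin (2 ^ t)) N := ⟨by rw [pow_succ] at ht; simp; omega⟩
    specialize ih (by rw [pow_succ] at ht; omega)
    refine ((ih.bind (c₂ := μ + μ)) fun S' hS hT => ?_).of_le (by push_cast; linarith)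
    have hP := Set.subset_union_left.trans hT
    have hK := Set.subset_union_right.trans hT
    have h1 := hB.mul (D := D) (Steps.of_subset hP) (Steps.of_subset hP)
    have h2 := hB.mul (D := D) (Steps.of_subset hP) (Steps.of_subset hK)
    simp only [Steps, zero_add, Nat.cast_one, one_mul] at h1 h2
    refine ((Computes.of_subset hK).union (h1.union h2)).mono (by simp) subset_rfl ?_
    refine Set.union_subset ?_ (entries_subset_iff.2 fun i j => ?_)
    · simp only [pow_succ 2 t, mul_two, pow_add]
      exact Set.subset_union_left.trans Set.subset_union_right
    · rcases lt_or_ge (j : ℕ) (2 ^ t) with hj | hj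
      · exact .inl ⟨(i, ⟨j, hj⟩), rfl⟩
      · refine .inr (.inr ⟨(i, ⟨j - 2 ^ t, ?_⟩), ?_⟩)
        · have := j.2
          have := pow_succ 2 t
          omega
        · funext w
          change (A w ^ 2 ^ t * krylov (A w) (v w) (2 ^ t) : Matrix m (Fin (2 ^ t)) (K w)) i ⟨j - 2 ^ t, _⟩ = _
          rw [mul_krylov (Commute.pow_self (A w) _)]
          change (A w ^ ((j : ℕ) - 2 ^ t) * (A w ^ 2 ^ t * v w : Matrix m Unit (K w)) :
            Matrix m Unit (K w)) i () = (A w ^ (j : ℕ) * v w : Matrix m Unit (K w)) i ()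
          rw [← Matrix.mul_assoc, ← pow_add, Nat.sub_add_cancel hj]

theorem Nat.two_pow_clog_le {a : ℕ} (ha : 0 < a) : 2 ^ Nat.clog 2 a ≤ 2 * a := by
  rcases Nat.lt_or_ge 1 a with h | h
  · have h1 := Nat.pow_pred_clog_lt_self one_lt_two h
    have h2 : 0 < Nat.clog 2 a := Nat.clog_pos one_lt_two h
    obtain ⟨c, hc⟩ := Nat.exists_eq_succ_of_ne_zero h2.ne'
    rw [hc] at h1 ⊢
    rw [Nat.pred_succ] at h1
    rw [Nat.succ_eq_add_one, pow_succ]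
    omega
  · rw [Nat.clog_of_right_le_one h]
    omega

/-- Rounding d up to a power of two may nearly double it, hence 2 d ≤ N. -/
theorem Budget.krylov (hB : Budget.{u} N μ) [SizeLE m N] {A : ∀ w, Matrix m m (K w)}
    {v : ∀ w, Matrix m Unit (K w)} (hA : entries A ⊆ S) (hv : entries v ⊆ S) {d : ℕ}
    (hd : 2 * d ≤ N) (hℓ : N ≤ 2 ^ ℓ) :
    Steps μ (2 * ℓ) D S (fun w => krylov (A w) (v w) d) := by
  rcases Nat.eq_zero_or_pos d with rfl | hd0
  · refine Computes.mono (Computes.of_subset (Set.empty_subset _)) ?_ subset_rfl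
      (Set.range_eq_empty _).le
    have := hB.nonneg
    positivity
  have h1 := (Nat.two_pow_clog_le hd0).trans hd
  refine Computes.mono (hB.krylov_two_pow hA hv (Nat.clog 2 d) h1) ?_ subset_rfl
    ((entries_krylov_subset (Nat.le_pow_clog one_lt_two d)).trans Set.subset_union_right)
  have h2 : Nat.clog 2 d ≤ ℓ := (Nat.pow_le_pow_iff_right one_lt_two).1 (h1.trans hℓ)
  have := hB.nonneg
  gcongr

theorem Toolkit.krylovProj (hT : Toolkit K N μ) [SizeLE m N] [SizeLE κ N]
    {A : ∀ w, Matrix m m (K w)} {B : ∀ w, Matrix m κ (K w)} (hA : entries A ⊆ S)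
    (hB : entries B ⊆ S) (t : ℕ) : Computes ((20 * t + 2 : ℕ) * μ) D S
      (entries (fun w => A w ^ 2 ^ t) ∪ entries fun w => krylovProj (A w) (B w) t) := by
  have b := hT.toBudget
  induction t with
  | zero =>
    have h1 := b.mul (Steps.of_subset hB) (hT.pinv (D := D) (Steps.of_subset hB))
    refine ((Computes.of_subset hA).union h1).mono (by simp) subset_rfl ?_
    refine Set.union_subset_union (le_of_eq ?_) subset_rfl
    simp
  | succ t ih =>
    refine ((ih.bind (c₂ := (1 : ℕ) * μ + (19 : ℕ) * μ)) fun S' hS hT' => ?_).of_le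
      (by push_cast; linarith)
    have hP := Set.subset_union_left.trans hT'
    have hE := Set.subset_union_right.trans hT'
    have v {S' : Set (∀ w, K w)} {l : Type} {X : ∀ w, Matrix m l (K w)} (h : entries X ⊆ S') :
        Steps μ 0 D S' X := Steps.of_subset h
    have one {S' : Set (∀ w, K w)} : Steps μ 1 D S' (fun w => (1 : Matrix m m (K w))) :=
      b.one
    refine Computes.union ?_ ?_
    · refine Steps.congr (b.mul (v hP) (v hP)) fun w _ => ?_
      rw [pow_succ, mul_two, pow_add]
    · simp only [_root_.krylovProj]
      change Steps μ 19 D S' _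
      refine (b.mul (b.sub one (v hE)) (b.mul (v hP) (v hE))).chain (by omega) fun S₁ h₁ hY => ?_
      replace hE := hE.trans h₁
      refine (b.add (v hE) (b.mul (b.mul (v hY) (hT.pinv (v hY))) (b.sub one (v hE)))).of_le
        b.nonneg (by omega)

/-- Three Krylov matrices account for 6 ℓ and the iterated squaring of H for ℓ. -/
theorem Toolkit.mergeColumns (hT : Toolkit K N μ) {A : ∀ w, Matrix m m (K w)}
    {Y : ∀ w, Matrix m p (K w)} {B : ∀ w, Matrix p p (K w)} {x : ∀ w, Matrix m Unit (K w)}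
    {y : ∀ w, Matrix p Unit (K w)} (hA : entries A ⊆ S) (hY : entries Y ⊆ S) (hB : entries B ⊆ S)
    (hx : entries x ⊆ S) (hy : entries y ⊆ S)
    (hN : 2 * (Fintype.card m + Fintype.card p + 1) ≤ N) (hℓ : N ≤ 2 ^ ℓ) :
    Steps μ (7 * ℓ + 50) D S (fun w => mergeColumns (A w) (Y w) (B w) (x w) (y w)) := by
  have b := hT.toBudget
  have : SizeLE m N := ⟨by omega⟩
  have : SizeLE p N := ⟨by omega⟩
  have : SizeLE (m ⊕ p) N := ⟨by rw [Fintype.card_sum]; omega⟩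
  have : SizeLE Unit N := ⟨by simp; omega⟩
  have : SizeLE (Fin (Fintype.card m)) N := ⟨by simp; omega⟩
  have : SizeLE (Fin (Fintype.card p)) N := ⟨by simp; omega⟩
  have v {S' : Set (∀ w, K w)} {l l' : Type} {X : ∀ w, Matrix l' l (K w)} (h : entries X ⊆ S') :
      Steps μ 0 D S' X := Steps.of_subset h
  simp only [_root_.mergeColumns]
  refine (Steps.fromBlocks (v hA) (v hY) (b.zero (m := p) (n := m)) (v hB)).chain (by omega)
    fun S₁ h₁ hM => ?_
  refine (Steps.fromRows (b.zero (m := m) (n := Unit)) (v (hy.trans h₁))).chain (by omega)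
    fun S₂ h₂ ht => ?_
  replace hM := hM.trans h₂
  replace h₂ := h₁.trans h₂
  refine (b.krylov hM ht (d := Fintype.card p + 1) (ℓ := ℓ) (by omega) hℓ).chain (by omega)
    fun S₃ h₃ hR => ?_
  replace h₃ := h₂.trans h₃
  have hR' : ∀ {l l' : Type} (f : l → m ⊕ p) (g : l' → Fin (Fintype.card p + 1)),
      Steps μ 0 D S₃ (fun w => (_root_.krylov (fromBlocks (A w) (Y w) 0 (B w))
        (fromRows (0 : Matrix m Unit (K w)) (y w)) (Fintype.card p + 1)).submatrix f g) :=
    fun f g => (v hR).submatrix f g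
  have r₁ := hR' (Sum.inl : m → m ⊕ p) fun _ : Unit => Fin.last _
  have r₂ := hR' (Sum.inr : p → m ⊕ p) fun _ : Unit => Fin.last _
  have r₃ := hR' (Sum.inl : m → m ⊕ p) Fin.castSucc
  have r₄ := hR' (Sum.inr : p → m ⊕ p) Fin.castSucc
  refine (b.sub r₁ (b.mul r₃ (b.mul (hT.pinv r₄) r₂))).chain (by omega) fun S₄ h₄ hu => ?_
  replace h₄ := h₃.trans h₄
  refine (b.krylov (hA.trans h₄) hu (d := Fintype.card m) (ℓ := ℓ) (by omega) hℓ).chain (by omega)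
    fun S₅ h₅ hKu => ?_
  replace h₅ := h₄.trans h₅
  refine (b.krylov (hA.trans h₅) (hx.trans h₅) (d := Fintype.card m) (ℓ := ℓ) (by omega) hℓ).chain
    (by omega) fun S₆ h₆ hKw => ?_
  refine (b.mul (v (hKu.trans h₆)) (hT.pinv (v hKw))).chain (by omega) fun S₇ h₇ hH => ?_
  replace h₇ := (h₅.trans h₆).trans h₇
  have hc : Nat.clog 2 (Fintype.card m) ≤ ℓ := by
    refine (Nat.pow_le_pow_iff_right one_lt_two).1 (le_trans ?_ hℓ)
    rcases Nat.eq_zero_or_pos (Fintype.card m) with h0 | h0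
    · rw [h0]; simp; omega
    · exact (Nat.two_pow_clog_le h0).trans (by omega)
  refine (b.pow_two_pow hH (Nat.clog 2 (Fintype.card m))).chain (by omega) fun S₈ h₈ hQ => ?_
  replace h₈ := h₇.trans h₈
  refine (Steps.fromRows (b.sub (v (hx.trans h₈)) (b.mul (b.mul (b.mul (v hQ) (hT.pinv
    (b.mul (v hQ) (v hQ)))) (v hQ)) (v (hx.trans h₈)))) (v (hy.trans h₈))).of_le b.nonneg ?_
  omega

end CyclicColumnCost

/-! ### Cost of the recursion -/

section CyclicColumnCost

open Matrix

variable {W : Type*} {K : W → Type u} [∀ w, Field (K w)]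

theorem steps_selector {N : ℕ} {μ : ℝ} {D : Set W} {S : Set (∀ w, K w)} {m : Type} [Fintype m]
    [DecidableEq m] (hB : Budget.{u} N μ) [SizeLE m N] (s : Set m) :
    Steps μ 1 D S (fun w => (selector s : Matrix m m (K w))) := by
  classical
  refine (hB.diagonal (s.indicator 1)).congr fun w _ => ?_
  rw [selector]
  congr 1
  ext i
  by_cases hi : i ∈ s <;> simp [hi]

/-- The relevant size counts rows and generators together: both are split between the two recursive
calls, so the two sizes add up to the old one. Of 27 ℓ per level, 20 ℓ pays for the invariant
subspace and 7 ℓ for gluing. -/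
theorem computes_cyclicColumn {ℓ : ℕ} {μ : ℕ → ℝ} (hT : ∀ N, N ≤ 2 ^ ℓ → Toolkit K N (μ N))
    (hμ : ∀ a b, μ a + μ b ≤ μ (a + b)) (s : ℕ) {ι : Type} [Fintype ι] [DecidableEq ι]
    {D : Set W} {S : Set (∀ w, K w)} {A : ∀ w, Matrix ι ι (K w)} {B : ∀ w, Matrix ι (Idx s) (K w)}
    (hA : entries A ⊆ S) (hB : entries B ⊆ S) (hs : 2 * (Fintype.card ι + 2 ^ s) ≤ 2 ^ ℓ) :
    Computes (s * (27 * ℓ + 200) * μ (2 * (Fintype.card ι + 2 ^ s))) D S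
      (entries fun w => cyclicColumn s (A w) (B w)) := by
  induction s generalizing ι D S with
  | zero =>
    simp only [Nat.cast_zero, zero_mul]
    exact Computes.of_subset hB
  | succ s ih =>
    obtain ⟨N, hN⟩ : ∃ N, N = 2 * (Fintype.card ι + 2 ^ (s + 1)) := ⟨_, rfl⟩
    rw [← hN] at hs ⊢
    rw [pow_succ] at hN
    have hs0 : 0 < 2 ^ s := by positivity
    replace hT' := hT
    specialize hT N hs
    have b := hT.toBudget
    have : SizeLE ι N := ⟨by omega⟩
    have : SizeLE (Idx s) N := ⟨by rw [Idx.card]; omega⟩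
    have : SizeLE (Idx s ⊕ Idx s) N := ⟨by rw [Fintype.card_sum, Idx.card]; omega⟩
    have : SizeLE Unit N := ⟨by simp; omega⟩
    have : SizeLE (Idx (s + 1)) N := ⟨by rw [Idx.card, pow_succ]; omega⟩
    have v {D : Set W} {S' : Set (∀ w, K w)} {l l' : Type} {X : ∀ w, Matrix l' l (K w)}
        (h : entries X ⊆ S') : Steps (μ N) 0 D S' X := Steps.of_subset h
    obtain ⟨t, ht⟩ : ∃ t, t = Nat.clog 2 (Fintype.card ι) := ⟨_, rfl⟩
    have htℓ : t ≤ ℓ := by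
      refine (Nat.pow_le_pow_iff_right one_lt_two).1 (le_trans ?_ hs)
      rcases Nat.eq_zero_or_pos (Fintype.card ι) with h0 | h0
      · rw [ht, h0]; simp; omega
      · rw [ht]; exact (Nat.two_pow_clog_le h0).trans (by omega)
    obtain ⟨E, hE⟩ : ∃ E : ∀ w, Matrix ι ι (K w), E = fun w => krylovProj (A w)
      ((show Matrix ι (Idx s ⊕ Idx s) (K w) from B w).submatrix id Sum.inl) t := ⟨_, rfl⟩
    obtain ⟨H, hH⟩ : ∃ H : ∀ w, Matrix ι ι (K w), H = fun w => (pinv (E w)ᵀ)ᵀ := ⟨_, rfl⟩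
    have hcyc : ∀ w, cyclicColumn (s + 1) (A w) (B w) =
        cyclicColumnStep (cyclicColumn s) (columnSupport (H w)) (E w) (H w) (A w) (B w) := by
      intro w
      rw [hH, hE, ht]
      rfl
    have h1 : Computes ((20 * t + 2 : ℕ) * μ N) D S (entries E) := by
      refine (hT.krylovProj hA (B := fun w =>
        (show Matrix ι (Idx s ⊕ Idx s) (K w) from B w).submatrix id Sum.inl) ?_ t).mono le_rfl
        subset_rfl ?_
      · exact entries_subset_iff.2 fun i j => hB (mem_entries B i (Sum.inl j))
      · rw [hE]; exact Set.subset_union_right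
    suffices h : ∀ S', S ⊆ S' → entries E ⊆ S' → Computes (1 * μ N + ((7 * ℓ + 100 : ℕ) * μ N +
        s * (27 * ℓ + 200) * μ N + Nat.card (ι × ι))) D S'
        (entries fun w => cyclicColumn (s + 1) (A w) (B w)) by
      refine (h1.bind h).of_le ?_
      have h2 : (Nat.card (ι × ι) : ℝ) ≤ μ N := by
        refine le_trans ?_ b.sq_le
        rw [Nat.card_eq_fintype_card, Fintype.card_prod, sq]
        exact_mod_cast Nat.mul_le_mul (by omega) (by omega)
      have h3 : (t : ℝ) ≤ ℓ := by exact_mod_cast htℓ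
      have h4 := mul_le_mul_of_nonneg_right h3 b.nonneg
      have h5 : (0 : ℝ) ≤ ℓ * μ N := mul_nonneg (by positivity) b.nonneg
      push_cast
      linarith [b.nonneg]
    intro S₁ hS₁ hE₁
    have h2 : Steps (μ N) 1 D S₁ H := by
      rw [hH]
      exact (hT.pinv (v hE₁).transpose).transpose
    refine Computes.bind (by simpa [Steps] using h2) fun S₂ h₂ hH₂ => ?_
    replace hE₁ := hE₁.trans h₂
    replace h₂ := hS₁.trans h₂
    -- The dimension of the invariant subspace depends on the input. The zero pattern of H
    -- determines its coordinates T, and with them the shape of the blocks on each branch.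
    refine Computes.cases (fun (q : ι × ι) w => H w q.1 q.2) (fun q => hH₂ (mem_entries H _ _))
      fun Z => ?_
    obtain ⟨T, hTZ⟩ : ∃ T : Set ι, T = {j | ∃ i, (i, j) ∉ Z} := ⟨_, rfl⟩
    obtain ⟨D', hD'⟩ : ∃ D', D' = D ∩ {w | ∀ q : ι × ι, H w q.1 q.2 = 0 ↔ q ∈ Z} := ⟨_, rfl⟩
    rw [← hD']
    have hTH : ∀ w ∈ D', columnSupport (H w) = T := by
      intro w hw
      rw [hD'] at hw
      rw [hTZ, columnSupport]
      ext j
      exact exists_congr fun i => not_congr (hw.2 (i, j))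
    let := Fintype.ofFinite T
    let := Fintype.ofFinite (Tᶜ : Set ι)
    have hcard : Fintype.card T + Fintype.card (Tᶜ : Set ι) = Fintype.card ι := by
      classical
      rw [← Fintype.card_sum]
      exact Fintype.card_congr (Equiv.Set.sumCompl T)
    have : SizeLE T N := ⟨by omega⟩
    have : SizeLE (Tᶜ : Set ι) N := ⟨by omega⟩
    have : SizeLE (T ⊕ (Tᶜ : Set ι)) N := ⟨by rw [Fintype.card_sum]; omega⟩
    have one {S' : Set (∀ w, K w)} : Steps (μ N) 1 D' S' (fun w => (1 : Matrix ι ι (K w))) :=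
      b.one
    obtain ⟨P, hP⟩ : ∃ P : ∀ w, Matrix ι (T ⊕ (Tᶜ : Set ι)) (K w),
      P = fun w => adaptedBasis T (E w) (H w) := ⟨_, rfl⟩
    obtain ⟨P', hP'⟩ : ∃ P' : ∀ w, Matrix (T ⊕ (Tᶜ : Set ι)) ι (K w),
      P' = fun w => adaptedBasisInv T (E w) (H w) := ⟨_, rfl⟩
    obtain ⟨M, hM⟩ : ∃ M, M = fun w => P' w * A w * P w := ⟨_, rfl⟩
    obtain ⟨C, hC⟩ : ∃ C : ∀ w, Matrix (T ⊕ (Tᶜ : Set ι)) (Idx s ⊕ Idx s) (K w),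
      C = fun w => P' w * B w := ⟨_, rfl⟩
    have hstep : ∀ w ∈ D', cyclicColumn (s + 1) (A w) (B w) = P w * mergeColumns (M w).toBlocks₁₁
        (M w).toBlocks₁₂ (M w).toBlocks₂₂ (cyclicColumn s (M w).toBlocks₁₁ (C w).toBlocks₁₁)
        (cyclicColumn s (M w).toBlocks₂₂ (C w).toBlocks₂₂) := by
      intro w hw
      rw [hcyc, hTH w hw, hM, hC, hP, hP']
      rfl
    have hP₂ : Steps (μ N) 12 D' S₂ P := by
      rw [hP]
      exact ((b.add one (b.mul (b.sub one (steps_selector b T)) (b.mul (v hE₁) (v hH₂)))).of_le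
        b.nonneg (by omega)).submatrix _ _
    have hP'₂ : ∀ S', S₂ ⊆ S' → Steps (μ N) 12 D' S' P' := by
      intro S' h
      rw [hP']
      exact ((b.sub one (b.mul (b.sub one (steps_selector b T)) (b.mul (v (hE₁.trans h))
        (v (hH₂.trans h))))).of_le b.nonneg (by omega)).submatrix _ _
    suffices h : ∀ S', entries P ⊆ S' → entries M ⊆ S' → entries C ⊆ S' →
        Computes (s * (27 * ℓ + 200) * μ N + (7 * ℓ + 51 : ℕ) * μ N) D' S'
          (entries fun w => cyclicColumn (s + 1) (A w) (B w)) by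
      have h3 : Computes ((7 * ℓ + 100 : ℕ) * μ N + s * (27 * ℓ + 200) * μ N) D' S₂
          (entries fun w => cyclicColumn (s + 1) (A w) (B w)) := by
        refine (Computes.bind hP₂ fun S₃ h₃ hP₃ => Computes.bind (hP'₂ S₃ h₃) fun S₄ h₄ hP'₄ =>
          Computes.bind (c₂ := (1 : ℕ) * μ N + (s * (27 * ℓ + 200) * μ N + (7 * ℓ + 51 : ℕ) * μ N))
            (b.mul (b.mul (v hP'₄) (v ((hA.trans h₂).trans (h₃.trans h₄)))) (v (hP₃.trans h₄)))
            fun S₅ h₅ hM₅ => Computes.bind (b.mul (v (hP'₄.trans h₅))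
            (v ((hB.trans h₂).trans ((h₃.trans h₄).trans h₅)))) fun S₆ h₆ hC₆ =>
            h S₆ ((hP₃.trans h₄).trans (h₅.trans h₆)) ?_ ?_).of_le ?_
        · rw [hM]; exact hM₅.trans h₆
        · rw [hC]; exact hC₆
        · push_cast
          linarith [b.nonneg]
      refine h3
    intro S₃ hP₃ hM₃ hC₃
    have hM11 : entries (fun w => (M w).toBlocks₁₁) ⊆ S₃ :=
      entries_subset_iff.2 fun i j => hM₃ (mem_entries M _ _)
    have hM12 : entries (fun w => (M w).toBlocks₁₂) ⊆ S₃ :=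
      entries_subset_iff.2 fun i j => hM₃ (mem_entries M _ _)
    have hM22 : entries (fun w => (M w).toBlocks₂₂) ⊆ S₃ :=
      entries_subset_iff.2 fun i j => hM₃ (mem_entries M _ _)
    have hC11 : entries (fun w => (C w).toBlocks₁₁) ⊆ S₃ :=
      entries_subset_iff.2 fun i j => hC₃ (mem_entries C _ _)
    have hC22 : entries (fun w => (C w).toBlocks₂₂) ⊆ S₃ :=
      entries_subset_iff.2 fun i j => hC₃ (mem_entries C _ _)
    have ih1 := ih (D := D') hM11 hC11 (by omega)
    have ih2 := ih (D := D') hM22 hC22 (by omega)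
    -- Superadditivity merges the budgets of both halves, although their sizes may be very unequal.
    have hsum := hμ (2 * (Fintype.card T + 2 ^ s)) (2 * (Fintype.card (Tᶜ : Set ι) + 2 ^ s))
    rw [show 2 * (Fintype.card T + 2 ^ s) + 2 * (Fintype.card (Tᶜ : Set ι) + 2 ^ s) = N by omega]
      at hsum
    refine (Computes.bind ih1 fun S₄ h₄ h1₄ => Computes.bind (ih2.weaken h₄) fun S₅ h₅ h2₅ =>
      Steps.congr (b.mul (v (hP₃.trans (h₄.trans h₅))) (hT.mergeColumns (ℓ := ℓ)
        (hM11.trans (h₄.trans h₅)) (hM12.trans (h₄.trans h₅)) (hM22.trans (h₄.trans h₅))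
        (h1₄.trans h₅) h2₅ (by omega) hs)) hstep).of_le ?_
    have h6 : (0 : ℝ) ≤ s * (27 * ℓ + 200) := by positivity
    have h7 := mul_le_mul_of_nonneg_left hsum h6
    push_cast
    linarith [b.nonneg]

end CyclicColumnCost

/-! ### Cyclic vectors, nonderogatory matrices and the final test -/

section CyclicVector

open Matrix Polynomial

variable {k : Type*} [Field k]

/-- Modulo an annihilating polynomial q, the first deg q Krylov columns already span. -/
theorem Nonderogatory.of_isCyclicColumn {m : Type} [Fintype m] [DecidableEq m] {A : Matrix m m k}
    {v : Matrix m Unit k} (h : IsCyclicColumn A v) : Nonderogatory A := by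
  intro q hq h0
  have hs : Function.Surjective (krylov A v q.natDegree).mulVecLin := by
    intro x
    obtain ⟨r, hr⟩ := h (Matrix.of fun i _ => x i)
    have hq' : (q * C q.leadingCoeff⁻¹).Monic := monic_mul_leadingCoeff_inv hq
    have hr' : aeval A (r %ₘ (q * C q.leadingCoeff⁻¹)) = aeval A r :=
      aeval_modByMonic_eq_self_of_root (by rw [map_mul, h0, zero_mul])
    have hd : (r %ₘ (q * C q.leadingCoeff⁻¹)).degree < q.natDegree := by
      refine (degree_modByMonic_lt r hq').trans_le ?_
      rw [degree_mul_leadingCoeff_inv _ hq]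
      exact degree_le_natDegree
    obtain ⟨s, hs⟩ : ∃ s, s = r %ₘ (q * C q.leadingCoeff⁻¹) := ⟨_, rfl⟩
    rw [← hs] at hr' hd
    refine ⟨fun i => s.coeff i, ?_⟩
    have h1 := krylov_mul A v q.natDegree (Matrix.of fun i _ => s.coeff i)
    simp only [of_apply] at h1
    rw [Fin.sum_univ_eq_sum_range (fun i => C (s.coeff i) * X ^ i)] at h1
    have h2 : ∑ i ∈ Finset.range q.natDegree, C (s.coeff i) * X ^ i = s := by
      ext j
      simp only [finsetSum_coeff, coeff_C_mul, coeff_X_pow, mul_ite, mul_one, mul_zero,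
        Finset.sum_ite_eq, Finset.mem_range, ite_eq_left_iff, not_lt]
      exact fun hj => (coeff_eq_zero_of_degree_lt (hd.trans_le (by exact_mod_cast hj))).symm
    rw [h2, hr', ← hr] at h1
    ext i
    exact congrFun (congrFun h1 i) ()
  simpa using LinearMap.finrank_le_finrank_of_surjective hs

theorem hasCyclicVector_iff {n : ℕ} (A : Matrix (Fin n) (Fin n) k) :
    HasCyclicVector A ↔ ∃ v, IsCyclicColumn A v := by
  have key : ∀ (v : Fin n → k) (q : k[X]),
      (aeval A q).mulVec v ∈ Submodule.span k (Set.range fun i : ℕ => (A ^ i).mulVec v) := by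
    intro v q
    rw [aeval_eq_sum_range, Matrix.sum_mulVec]
    refine Submodule.sum_mem _ fun i _ => ?_
    rw [Matrix.smul_mulVec]
    exact Submodule.smul_mem _ _ (Submodule.subset_span ⟨i, rfl⟩)
  constructor
  · rintro ⟨v, hv⟩
    refine ⟨Matrix.of fun i _ => v i, fun x => ?_⟩
    suffices h : ∀ y ∈ Submodule.span k (Set.range fun i : ℕ => (A ^ i).mulVec v),
        ∃ q : k[X], y = (aeval A q).mulVec v by
      obtain ⟨q, hq⟩ := h (fun i => x i ()) (hv ▸ Submodule.mem_top)
      refine ⟨q, ?_⟩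
      ext i j
      exact congrFun hq i
    intro y hy
    induction hy using Submodule.span_induction with
    | mem y hy =>
      obtain ⟨i, rfl⟩ := hy
      exact ⟨X ^ i, by simp⟩
    | zero => exact ⟨0, by simp⟩
    | add x y _ _ hx hy =>
      obtain ⟨q, rfl⟩ := hx
      obtain ⟨r, rfl⟩ := hy
      exact ⟨q + r, by rw [map_add, Matrix.add_mulVec]⟩
    | smul c x _ hx =>
      obtain ⟨q, rfl⟩ := hx
      exact ⟨c • q, by rw [map_smul, Matrix.smul_mulVec]⟩
  · rintro ⟨v, hv⟩
    refine ⟨fun i => v i (), eq_top_iff.2 fun x _ => ?_⟩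
    obtain ⟨q, hq⟩ := hv (Matrix.of fun i _ => x i)
    convert key (fun i => v i ()) q using 1
    ext i
    exact congrFun (congrFun hq i) ()

/-- The unit vectors, padded by zeros to a power of two of columns. -/
noncomputable def unitColumns (n s : ℕ) (h : Fintype.card (Fin n) ≤ 2 ^ s) :
    Matrix (Fin n) (Idx s) k :=
  (fromCols 1 0).submatrix id (idxEquiv (Fin n) h).symm

theorem generates_unitColumns {n s : ℕ} (h : Fintype.card (Fin n) ≤ 2 ^ s)
    (A : Matrix (Fin n) (Fin n) k) : Generates A (unitColumns n s h) := by
  intro U _ hU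
  rw [eq_top_iff]
  rintro x -
  have := hU ((fromRows x (0 : Matrix _ Unit k)).submatrix (idxEquiv (Fin n) h).symm id)
  rw [unitColumns, submatrix_mul_equiv, fromCols_mul_fromRows] at this
  simpa using this

/-- A column that is cyclic for `A` if there is a cyclic column. -/
noncomputable def candidateColumn {n : ℕ} (A : Matrix (Fin n) (Fin n) k) : Matrix (Fin n) Unit k :=
  cyclicColumn (Nat.clog 2 n) A
    (unitColumns n (Nat.clog 2 n) (by simpa using Nat.le_pow_clog one_lt_two n))

theorem Nonderogatory.isCyclicColumn_candidateColumn {n : ℕ} {A : Matrix (Fin n) (Fin n) k}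
    (h : Nonderogatory A) : IsCyclicColumn A (candidateColumn A) :=
  isCyclicColumn_cyclicColumn _ _ _ h (generates_unitColumns _ _)

theorem hasCyclicVector_iff_nonderogatory {n : ℕ} (A : Matrix (Fin n) (Fin n) k) :
    HasCyclicVector A ↔ Nonderogatory A := by
  rw [hasCyclicVector_iff]
  exact ⟨fun ⟨_, hv⟩ => .of_isCyclicColumn hv, fun h => ⟨_, h.isCyclicColumn_candidateColumn⟩⟩

/-- The candidate is defined for every A. If A is derogatory it is meaningless, but the identity
then fails, since it would certify a cyclic column. -/
theorem hasCyclicVector_iff_krylov {n : ℕ} (A : Matrix (Fin n) (Fin n) k) :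
    HasCyclicVector A ↔ ∀ i j, (krylov A (candidateColumn A) n *
      pinv (krylov A (candidateColumn A) n) - 1) i j = 0 := by
  have h : (∀ i j, (krylov A (candidateColumn A) n *
      pinv (krylov A (candidateColumn A) n) - 1) i j = 0) ↔
      krylov A (candidateColumn A) n * pinv (krylov A (candidateColumn A) n) = 1 := by
    rw [← sub_eq_zero (b := (1 : Matrix (Fin n) (Fin n) k)), ← Matrix.ext_iff]
    rfl
  rw [h]
  refine ⟨fun hA => ?_, fun hA => (hasCyclicVector_iff A).2
    ⟨_, isCyclicColumn_of_krylov_mul_pinv hA⟩⟩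
  exact krylov_mul_pinv ((hasCyclicVector_iff_nonderogatory A).1 hA).isCyclicColumn_candidateColumn
    (by simp)

end CyclicVector

/-! ### The lower bound on the exponent and the total budget -/

section Exponent

open Matrix Filter

/-- Every output is an input or one of the values computed on the way. -/
theorem StraightLine.exists_finset {R : Type*} [CommRing R] {ι σ : Type} (p : StraightLine ι σ)
    (x : σ → R) : ∃ F : Finset R, F.card ≤ p.cost ∧ ∀ i, p.eval x i ∈ Set.range x ∪ F := by
  classical
  induction p with
  | output out => exact ⟨∅, by simp [StraightLine.cost], fun i => .inl ⟨_, rfl⟩⟩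
  | step op rest ih =>
    obtain ⟨F, hF, h⟩ := ih (extend x (op.eval x))
    refine ⟨insert (op.eval x) F, (Finset.card_insert_le _ _).trans ?_, fun i => ?_⟩
    · simpa [StraightLine.cost] using hF
    · rcases h i with ⟨(_ | s), hs⟩ | hs
      · right
        simp only [StraightLine.eval, ← hs, extend]
        simp
      · exact .inl ⟨s, hs⟩
      · right
        simp only [StraightLine.eval]
        exact Finset.mem_insert_of_mem hs

/-- Matrix multiplication has at least as many operations as outputs. -/
theorem StraightLine.sq_le_cost {n : ℕ}
    (p : StraightLine (Fin n × Fin n) ((Fin n × Fin n) ⊕ (Fin n × Fin n)))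
    (h : ∀ (R : Type u) [CommRing R] (A B : Matrix (Fin n) (Fin n) R) (i j : Fin n),
      p.eval (Sum.elim (fun p => A p.1 p.2) (fun p => B p.1 p.2)) (i, j) = (A * B) i j) :
    n ^ 2 ≤ p.cost := by
  -- The outputs 4 i + 6 are pairwise distinct, even and larger than 2. The inputs are 0, 2 or odd,
  -- so every output must be computed. `ULift` moves the integers to the required universe.
  obtain ⟨A, hA⟩ : ∃ A : Matrix (Fin n) (Fin n) (ULift.{u} ℤ), A = diagonal fun _ => ⟨2⟩ := ⟨_, rfl⟩
  obtain ⟨B, hB⟩ : ∃ B : Matrix (Fin n) (Fin n) (ULift.{u} ℤ),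
    B = Matrix.of fun i j => ⟨2 * (finProdFinEquiv (i, j) : ℕ) + 3⟩ := ⟨_, rfl⟩
  obtain ⟨F, hF, hp⟩ := p.exists_finset (Sum.elim (fun p => A p.1 p.2) (fun p => B p.1 p.2))
  have hAB : ∀ q : Fin n × Fin n, ((A * B) q.1 q.2).down = 4 * (finProdFinEquiv q : ℕ) + 6 := by
    rintro ⟨i, j⟩
    rw [hA, hB, diagonal_mul]
    simp only [of_apply, ULift.mul_down]
    ring
  have hAF : ∀ q : Fin n × Fin n, (A * B) q.1 q.2 ∈ F := by
    intro q
    have hq := hp q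
    rw [h (ULift.{u} ℤ) A B q.1 q.2] at hq
    refine hq.resolve_left ?_
    rintro ⟨r | r, hr⟩
    · have := hAB q
      rw [← hr] at this
      simp only [Sum.elim_inl, hA, diagonal_apply] at this
      split_ifs at this
      · simp only at this; omega
      · simp only [ULift.zero_down] at this; omega
    · have := hAB q
      rw [← hr] at this
      simp only [Sum.elim_inr, hB, of_apply] at this
      omega
  have hinj : Function.Injective fun q : Fin n × Fin n => (A * B) q.1 q.2 := by
    intro q r hqr
    have h1 := hAB q
    have h2 := hAB r
    simp only at hqr
    rw [hqr, h2] at h1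
    exact (finProdFinEquiv.injective (Fin.ext (by omega))).symm
  calc n ^ 2 = (Finset.univ : Finset (Fin n × Fin n)).card := by simp [sq]
    _ = (Finset.univ.image fun q : Fin n × Fin n => (A * B) q.1 q.2).card :=
      (Finset.card_image_of_injective _ hinj).symm
    _ ≤ F.card := Finset.card_le_card (Finset.image_subset_iff.2 fun q _ => hAF q)
    _ ≤ _ := hF

theorem IsMatMulExponent.two_le {ω : ℝ} (h : IsMatMulExponent.{u} ω) : 2 ≤ ω := by
  obtain ⟨S, hS, hS'⟩ := h
  by_contra! hω
  obtain ⟨c, hc⟩ := hS.bound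
  have h1 := ((tendsto_rpow_atTop (sub_pos.2 hω)).comp tendsto_natCast_atTop_atTop).eventually_gt_atTop c
  obtain ⟨n, h2, h3, h4⟩ := (hc.and (h1.and (eventually_ge_atTop 1))).exists
  have hn : (0 : ℝ) < n := by exact_mod_cast h4
  rw [Real.norm_of_nonneg (by positivity), Real.norm_of_nonneg (by positivity)] at h2
  rw [Function.comp_apply, Real.rpow_sub hn, lt_div_iff₀ (by positivity)] at h3
  have h5 : (n : ℝ) ^ (2 : ℝ) ≤ (S n).cost := by exact_mod_cast (S n).sq_le_cost (hS' n)
  linarith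

theorem IsMatMulExponent.exists_budget {ω : ℝ} (h : IsMatMulExponent.{u} ω) :
    ∃ C : ℝ, ∀ N : ℕ, Budget.{u} N (C * (N : ℝ) ^ ω) := by
  have hω := h.two_le
  obtain ⟨S, hS, hS'⟩ := h
  obtain ⟨c, hc⟩ := hS.bound
  obtain ⟨N₀, hN₀⟩ := eventually_atTop.1 hc
  -- The sum covers the finitely many sizes not reached by the asymptotic bound; the final 1 pays
  -- for the padding zero.
  obtain ⟨C, hC⟩ : ∃ C : ℝ, C = |c| + (∑ i ∈ Finset.range N₀, ((S i).cost : ℝ)) + 1 := ⟨_, rfl⟩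
  have hsum : (0 : ℝ) ≤ ∑ i ∈ Finset.range N₀, ((S i).cost : ℝ) :=
    Finset.sum_nonneg fun i _ => by positivity
  have hC1 : 1 ≤ C := by rw [hC]; linarith [abs_nonneg c]
  refine ⟨C, fun N => ⟨by positivity, ?_, fun hN => ⟨S N, ?_, fun R _ => hS' N R⟩⟩⟩
  · rcases eq_or_ne N 0 with rfl | hN
    · simp only [Nat.cast_zero, ne_eq, OfNat.ofNat_ne_zero, not_false_eq_true, zero_pow]
      positivity
    have h1 : (1 : ℝ) ≤ N := by exact_mod_cast Nat.one_le_iff_ne_zero.2 hN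
    calc (N : ℝ) ^ 2 = (N : ℝ) ^ (2 : ℝ) := by norm_cast
      _ ≤ (N : ℝ) ^ ω := Real.rpow_le_rpow_of_exponent_le h1 hω
      _ ≤ _ := le_mul_of_one_le_left (by positivity) hC1
  · have h1 : (1 : ℝ) ≤ (N : ℝ) ^ ω :=
      Real.one_le_rpow (by exact_mod_cast Nat.one_le_iff_ne_zero.2 hN) (by linarith)
    rcases lt_or_ge N N₀ with h2 | h2
    · have h3 : ((S N).cost : ℝ) ≤ ∑ i ∈ Finset.range N₀, ((S i).cost : ℝ) :=
        Finset.single_le_sum (f := fun i => ((S i).cost : ℝ)) (fun i _ => by positivity)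
          (Finset.mem_range.2 h2)
      calc ((S N).cost : ℝ) + 1 ≤ C := by rw [hC]; linarith [abs_nonneg c]
        _ ≤ _ := le_mul_of_one_le_right (by linarith) h1
    · have h3 := hN₀ N h2
      rw [Real.norm_of_nonneg (by positivity), Real.norm_of_nonneg (by positivity)] at h3
      have h4 : c * (N : ℝ) ^ ω ≤ |c| * (N : ℝ) ^ ω := by gcongr; exact le_abs_self c
      rw [hC]
      nlinarith

/-- A square matrix over some field. -/
structure MatrixOverField (n : ℕ) where
  carrier : Type u
  [field : Field carrier]
  matrix : Matrix (Fin n) (Fin n) carrier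

instance {n : ℕ} (w : MatrixOverField.{u} n) : Field w.carrier := w.field

/-- Taking all matrices over all fields as inputs at once makes the tree independent of the field.
-/
theorem solvable_hasCyclicVector {ℓ n : ℕ} (hℓ : ℓ = Nat.clog 2 n + 2) {μ : ℕ → ℝ}
    (hT : ∀ N, N ≤ 2 ^ ℓ → Toolkit (fun w : MatrixOverField.{u} n => w.carrier) N (μ N))
    (hμ : ∀ a b, μ a + μ b ≤ μ (a + b)) :
    Solvable (27 * (ℓ + 10) ^ 2 * μ (2 * (n + 2 ^ Nat.clog 2 n))) Set.univ
      (entries fun w : MatrixOverField.{u} n => w.matrix) (fun w => ¬ HasCyclicVector w.matrix) := by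
  have hn2 := Nat.le_pow_clog one_lt_two n
  obtain ⟨s, hs⟩ : ∃ s, s = Nat.clog 2 n := ⟨_, rfl⟩
  have hN2 : 2 * (n + 2 ^ s) ≤ 2 ^ ℓ := by
    rw [hℓ, pow_add, hs]; omega
  have hs1 : 1 ≤ 2 ^ s := Nat.one_le_two_pow
  obtain ⟨N, hN⟩ : ∃ N, N = 2 * (n + 2 ^ s) := ⟨_, rfl⟩
  rw [← hs, ← hN]
  rw [← hN] at hN2
  have hTN := hT N hN2
  have b := hTN.toBudget
  have : SizeLE (Fin n) N := ⟨by simp; omega⟩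
  have : SizeLE (Idx s) N := ⟨by rw [Idx.card]; omega⟩
  let A : ∀ w : MatrixOverField.{u} n, Matrix (Fin n) (Fin n) w.carrier := fun w => w.matrix
  have hcard : Fintype.card (Fin n) ≤ 2 ^ s := by simpa [hs] using hn2
  have hU : ∀ S, Steps (μ N) 1 Set.univ S
      (fun w : MatrixOverField.{u} n => (unitColumns n s hcard : Matrix _ _ w.carrier)) := by
    intro S
    refine (b.const fun i j => if (idxEquiv (Fin n) hcard).symm j = Sum.inl i then 1 else 0).congr
      fun w _ => ?_
    ext i j
    rw [unitColumns, submatrix_apply]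
    simp only [of_apply]
    rcases (idxEquiv (Fin n) hcard).symm j with j | j
    · simp [Matrix.one_apply, eq_comm]
    · simp
  have v {S' : Set (∀ w : MatrixOverField.{u} n, w.carrier)} {l l' : Type}
      {X : ∀ w : MatrixOverField.{u} n, Matrix l' l w.carrier} (h : entries X ⊆ S') :
      Steps (μ N) 0 Set.univ S' X := Steps.of_subset h
  suffices h : Computes ((s * (27 * ℓ + 200) + (2 * ℓ + 10)) * μ N) Set.univ (entries A)
      (entries fun w => krylov (A w) (candidateColumn (A w)) n *
        pinv (krylov (A w) (candidateColumn (A w)) n) - 1) by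
    have h1 : Solvable (Nat.card (Fin n × Fin n)) Set.univ (entries A ∪
        entries fun w => krylov (A w) (candidateColumn (A w)) n *
        pinv (krylov (A w) (candidateColumn (A w)) n) - 1)
        (fun w => ¬ HasCyclicVector (A w)) := by
      refine Solvable.forall_eq_zero (fun (q : Fin n × Fin n) w =>
        (krylov (A w) (candidateColumn (A w)) n *
        pinv (krylov (A w) (candidateColumn (A w)) n) - 1) q.1 q.2) (fun q => .inr ⟨q, rfl⟩) _
        fun w _ => ?_
      rw [hasCyclicVector_iff_krylov, Prod.forall]
    refine (h _ subset_rfl _ subset_rfl _ _ h1).mono ?_ subset_rfl fun f hf =>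
      ⟨f, hf, fun _ _ => rfl⟩
    have h2 : (Nat.card (Fin n × Fin n) : ℝ) ≤ μ N := by
      refine le_trans ?_ b.sq_le
      rw [Nat.card_eq_fintype_card, Fintype.card_prod, Fintype.card_fin, sq]
      exact_mod_cast Nat.mul_le_mul (by omega) (by omega)
    have h3 : (s : ℝ) = ℓ - 2 := by rw [hs, hℓ]; push_cast; ring
    have h4 : (1 : ℝ) + (s * (27 * ℓ + 200) + (2 * ℓ + 10)) ≤ 27 * (ℓ + 10) ^ 2 := by
      rw [h3]
      have : (0 : ℝ) ≤ ℓ := by positivity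
      nlinarith
    have h5 := mul_le_mul_of_nonneg_right h4 b.nonneg
    linarith
  refine ((Computes.bind (hU (entries A)) fun S₁ h₁ hU₁ => Computes.bind
    (computes_cyclicColumn hT hμ s h₁ hU₁ (by simpa [← hN] using hN2)) fun S₂ h₂ hv => ?_).of_le
    (c₁ := (1 : ℕ) * μ N + (s * (27 * ℓ + 200) * μ (2 * (Fintype.card (Fin n) + 2 ^ s)) +
      (2 * ℓ + 8 : ℕ) * μ N))) ?_
  · have hv' : entries (fun w => candidateColumn (A w)) ⊆ S₂ := by
      subst hs
      exact hv
    refine (b.krylov (ℓ := ℓ) (h₁.trans h₂) hv' (d := n) (by omega) hN2).chain (by omega)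
      fun S₃ h₃ hK => ?_
    exact (b.sub (b.mul (v hK) (hTN.pinv (v hK))) b.one).of_le b.nonneg (by omega)
  · rw [Fintype.card_fin, ← hN]
    push_cast
    linarith [b.nonneg]

end Exponent

/-! ### The computation trees -/

section Exponent

open Matrix Filter

theorem exists_computationTree {ω : ℝ} (h : IsMatMulExponent.{u} ω) :
    ∃ (T : (n : ℕ) → ComputationTree (Fin n × Fin n)) (κ : ℕ),
      (fun n : ℕ => ((T n).cost : ℝ)) =O[atTop] (fun n : ℕ => (n : ℝ) ^ ω * Real.log n ^ κ) ∧
      ∀ (k : Type u) [Field k] (n : ℕ) (A : Matrix (Fin n) (Fin n) k),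
        (T n).Decides (¬ HasCyclicVector A) (fun p => A p.1 p.2) := by
  have hω := h.two_le
  obtain ⟨C, hC⟩ := h.exists_budget
  have hC1 : 1 ≤ C := by simpa using (hC 1).sq_le
  have h2ω : (4 : ℝ) ≤ 2 ^ ω := by
    calc (4 : ℝ) = 2 ^ (2 : ℝ) := by norm_num
      _ ≤ _ := Real.rpow_le_rpow_of_exponent_le (by norm_num) hω
  obtain ⟨M, hM⟩ : ∃ M : ℕ → ℝ, M = fun N : ℕ => C * (N : ℝ) ^ ω := ⟨_, rfl⟩
  have hM2 : ∀ N, M (2 * N) = 2 ^ ω * M N := fun N => by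
    simp only [hM]
    push_cast
    rw [Real.mul_rpow (by norm_num) (by positivity)]
    ring
  have hM0 : ∀ N, 0 ≤ M N := fun N => by rw [hM]; positivity
  have hmono : Monotone M := by
    rw [hM]
    intro a b hab
    have : (a : ℝ) ≤ b := by exact_mod_cast hab
    dsimp only
    gcongr
  have hadd : ∀ a b, M a + M b ≤ M (a + b) := fun a b => by
    simp only [hM]
    push_cast
    rw [← mul_add]
    gcongr
    exact Real.add_rpow_le_rpow_add (by positivity) (by positivity) (by linarith)
  have key : ∀ n : ℕ, ∃ t : ComputationTree (Fin n × Fin n),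
      ((t.cost : ℝ) ≤ 27 * ((Nat.clog 2 n + 2 : ℕ) + 10) ^ 2 *
        ((200 * (Nat.clog 2 n + 2 + 1 : ℕ) + 4) * (2 ^ ω * M (2 * (n + 2 ^ Nat.clog 2 n))))) ∧
      ∀ (k : Type u) [Field k] (A : Matrix (Fin n) (Fin n) k),
        t.Decides (¬ HasCyclicVector A) (fun p => A p.1 p.2) := by
    intro n
    obtain ⟨t, ht, ht'⟩ := solvable_hasCyclicVector.{u} (n := n) rfl
      -- One more than ℓ, since a generalized inverse of size N ≤ 2^ℓ works in size up to 2 N.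
      (μ := fun N => (200 * (Nat.clog 2 n + 2 + 1 : ℕ) + 4) * (2 ^ ω * M N))
      (fun N hN => toolkit _ (fun N => by rw [hM]; exact hC N)
        (fun N => by rw [hM2]; exact mul_le_mul_of_nonneg_right h2ω (hM0 N)) hmono
        (by rw [pow_succ]; omega) (hM2 N).le)
      (fun a b => by
        rw [← mul_add, ← mul_add]
        gcongr
        exact hadd a b)
      Set.univ subset_rfl (Fin n × Fin n) (fun q w => w.matrix q.1 q.2)
      (by rintro _ ⟨q, rfl⟩; exact ⟨q, fun _ _ => rfl⟩)
    exact ⟨t, ht, fun k _ A => ht' ⟨k, A⟩ trivial⟩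
  choose T hT hT' using key
  -- Three logarithms: the depth of the recursion on generators, the doublings within each level,
  -- and the depth of the block recursion for generalized inverses.
  refine ⟨T, 3, ?_, fun k _ n A => hT' n k A⟩
  -- For n ≥ 3 we have log n ≥ 1, which absorbs additive constants. The factor 8^ω comes from 2 (n +
  -- 2^s) ≤ 6 n ≤ 8 n.
  refine Asymptotics.IsBigO.of_bound (27 * 15 ^ 2 * (204 * 15) * (2 ^ ω * (C * 8 ^ ω))) ?_
  filter_upwards [eventually_ge_atTop 3] with n hn
  have hn0 : (0 : ℝ) < n := by exact_mod_cast (by omega : 0 < n)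
  have hlog : 1 ≤ Real.log n := by
    rw [Real.le_log_iff_exp_le hn0]
    have : (3 : ℝ) ≤ n := by exact_mod_cast hn
    linarith [Real.exp_one_lt_d9]
  have hs := Nat.two_pow_clog_le (by omega : 0 < n)
  obtain ⟨s, hs'⟩ : ∃ s, s = Nat.clog 2 n := ⟨_, rfl⟩
  have h1 := hT n
  rw [← hs'] at hs h1
  have h2 : (s : ℝ) ≤ 1 + 2 * Real.log n := by
    have h3 : (2 : ℝ) ^ s ≤ 2 * n := by exact_mod_cast hs
    have h4 := Real.log_le_log (by positivity) h3
    rw [Real.log_pow, Real.log_mul (by norm_num) hn0.ne'] at h4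
    have h5 := Real.log_two_gt_d9
    have h6 : (0 : ℝ) ≤ s := by positivity
    by_contra! h7
    nlinarith
  rw [Real.norm_of_nonneg (by positivity), Real.norm_of_nonneg (by positivity)]
  refine h1.trans ?_
  have h3 : M (2 * (n + 2 ^ s)) ≤ C * (8 ^ ω * (n : ℝ) ^ ω) := by
    refine (hmono (by omega : 2 * (n + 2 ^ s) ≤ 8 * n)).trans ?_
    simp only [hM]
    push_cast
    rw [Real.mul_rpow (by norm_num) hn0.le]
  have h4 : ((s + 2 : ℕ) : ℝ) + 10 ≤ 15 * Real.log n := by push_cast; linarith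
  have h5 : (200 * (s + 2 + 1 : ℕ) + 4 : ℝ) ≤ 204 * (15 * Real.log n) := by push_cast; linarith
  calc 27 * (((s + 2 : ℕ) : ℝ) + 10) ^ 2 * ((200 * (s + 2 + 1 : ℕ) + 4) *
        (2 ^ ω * M (2 * (n + 2 ^ s))))
      ≤ 27 * (15 * Real.log n) ^ 2 * (204 * (15 * Real.log n) *
        (2 ^ ω * (C * (8 ^ ω * (n : ℝ) ^ ω)))) := by
        gcongr
        · exact mul_nonneg (by positivity) (mul_nonneg (by positivity) (hM0 _))
        · exact mul_nonneg (by positivity) (hM0 _)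
    _ = _ := by ring

end Exponent

/-! ### The derivative of the characteristic polynomial -/

section CharpolyDerivative

open Matrix Polynomial

variable {R : Type*} [CommRing R] {n : ℕ}

/-- Jacobi's formula. -/
theorem derivative_det_add_X_smul (A B : Matrix (Fin n) (Fin n) R) :
    eval 0 (derivative (det (A.map C + (X : R[X]) • B.map C))) = trace (adjugate A * B) := by
  have h1 : ∀ i, (adjugate A * B) i i = det (A.updateCol i (fun j => B j i)) := by
    intro i
    rw [← cramer_apply, cramer_eq_adjugate_mulVec]
    rfl
  simp only [trace, diag_apply, h1, det_apply, derivative_sum, eval_finsetSum]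
  rw [Finset.sum_comm]
  refine Finset.sum_congr rfl fun σ _ => ?_
  rw [← Finset.smul_sum, Units.smul_def, zsmul_eq_mul, derivative_mul, derivative_intCast, zero_mul,
    zero_add, eval_mul, eval_intCast, Units.smul_def, zsmul_eq_mul]
  congr 1
  rw [derivative_prod_finset, eval_finsetSum]
  refine Finset.sum_congr rfl fun i _ => ?_
  rw [eval_mul, eval_prod, ← Finset.mul_prod_erase _ _ (Finset.mem_univ i), mul_comm]
  congr 1
  · simp
  · refine Finset.prod_congr rfl fun j hj => ?_
    simp [updateCol_ne (Finset.ne_of_mem_erase hj)]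

/-- The coefficients of the adjugate of the characteristic matrix. -/
noncomputable def adjugateCoeff (A : Matrix (Fin n) (Fin n) R) (i : ℕ) : Matrix (Fin n) (Fin n) R :=
  Matrix.of fun a b => (adjugate (charmatrix A) a b).coeff i

theorem coeff_trace_adjugate (A N : Matrix (Fin n) (Fin n) R) (i : ℕ) :
    (trace (adjugate (charmatrix A) * N.map C)).coeff i = trace (adjugateCoeff A i * N) := by
  simp [trace, Matrix.mul_apply, adjugateCoeff, finsetSum_coeff]

theorem coeff_iterate_divX (p : R[X]) (i j : ℕ) : (divX^[i] p).coeff j = p.coeff (j + i) := by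
  induction i generalizing j with
  | zero => rfl
  | succ i ih => rw [Function.iterate_succ_apply', coeff_divX, ih]; congr 1; ring

/-- Compare coefficients of X^(i+1) in (X - A) adj(X - A) = χ_A. -/
theorem adjugateCoeff_recurrence (A : Matrix (Fin n) (Fin n) R) (i : ℕ) :
    adjugateCoeff A i = A * adjugateCoeff A (i + 1) + A.charpoly.coeff (i + 1) • 1 := by
  have h := mul_adjugate (charmatrix A)
  rw [charmatrix, Matrix.sub_mul, sub_eq_iff_eq_add] at h
  rw [← charmatrix] at h
  ext a b
  have h2 := congrArg (fun p => coeff p (i + 1)) (congrFun (congrFun h a) b)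
  simp only [scalar_apply, Matrix.add_apply, Matrix.smul_apply, smul_eq_mul, diagonal_mul,
    coeff_X_mul, coeff_add] at h2
  rw [adjugateCoeff, of_apply, h2, add_comm, Matrix.add_apply, Matrix.smul_apply]
  congr 1
  · simp [Matrix.mul_apply, adjugateCoeff, finsetSum_coeff]
  · rw [charpoly, Matrix.one_apply, Matrix.one_apply, smul_eq_mul]
    split_ifs <;> simp

/-- The quotients of χ_A by powers of X satisfy the same recurrence after evaluation at A, as
Horner's scheme shows. Both sides vanish for large i, so descending induction applies. -/
theorem adjugateCoeff_eq (A : Matrix (Fin n) (Fin n) R) (i : ℕ) :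
    adjugateCoeff A i = aeval A (divX^[i + 1] A.charpoly) := by
  obtain ⟨I, hI⟩ : ∃ I, ∀ j ≥ I, adjugateCoeff A j = aeval A (divX^[j + 1] A.charpoly) := by
    refine ⟨A.charpoly.natDegree + ∑ a, ∑ b, ((adjugate (charmatrix A) a b).natDegree + 1),
      fun j hj => ?_⟩
    have h1 : divX^[j + 1] A.charpoly = 0 := by
      ext m
      rw [coeff_iterate_divX, coeff_zero, coeff_eq_zero_of_natDegree_lt (by omega)]
    rw [h1, map_zero]
    ext a b
    rw [adjugateCoeff, of_apply, Matrix.zero_apply, coeff_eq_zero_of_natDegree_lt]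
    have h2 := Finset.single_le_sum (f := fun a => ∑ b, ((adjugate (charmatrix A) a b).natDegree + 1))
      (fun _ _ => Nat.zero_le _) (Finset.mem_univ a)
    have h3 := Finset.single_le_sum (f := fun b => ((adjugate (charmatrix A) a b).natDegree + 1))
      (fun _ _ => Nat.zero_le _) (Finset.mem_univ b)
    omega
  suffices h : ∀ d j, I ≤ j + d → adjugateCoeff A j = aeval A (divX^[j + 1] A.charpoly) from
    h I i (by omega)
  intro d
  induction d with
  | zero => exact fun j hj => hI j (by omega)
  | succ d ih =>
    intro j hj
    rw [adjugateCoeff_recurrence, ih (j + 1) (by omega)]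
    conv_rhs => rw [← divX_mul_X_add (divX^[j + 1] A.charpoly)]
    rw [← Function.iterate_succ_apply' divX, map_add, map_mul, aeval_X, aeval_C, coeff_iterate_divX,
      zero_add, Algebra.algebraMap_eq_smul_one]
    congr 1
    have : Commute X (divX^[j + 1 + 1] A.charpoly) := Commute.all _ _
    simpa using (this.map (aeval A)).eq

/-- Up to sign, the differential of the characteristic polynomial at `A`. -/
noncomputable def charpolyTangent (A : Matrix (Fin n) (Fin n) R) : Matrix (Fin n) (Fin n) R →ₗ[R] Fin n → R where
  toFun N i := trace (adjugateCoeff A i * N)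
  map_add' N N' := by ext i; simp [Matrix.mul_add]
  map_smul' c N := by ext i; simp

/-- The formula is polynomial in the entries, so it is compatible with inclusion into the field and
with reduction to the residue field. -/
theorem charpolyTangent_map {S : Type*} [CommRing S] (f : R →+* S) (A N : Matrix (Fin n) (Fin n) R)
    (i : Fin n) : charpolyTangent (A.map f) (N.map f) i = f (charpolyTangent A N i) := by
  have h : ∀ j, adjugateCoeff (A.map f) j = (adjugateCoeff A j).map f := by
    intro j
    ext a b
    have h1 := congrFun (congrFun ((mapRingHom f).map_adjugate (charmatrix A)) a) b
    simp only [RingHom.mapMatrix_apply, Matrix.map_apply, coe_mapRingHom] at h1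
    simp only [adjugateCoeff, of_apply, Matrix.map_apply]
    rw [← coeff_map, h1, ← charmatrix_map]
  simp only [charpolyTangent, LinearMap.coe_mk, AddHom.coe_mk, h, ← Matrix.map_mul]
  rw [AddMonoidHom.map_trace f]

end CharpolyDerivative

/-! ### Surjectivity of the differential -/

section Surjectivity

open Matrix Polynomial

theorem sum_divX_coeff {R : Type*} [CommRing R] {n : ℕ} (p : R[X]) (c : Fin n → R) (j : ℕ) :
    (∑ i, C (c i) * divX^[(i : ℕ) + 1] p).coeff j = ∑ i, c i * p.coeff (j + (i + 1)) := by
  simp only [finsetSum_coeff, coeff_C_mul, coeff_iterate_divX]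

/-- A linear form c kills the image exactly when tr(Φ(c)(A) N) = 0 for all N, that is, when Φ(c)(A)
= 0. As Φ is a bijection onto the polynomials of degree less than n, such forms correspond to
annihilating polynomials of low degree. -/
theorem surjective_charpolyTangent_iff {k : Type*} [Field k] {n : ℕ} (A : Matrix (Fin n) (Fin n) k) :
    Function.Surjective (charpolyTangent A) ↔ Nonderogatory A := by
  have hn : A.charpoly.natDegree = n := by simp
  have hlead : A.charpoly.coeff n = 1 := by
    have := A.charpoly_monic.coeff_natDegree
    rwa [hn] at this
  have hdeg : ∀ c : Fin n → k, (∑ i, C (c i) * divX^[(i : ℕ) + 1] A.charpoly) ∈ degreeLT k n := by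
    intro c
    rw [mem_degreeLT, degree_lt_iff_coeff_zero]
    intro m hm
    rw [sum_divX_coeff]
    refine Finset.sum_eq_zero fun i _ => ?_
    rw [coeff_eq_zero_of_natDegree_lt (by omega), mul_zero]
  let Φ : (Fin n → k) →ₗ[k] degreeLT k n :=
    { toFun := fun c => ⟨_, hdeg c⟩
      map_add' := fun c d => by
        ext1
        simp [add_mul, Finset.sum_add_distrib]
      map_smul' := fun a c => by
        ext1
        simp [Finset.smul_sum, smul_eq_C_mul, mul_assoc] }
  have hΦ : Function.Injective Φ := by
    rw [injective_iff_map_eq_zero]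
    intro c hc
    have h0 : ∀ j, ∑ i : Fin n, c i * A.charpoly.coeff (j + (i + 1)) = 0 := fun j => by
      rw [← sum_divX_coeff, show (∑ i, C (c i) * divX^[(i : ℕ) + 1] A.charpoly) = 0 from
        congrArg Subtype.val hc, coeff_zero]
    suffices h : ∀ m, ∀ i : Fin n, (i : ℕ) < m → c i = 0 from funext fun i => h n i i.2
    intro m
    induction m with
    | zero => exact fun i hi => absurd hi (Nat.not_lt_zero _)
    | succ m ih =>
      intro i hi
      rcases Nat.lt_or_ge i m with h | h
      · exact ih i h
      -- The i-th quotient is monic of degree n - 1 - i, so this coefficient isolates c i: earlier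
      -- terms vanish by induction, later ones have smaller degree.
      have hj := h0 (n - 1 - i)
      rw [Finset.sum_eq_single i] at hj
      · rwa [show n - 1 - i + (i + 1) = n by omega, hlead, mul_one] at hj
      · intro l _ hl
        rcases Nat.lt_or_ge l m with h' | h'
        · rw [ih l h', zero_mul]
        · rw [coeff_eq_zero_of_natDegree_lt, mul_zero]
          have : (l : ℕ) ≠ i := fun h => hl (Fin.ext h)
          omega
      · simp
  have hΦs : Function.Surjective Φ := by
    refine (LinearMap.injective_iff_surjective_of_finrank_eq_finrank ?_).1 hΦ
    exact (degreeLTEquiv k n).finrank_eq.symm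
  have hΦt : ∀ (c : Fin n → k) (N : Matrix (Fin n) (Fin n) k),
      ∑ i, c i * charpolyTangent A N i = trace (aeval A (Φ c : k[X]) * N) := by
    intro c N
    simp only [Φ, charpolyTangent, LinearMap.coe_mk, AddHom.coe_mk, map_sum, map_mul, aeval_C,
      Matrix.sum_mul, trace_sum, adjugateCoeff_eq, Algebra.algebraMap_eq_smul_one, Matrix.smul_mul,
      Matrix.one_mul, trace_smul, smul_eq_mul]
  constructor
  · intro h q hq hqA
    by_contra! hlt
    rw [Fintype.card_fin] at hlt
    obtain ⟨c, hc⟩ := hΦs ⟨q, by rwa [mem_degreeLT, ← natDegree_lt_iff_degree_lt hq]⟩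
    have hc0 : c = 0 := by
      ext i
      obtain ⟨N, hN⟩ := h (Pi.single i 1)
      have := hΦt c N
      rw [hN, hc] at this
      simpa [hqA, Pi.single_apply] using this
    rw [hc0, map_zero] at hc
    exact hq (congrArg Subtype.val hc).symm
  · intro h
    rw [← LinearMap.range_eq_top]
    by_contra hr
    obtain ⟨f, hf, hf'⟩ := Submodule.exists_dual_map_eq_bot_of_lt_top (lt_top_iff_ne_top.2 hr)
      inferInstance
    obtain ⟨c, hc⟩ : ∃ c : Fin n → k, c = fun i => f (Pi.single i 1) := ⟨_, rfl⟩
    have hfc : ∀ y, f y = ∑ i, c i * y i := by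
      intro y
      conv_lhs => rw [pi_eq_sum_univ' y]
      simp [hc, mul_comm]
    have h1 : aeval A (Φ c : k[X]) = 0 := by
      rw [ext_iff_trace_mul_right]
      intro N
      rw [← hΦt, ← hfc, Matrix.zero_mul, trace_zero]
      have : f (charpolyTangent A N) ∈ (LinearMap.range (charpolyTangent A)).map f :=
        Submodule.mem_map_of_mem ⟨N, rfl⟩
      rwa [hf', Submodule.mem_bot] at this
    have h2 : (Φ c : k[X]) = 0 := by
      by_contra h2
      have h3 := h _ h2 h1
      rw [Fintype.card_fin] at h3
      have h4 := mem_degreeLT.1 (Φ c).2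
      rw [← natDegree_lt_iff_degree_lt h2] at h4
      omega
    have h3 : c = 0 := hΦ (by rw [map_zero]; exact Subtype.ext h2)
    refine hf ?_
    ext y
    simp [hfc, h3]

/-- Nakayama's lemma, applied to the image in a finite free module. -/
theorem surjective_charpolyTangent_iff_residue {R : Type*} [CommRing R] [IsLocalRing R] {n : ℕ}
    (A : Matrix (Fin n) (Fin n) R) : Function.Surjective (charpolyTangent A) ↔
      Function.Surjective (charpolyTangent (A.map (IsLocalRing.residue R))) := by
  have hlift : ∀ {m : Type} (y : m → IsLocalRing.ResidueField R),
      ∃ x : m → R, ∀ i, IsLocalRing.residue R (x i) = y i := fun y =>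
    ⟨fun i => (IsLocalRing.residue_surjective (y i)).choose, fun i =>
      (IsLocalRing.residue_surjective (y i)).choose_spec⟩
  constructor
  · intro h y
    obtain ⟨x, hx⟩ := hlift y
    obtain ⟨N, rfl⟩ := h x
    refine ⟨N.map (IsLocalRing.residue R), ?_⟩
    ext i
    rw [charpolyTangent_map, hx]
  · intro h
    rw [← LinearMap.range_eq_top, eq_top_iff]
    refine Submodule.le_of_le_smul_of_le_jacobson_bot (I := IsLocalRing.maximalIdeal R)
      Module.Finite.fg_top (IsLocalRing.maximalIdeal_le_jacobson _) ?_
    intro y _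
    obtain ⟨N', hN'⟩ := h fun i => IsLocalRing.residue R (y i)
    obtain ⟨x, hx⟩ := hlift fun p : Fin n × Fin n => N' p.1 p.2
    obtain ⟨N, hN⟩ : ∃ N : Matrix (Fin n) (Fin n) R, N = Matrix.of fun i j => x (i, j) := ⟨_, rfl⟩
    have hNN : N.map (IsLocalRing.residue R) = N' := by
      ext i j
      rw [hN]
      exact hx (i, j)
    refine Submodule.mem_sup.2 ⟨charpolyTangent A N, ⟨N, rfl⟩, y - charpolyTangent A N, ?_,
      add_sub_cancel _ _⟩
    have hz : ∀ i, (y - charpolyTangent A N) i ∈ IsLocalRing.maximalIdeal R := by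
      intro i
      rw [← IsLocalRing.residue_eq_zero_iff, Pi.sub_apply, map_sub, ← charpolyTangent_map, hNN, hN',
        sub_self]
    rw [pi_eq_sum_univ' (y - charpolyTangent A N)]
    exact Submodule.sum_mem _ fun i _ => Submodule.smul_mem_smul (hz i) trivial

end Surjectivity

/-! ### The analytic differential -/

section Differential

open Matrix Polynomial

variable {K : Type*} [NontriviallyNormedField K] {n : ℕ}

theorem charpolyMap_eq_eval (A : Matrix (Fin n) (Fin n) K) (i : Fin n) : charpolyMap K n A i =
    MvPolynomial.eval (fun p : Fin n × Fin n => A p.1 p.2) ((charpoly.univ K (Fin n)).coeff i) := by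
  have := charpoly.univ_coeff_eval₂Hom (Fin n) (RingHom.id K) (fun p => A p.1 p.2) i
  rw [MvPolynomial.coe_eval₂Hom] at this
  exact this.symm

theorem differentiableAt_charpolyMap [CompleteSpace K] (A : Matrix (Fin n) (Fin n) K) :
    DifferentiableAt K (charpolyMap K n) A := by
  have h : ∀ x : Fin n → Fin n → K, DifferentiableAt K
      (fun x : Fin n → Fin n → K => charpolyMap K n (Matrix.of x)) x := by
    intro x
    rw [differentiableAt_pi]
    intro i
    simp only [charpolyMap_eq_eval]
    have := AnalyticOnNhd.eval_continuousLinearMap' (𝕜 := K) (E := Fin n → Fin n → K) (B := K)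
      (fun p : Fin n × Fin n => (ContinuousLinearMap.proj (R := K) (φ := fun _ => K) p.2).comp
        (ContinuousLinearMap.proj (R := K) (φ := fun _ => Fin n → K) p.1)) ((charpoly.univ K (Fin n)).coeff i)
    exact (this x trivial).differentiableAt
  exact h A

theorem hasDerivAt_coeff_eval_C (Q : K[X][X]) (i : ℕ) (t : K) :
    HasDerivAt (fun t => (Q.eval (C t)).coeff i) (((derivative Q).eval (C t)).coeff i) t := by
  induction Q using Polynomial.induction_on' with
  | add p q hp hq =>
    simp only [eval_add, coeff_add, derivative_add]
    exact hp.add hq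
  | monomial m a =>
    have h : ∀ (m : ℕ) (a : K[X]) (t : K), ((monomial m a).eval (C t)).coeff i = a.coeff i * t ^ m :=
      fun m a t => by rw [eval_monomial, ← C_pow, coeff_mul_C]
    rw [derivative_monomial]
    simp only [h]
    have := (hasDerivAt_pow m t).const_mul (a.coeff i)
    refine this.congr_deriv ?_
    rw [← nsmul_eq_mul', coeff_smul, nsmul_eq_mul]
    ring

/-- Along the line A + tN the characteristic polynomial is a polynomial in t over K[X], so its
derivative can be taken formally and Jacobi's formula applies. -/
theorem fderiv_charpolyMap [CompleteSpace K] (A N : Matrix (Fin n) (Fin n) K) (i : Fin n) :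
    fderiv K (charpolyMap K n) A N i = -charpolyTangent A N i := by
  have h1 : HasDerivAt (fun t : K => charpolyMap K n (A + t • N)) (fderiv K (charpolyMap K n) A N) 0 :=
    HasFDerivAt.hasLineDerivAt (E := Fin n → Fin n → K)
      (differentiableAt_charpolyMap A).hasFDerivAt N
  have h2 := hasDerivAt_pi.1 h1 i
  -- The outer variable is t; the inner one is that of the characteristic polynomial.
  have h3 := hasDerivAt_coeff_eval_C
    (det ((charmatrix A).map C + (X : K[X][X]) • ((-N).map C).map C)) i 0
  rw [C_0, derivative_det_add_X_smul] at h3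
  have h4 : (trace (adjugate (charmatrix A) * (-N).map C)).coeff (i : ℕ) = -charpolyTangent A N i := by
    rw [coeff_trace_adjugate, Matrix.mul_neg, trace_neg]
    rfl
  rw [h4] at h3
  have h5 : (fun t : K => charpolyMap K n (A + t • N) i) = fun t => (eval (C t)
      (det ((charmatrix A).map C + (X : K[X][X]) • ((-N).map C).map C))).coeff i := by
    ext t
    change (det (charmatrix (A + t • N))).coeff i = _
    rw [← coe_evalRingHom, RingHom.map_det]
    congr 2
    ext a b : 2
    simp [charmatrix_apply]
    ring
  rw [h5] at h2
  exact h2.unique h3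

end Differential

/-! ### Precision lattices -/

section PrecisionLattice

open Matrix Polynomial

variable {K : Type*} [NontriviallyNormedField K] {n : ℕ}

theorem mem_bigO_iff [IsUltrametricDist K] {π : IntegerRing K} {m : ℤ} {x : K} :
    x ∈ bigO π m ↔ ∃ r : IntegerRing K, x = (π : K) ^ m * r := by
  rw [bigO, Submodule.mem_span_singleton]
  refine exists_congr fun r => ?_
  rw [eq_comm, mul_comm]
  rfl

theorem coeff_charpolyDifferential [CompleteSpace K] (A N : Matrix (Fin n) (Fin n) K) (i : Fin n) :
    (charpolyDifferential A N : K[X]).coeff i = -charpolyTangent A N i := by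
  rw [← fderiv_charpolyMap]
  have := congrFun ((degreeLTEquiv K n).apply_symm_apply (fderiv K (charpolyMap K n) A N)) i
  exact this

theorem degreeLT_ext {P Q : degreeLT K n} (h : ∀ i : Fin n, (P : K[X]).coeff i = (Q : K[X]).coeff i) :
    P = Q :=
  (degreeLTEquiv K n).injective (funext h)

theorem charpolyDifferential_smul_map [IsUltrametricDist K] [CompleteSpace K]
    (A N : Matrix (Fin n) (Fin n) (IntegerRing K)) (c : K) (i : Fin n) : (charpolyDifferential (A.map (algebraMap (IntegerRing K) K))
      (c • N.map (algebraMap (IntegerRing K) K)) : K[X]).coeff i =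
        c * ((-charpolyTangent A N i : IntegerRing K) : K) := by
  rw [coeff_charpolyDifferential, map_smul, Pi.smul_apply, charpolyTangent_map, smul_eq_mul]
  push_cast
  rw [mul_neg]
  rfl

/-- Both lattices are π^m times their integral versions, so the scaling cancels. The inclusion holds
because the differential is integral, and equality is surjectivity over the ring of integers. -/
theorem charpolyPrecision_lt_iff [IsUltrametricDist K] [CompleteSpace K] {π : IntegerRing K}
    (hπ : (π : K) ≠ 0) (m : ℤ) (A : Matrix (Fin n) (Fin n) (IntegerRing K)) :
    charpolyPrecision (A.map (algebraMap (IntegerRing K) K)) π m < flatPolyLattice π m n ↔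
      ¬ Function.Surjective (charpolyTangent A) := by
  have hπm : (π : K) ^ m ≠ 0 := zpow_ne_zero _ hπ
  have hflat : ∀ N ∈ flatMatrixLattice π m n, ∃ N₀ : Matrix (Fin n) (Fin n) (IntegerRing K),
      N = (π : K) ^ m • N₀.map (algebraMap (IntegerRing K) K) := by
    intro N hN
    have hN' : ∀ i j, ∃ r : IntegerRing K, N i j = (π : K) ^ m * r := fun i j =>
      mem_bigO_iff.1 (hN i j)
    choose r hr using hN'
    exact ⟨Matrix.of r, by ext i j; exact hr i j⟩
  have hflat' : ∀ N₀ : Matrix (Fin n) (Fin n) (IntegerRing K),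
      (π : K) ^ m • N₀.map (algebraMap (IntegerRing K) K) ∈ flatMatrixLattice π m n :=
    fun N₀ i j => mem_bigO_iff.2 ⟨N₀ i j, rfl⟩
  have hzero : ∀ (P : degreeLT K n) (i : ℕ), n ≤ i → (P : K[X]).coeff i = 0 := fun P i hi =>
    coeff_eq_zero_of_degree_lt ((mem_degreeLT.1 P.2).trans_le (by exact_mod_cast hi))
  have hle : charpolyPrecision (A.map (algebraMap (IntegerRing K) K)) π m ≤
      flatPolyLattice π m n := by
    rintro _ ⟨N, hN, rfl⟩ i
    obtain ⟨N₀, rfl⟩ := hflat N hN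
    rcases Nat.lt_or_ge i n with hi | hi
    · exact mem_bigO_iff.2 ⟨_, charpolyDifferential_smul_map A N₀ _ ⟨i, hi⟩⟩
    · rw [hzero _ i hi]
      exact (bigO π m).zero_mem
  rw [lt_iff_le_not_ge, and_iff_right hle]
  refine not_congr ⟨fun h y => ?_, fun h P hP => ?_⟩
  · obtain ⟨P, hP⟩ : ∃ P : degreeLT K n, P = (degreeLTEquiv K n).symm
      fun i => (π : K) ^ m * ((y i : IntegerRing K) : K) := ⟨_, rfl⟩
    have hPi : ∀ i : Fin n, (P : K[X]).coeff i = (π : K) ^ m * ((y i : IntegerRing K) : K) := by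
      intro i
      rw [hP]
      exact congrFun ((degreeLTEquiv K n).apply_symm_apply _) i
    have hPf : P ∈ flatPolyLattice π m n := by
      intro i
      rcases Nat.lt_or_ge i n with hi | hi
      · exact mem_bigO_iff.2 ⟨_, hPi ⟨i, hi⟩⟩
      · rw [hzero _ i hi]
        exact (bigO π m).zero_mem
    obtain ⟨N, hN, hNP⟩ := h hPf
    obtain ⟨N₀, rfl⟩ := hflat N hN
    refine ⟨-N₀, ?_⟩
    ext i
    have h1 := charpolyDifferential_smul_map A N₀ ((π : K) ^ m) i
    have h2 : charpolyDifferential (A.map (algebraMap (IntegerRing K) K))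
      ((π : K) ^ m • N₀.map (algebraMap (IntegerRing K) K)) = P := hNP
    rw [h2, hPi] at h1
    rw [map_neg, Pi.neg_apply]
    exact (mul_left_cancel₀ hπm h1).symm
  · have hP' : ∀ i : Fin n, ∃ r : IntegerRing K, (P : K[X]).coeff i = (π : K) ^ m * r := fun i =>
      mem_bigO_iff.1 (hP i)
    choose r hr using hP'
    obtain ⟨N₀, hN₀⟩ := h (-r)
    refine ⟨_, hflat' N₀, degreeLT_ext fun i => ?_⟩
    refine (charpolyDifferential_smul_map A N₀ _ i).trans ?_
    rw [hN₀, hr, Pi.neg_apply, neg_neg]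

end PrecisionLattice

theorem corollary2p4 :
    -- the criterion
    (∀ (K : Type u) [NontriviallyNormedField K] [IsUltrametricDist K] [CompleteSpace K]
        [IsDiscreteValuationRing (IntegerRing K)]
        (π : IntegerRing K) (_ : Irreducible π) (m : ℤ) (n : ℕ)
        (M : Matrix.GeneralLinearGroup (Fin n) (IntegerRing K)),
      DifferentiableAt K (charpolyMap K n)
          (M.val.map (algebraMap (IntegerRing K) K)) ∧
      (charpolyPrecision (M.val.map (algebraMap (IntegerRing K) K)) π m <
          flatPolyLattice π m n ↔
        ¬ HasCyclicVector (M.val.map (IsLocalRing.residue (IntegerRing K))))) ∧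
    -- its cost, in operations in the residue field
    (∀ ω : ℝ, IsMatMulExponent.{u} ω →
      ∃ (T : (n : ℕ) → ComputationTree (Fin n × Fin n)) (κ : ℕ),
        (fun n : ℕ => ((T n).cost : ℝ)) =O[Filter.atTop]
          (fun n : ℕ => (n : ℝ) ^ ω * Real.log n ^ κ) ∧
        ∀ (K : Type u) [NontriviallyNormedField K] [IsUltrametricDist K] [CompleteSpace K]
          [IsDiscreteValuationRing (IntegerRing K)] (n : ℕ)
          (A : Matrix (Fin n) (Fin n) (IsLocalRing.ResidueField (IntegerRing K))),
          (T n).Decides (¬ HasCyclicVector A) (fun p => A p.1 p.2)) := by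
  refine ⟨fun K _ _ _ _ π hπ m n M => ⟨differentiableAt_charpolyMap _, ?_⟩, fun ω hω => ?_⟩
  · rw [charpolyPrecision_lt_iff (fun h => hπ.ne_zero (Subtype.ext h)),
      surjective_charpolyTangent_iff_residue, surjective_charpolyTangent_iff,
      hasCyclicVector_iff_nonderogatory]
  · obtain ⟨T, κ, hT, hT'⟩ := exists_computationTree hω
    exact ⟨T, κ, hT, fun K _ _ _ _ n A => hT' _ n A⟩
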